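/- Let $(\mathbb X,\mathcal X)$ be a measurable space with a $\sigma$-finite measure $\lambda$, and let $\eta$ be a Poisson process on $\mathbb X$ with intensity measure $\lambda$, i.e. a random $\sigma$-finite measure with values in $\{0,1,2,\dots\}\cup\{\infty\}$ such that $\eta(B)$ is Poisson distributed with mean $\lambda(B)$ for every measurable $B$ (a.s. infinite if $\lambda(B)=\infty$) and $\eta(B_1),\dots,\eta(B_k)$ are independent for disjoint measurable $B_1,\dots,B_k$. Let $\eta^{(m)}$ denote the $m$-th factorial measure, $$\int g\,d\eta^{(m)}=\int\cdots\int g(x_1,\dots,x_m)\,\Big(\eta-\sum_{j=1}^{m-1}\delta_{x_j}\Big)(dx_m)\cdots(\eta-\delta_{x_1})(dx_2)\,\eta(dx_1).$$ Let $L^1_s(\lambda^n)$ be the set of measurable, symmetric, $\lambda^n$-integrable functions $f:\mathbb X^n\to\mathbb R$. For $n\ge1$ and $f\in L^1_s(\lambda^n)$ let $$I_n(f)=\sum_{J\subset\{1,\dots,n\}}(-1)^{n-|J|}\int\!\!\int f(x_1,\dots,x_n)\,\eta^{(|J|)}(dx_J)\,\lambda^{n-|J|}(dx_{J^c})$$ be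 the pathwise multiple Wiener--Itô integral. For $n_1,\dots,n_\ell\ge1$ let $\Pi(n_1,\dots,n_\ell)$ be the set of partitions $\sigma$ of $\{1,\dots,n_1+\dots+n_\ell\}$ no block of which contains two elements of the same row $J_i=\{j: n_1+\dots+n_{i-1}<j\le n_1+\dots+n_i\}$. For a function $g$ of $n_1+\dots+n_\ell$ variables let $g_\sigma$ be the function of $|\sigma|$ variables obtained from $g$ by identifying the variables belonging to the same block of $\sigma$, where $|\sigma|$ is the number of blocks. Let $F=\sum_{n=1}^\infty I_n(f_n)$ with $f_n\in L^1_s(\lambda^n)$, $n\ge1$. Assume that for all $\ell\ge1$ $$\int\Big(\bigotimes_{i=1}^{\ell}|f_{n_i}|\Big)_\sigma\,d\lambda^{|\sigma|}<\infty\quad\text{for all } n_1,\dots,n_\ell\ge1 \text{ and all } \sigma\in\Pi(n_1,\dots,n_\ell),$$ and $$\mathbb E\Big(\sum_{n=1}^\infty|I_n(f_n)|\Big)^{\ell}<\infty.$$ Suppose moreover that $f_n\ge0$ for all $n\ge1$ and that $\|f_{n_0}\|_{L^2(\lambda^{n_0})}>0$ for some $n_0\ge2$. Then $$\mathbb E\exp(sF)=\infty\quad\text{for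 all } s>0.$$ Moreover, there is a constant $c>0$ such that for every integer $\ell\ge1$ divisible by $6$ the $\ell$-th moment of $F$ and the $\ell$-th cumulant $\gamma_\ell(F)=(-\mathbf i)^\ell\frac{d^\ell}{dz^\ell}\log\mathbb E\,e^{\mathbf i zF}\big|_{z=0}$ (which is real) satisfy $$\mathbb E F^\ell\ \ge\ \frac{\ell!\,(\ell/6)!}{(6!)^\ell}\,c^\ell\qquad\text{and}\qquad \gamma_\ell(F)\ \ge\ \frac{\ell!\,(\ell/6)!}{(6!)^\ell}\,c^\ell .$$ -/

import Mathlib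

open MeasureTheory ProbabilityTheory
open scoped ENNReal NNReal Nat

namespace PoissonChaos

/-- `η` is a Poisson process on `X` with intensity measure `lam`, defined on `(Ω, P)`: a random
element of the space of `σ`-finite measures with values in `{0, 1, 2, …} ∪ {∞}`, whose value on a
measurable set `B` is Poisson distributed with mean `lam B` (almost surely infinite when
`lam B = ∞`) and whose values on disjoint measurable sets are independent.
The `σ`-algebra on `Measure X` is the one generated by the evaluations `m ↦ m B`. -/
structure IsPoissonProcess {Ω X : Type*} [MeasurableSpace Ω] [MeasurableSpace X]
    (P : Measure Ω) (lam : Measure X) (η : Ω → Measure X) : Prop where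
  measurable : Measurable η
  sigmaFinite : ∀ ω, SigmaFinite (η ω)
  integerValued : ∀ ω, ∀ B : Set X, MeasurableSet B → ∃ k : ℕ∞, η ω B = (k : ℝ≥0∞)
  poisson_law : ∀ B : Set X, MeasurableSet B → lam B ≠ ∞ →
    P.map (fun ω => η ω B)
      = (poissonMeasure (lam B).toNNReal).map (fun k : ℕ => (k : ℝ≥0∞))
  infinite_law : ∀ B : Set X, MeasurableSet B → lam B = ∞ → ∀ᵐ ω ∂P, η ω B = ∞
  indep : ∀ (k : ℕ) (B : Fin k → Set X), (∀ i, MeasurableSet (B i)) →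
    Pairwise (fun i j => Disjoint (B i) (B j)) → iIndepFun (fun i ω => η ω (B i)) P

/-- The integral `∫ f dμ⁽ᵐ⁾` against the `m`-th factorial measure of `μ`, that is, the iterated
integral of `f` in which the `k`-th variable is integrated against `μ - δ_{x₁} - ⋯ - δ_{x_{k-1}}`,
the last variable innermost. -/
noncomputable def factorialIntegral {X : Type*} [MeasurableSpace X] (μ : Measure X) :
    (m : ℕ) → ((Fin m → X) → ℝ) → ℝ
  | 0, f => f Fin.elim0
  | m + 1, f => factorialIntegral μ m fun x =>
      (∫ y, f (Fin.snoc (α := fun _ => X) x y) ∂μ)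
        - ∑ j : Fin m, f (Fin.snoc (α := fun _ => X) x (x j))

/-- The point of `Xⁿ` with coordinates `u` (in increasing order) on `J` and `z` off `J`. -/
def glue {X : Type*} {n : ℕ} (J : Finset (Fin n)) (u : Fin J.card → X)
    (z : {i : Fin n // i ∉ J} → X) : Fin n → X :=
  fun i => if h : i ∈ J then u ((J.orderIsoOfFin rfl).symm ⟨i, h⟩) else z ⟨i, h⟩

/-- The pathwise multiple Wiener-Itô integral `I_n(f)` at the configuration `μ`, for a Poisson
process with intensity measure `lam`. -/
noncomputable def wienerIto {X : Type*} [MeasurableSpace X] (lam : Measure X) (n : ℕ)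
    (f : (Fin n → X) → ℝ) (μ : Measure X) : ℝ :=
  ∑ J : Finset (Fin n), (-1 : ℝ) ^ (n - J.card) *
    ∫ z : {i : Fin n // i ∉ J} → X, factorialIntegral μ J.card (fun u => f (glue J u z))
      ∂(Measure.pi fun _ => lam)

/-- `f` belongs to `L¹ₛ(lamⁿ)`: measurable, symmetric and integrable. -/
structure IsSymmL1 {X : Type*} [MeasurableSpace X] (lam : Measure X) (n : ℕ)
    (f : (Fin n → X) → ℝ) : Prop where
  measurable : Measurable f
  symm : ∀ (τ : Equiv.Perm (Fin n)) (x : Fin n → X), f (fun i => x (τ i)) = f x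
  integrable : Integrable f (Measure.pi fun _ => lam)

/-- The tensor product of `f₁, …, f_ℓ`. The `n₁ + ⋯ + n_ℓ` variables are labelled by pairs
`⟨i, j⟩`, the row `i` holding the variables of `f i`. -/
def tensor {X : Type*} {ℓ : ℕ} {n : Fin ℓ → ℕ} (f : (i : Fin ℓ) → (Fin (n i) → X) → ℝ) :
    (((i : Fin ℓ) × Fin (n i)) → X) → ℝ :=
  fun x => ∏ i, f i (fun j => x ⟨i, j⟩)

/-- `g_σ`: the variables of `g` in the same block of the partition `σ` (an equivalence relation
on the labels, whose classes are the blocks) are identified. -/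
def identify {X ι : Type*} (σ : Setoid ι) (g : (ι → X) → ℝ) : (Quotient σ → X) → ℝ :=
  fun y => g (fun i => y (Quotient.mk σ i))

/-- No block of the partition `σ` contains two entries of the same row. -/
def NonFlat {ℓ : ℕ} {n : Fin ℓ → ℕ} (σ : Setoid ((i : Fin ℓ) × Fin (n i))) : Prop :=
  ∀ (i : Fin ℓ) (j j' : Fin (n i)), σ ⟨i, j⟩ ⟨i, j'⟩ → j = j'

open Classical in
/-- The integral `∫ g dlam^{|σ|}` in `[0, ∞]` of a non-negative function with one variable for
each block of the partition `σ`. -/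
noncomputable def blockIntegral {X ι : Type*} [MeasurableSpace X] [Fintype ι] (lam : Measure X)
    (σ : Setoid ι) (g : (Quotient σ → X) → ℝ) : ℝ≥0∞ :=
  ∫⁻ y, ENNReal.ofReal (g y) ∂(Measure.pi fun _ : Quotient σ => lam)

/-- The `ℓ`-th cumulant of the real random variable `Y`:
`(-i)^ℓ` times the `ℓ`-th derivative at `0` of `z ↦ log E exp(i z Y)`. -/
noncomputable def cumulant {Ω : Type*} [MeasurableSpace Ω] (P : Measure Ω) (ℓ : ℕ) (Y : Ω → ℝ) :
    ℂ :=
  (-Complex.I) ^ ℓ * iteratedDeriv ℓ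
    (fun z : ℝ => Complex.log (∫ ω, Complex.exp (Complex.I * (z : ℂ) * (Y ω : ℂ)) ∂P)) 0

end PoissonChaos

/-!
A product of pathwise multiple integrals `I_n(f)` expands, by the factorial moment formula for the
Poisson process, into a sum over partitions that separate the entries of each row. Inclusion and
exclusion over the variables integrated against `lam` leaves the partitions without singletons, so
that, for non-negative kernels,
`E ∏ r, I_{n r}(f_{n r}) = ∑ σ, ∫ (⊗ f_{n r})_σ`,
the sum being over the partitions `σ` in `Good` (`integral_prod_wienerIto`). All summands are
non-negative, so the whole expansion can be carried out with integrals in `[0, ∞]`. The basic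
building block, `prod_lintegral_facMeasure`, says that a product of integrals against factorial
measures of a configuration is a sum of integrals against factorial measures, one for each
partition; the configuration is first written as a countable sum of measures with values in
`{0, 1}` (`exists_eq_sum_zeroOne`).

Splitting a partition into the part that is linked to a fixed row and the rest gives the
recursion between moments and cumulants (`momentSum_eq`). Hence the cumulants of the partial sums
of `F` are the same sums restricted to partitions that link all rows (`cumulantSum_eq_cumulantSeq`),
and they are dominated by the moments. Both kinds of sums are non-negative, and the moments and
cumulants of `F` are the limits of those of the partial sums (`tendsto_integral_sum_pow`,
`tendsto_cumulantSeq`, `cumulant_eq_cumulantSeq`). It therefore suffices to bound from below the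
sum over the good and connected partitions for `ℓ = 6 k` rows that all carry `f n₀`.

For this, a variable of `f n₀` is split off, `f n₀ (x, z)` with `x ∈ X` and `z ∈ X ^ (n₀ - 1)`, and
a row is regarded as an edge of a bipartite graph on `q + 1` left and `q + 1` right vertices. One
vertex on each side is a hub. Every other vertex is joined to the hub of the opposite side by two
rows, so that every vertex lies in at least two rows, and the remaining `r ≥ 1` rows join arbitrary
non-hub vertices, which links the two hubs. The resulting `q ^ (2 r)` partitions are good and
connected. If `f n₀ ≥ ε` on a set `S` of positive measure, then the sum of their weights is at
least a constant to the power `ℓ` times an integral of the `r`-th power of the number of `S`-edges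
in a random bipartite graph, and Jensen's inequality bounds this by `q ^ (2 r)` up to another such
constant (`le_lintegral_hub`, `le_connectedSum`). With `q` about `k / 2` and `r = 6 k - 4 q`, about
`4 k`, this is at least `(6 k)! k!` up to an exponential factor (`exists_le_connectedSum`).

Finally, all moments of `F` are non-negative, so that the odd moments of the negative part are at
most those of the positive part. If `E exp (s F)` were finite, the moments would be at most of the
order `ℓ! C ^ ℓ`, in contradiction to the lower bound (`lintegral_exp_eq_top`).
-/
namespace PoissonChaos

/-! ### Measures with values in `{0, 1}` -/

variable {X : Type*} [MeasurableSpace X]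

/-- A measure that takes only the values `0` and `1` on measurable sets. Such measures play the
role of unit point masses: on an arbitrary measurable space an integer-valued measure need not be
a sum of Dirac measures, but it is a sum of measures with values in `{0, 1}`. The zero measure is
allowed, so that finite and countably infinite sums can both be indexed by `ℕ`. -/
def ZeroOne (m : Measure X) : Prop := ∀ s, MeasurableSet s → m s = 0 ∨ m s = 1

lemma ZeroOne.zero : ZeroOne (0 : Measure X) := fun _ _ => Or.inl rfl

lemma ZeroOne.isFiniteMeasure {m : Measure X} (h : ZeroOne m) : IsFiniteMeasure m :=
  ⟨by rcases h _ MeasurableSet.univ with h | h <;> simp [h]⟩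

/-- Sets are independent under a measure with values in `{0, 1}`. -/
lemma ZeroOne.measure_inter {m : Measure X} (h : ZeroOne m) {s t : Set X} (hs : MeasurableSet s)
    (ht : MeasurableSet t) : m (s ∩ t) = m s * m t := by
  have := h.isFiniteMeasure
  rcases h s hs with h0 | h1
  · rw [h0, zero_mul]
    exact measure_mono_null Set.inter_subset_left h0
  rcases h t ht with h0 | h2
  · rw [h0, mul_zero]
    exact measure_mono_null Set.inter_subset_right h0
  rw [h1, h2, mul_one]
  have huniv : m Set.univ = 1 := by
    rcases h _ MeasurableSet.univ with h | h
    · have := measure_mono_null (Set.subset_univ s) h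
      simp [this] at h1
    · exact h
  have hsc : m sᶜ = 0 := by
    rw [measure_compl hs (by simp [h1]), huniv, h1, tsub_self]
  rw [Set.inter_comm]
  rw [← h2]
  exact measure_inter_conull hsc

lemma ZeroOne.measure_biInter {m : Measure X} (h : ZeroOne m) {ι : Type*} {F : Finset ι}
    (hF : F.Nonempty) {s : ι → Set X} (hs : ∀ i, MeasurableSet (s i)) :
    m (⋂ i ∈ F, s i) = ∏ i ∈ F, m (s i) := by
  classical
  induction hF using Finset.Nonempty.cons_induction with
  | singleton a => simp
  | cons a F ha hF ih =>
    rw [Finset.prod_cons, ← ih, ← h.measure_inter (hs a) (F.measurableSet_biInter fun i _ => hs i)]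
    simp [Finset.cons_eq_insert]

lemma ZeroOne.exists_ae_eq_const {m : Measure X} (h : ZeroOne m) {f : X → ℝ} (hf : Measurable f) :
    ∃ c, f =ᵐ[m] fun _ => c := by
  have := h.isFiniteMeasure
  refine Filter.exists_eventuallyEq_const_of_forall_separating MeasurableSet fun U hU => ?_
  rcases h (f ⁻¹' U) (hf hU) with h0 | h1
  · right
    rw [ae_iff]
    have : {a | ¬f a ∉ U} = f ⁻¹' U := by ext; simp
    rw [this, h0]
  · left
    rw [ae_iff]
    have huniv : m Set.univ = 1 := by
      rcases h _ MeasurableSet.univ with h | h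
      · have := measure_mono_null (Set.subset_univ (f ⁻¹' U)) h
        simp [this] at h1
      · exact h
    have : m (f ⁻¹' U)ᶜ = 0 := by
      rw [measure_compl (hf hU) (by simp [h1]), huniv, h1, tsub_self]
    exact this

lemma measure_sum_succ (α : ℕ → Measure X) :
    Measure.sum α = α 0 + Measure.sum (fun i => α (i + 1)) := by
  ext s hs
  rw [Measure.add_apply, Measure.sum_apply _ hs, Measure.sum_apply _ hs,
    tsum_eq_zero_add' ENNReal.summable]

/-- A finite integer-valued measure is a finite sum of measures with values in `{0, 1}`: if `B` is
a set of minimal positive mass `v`, then `v⁻¹ μ|_B` is one of them, and it can be split off. -/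
lemma exists_eq_sum_zeroOne_of_finite (n : ℕ) : ∀ μ : Measure X, μ Set.univ = n →
    (∀ B, MeasurableSet B → ∃ k : ℕ∞, μ B = (k : ℝ≥0∞)) →
    ∃ α : ℕ → Measure X, (∀ i, ZeroOne (α i)) ∧ μ = Measure.sum α := by
  classical
  induction n with
  | zero =>
    intro μ h0 _
    refine ⟨fun _ => 0, fun _ => ZeroOne.zero, ?_⟩
    have : μ = 0 := Measure.measure_univ_eq_zero.1 (by simpa using h0)
    rw [this]
    exact Measure.ext fun s hs => by simp
  | succ n ih =>
    intro μ hμ hint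
    have hfin : IsFiniteMeasure μ := ⟨by rw [hμ]; exact ENNReal.natCast_lt_top _⟩
    have hnat : ∀ B, MeasurableSet B → ∃ k : ℕ, μ B = k := by
      intro B hB
      obtain ⟨k, hk⟩ := hint B hB
      induction k using ENat.recTopCoe with
      | top => exact absurd hk (by simp)
      | coe a => exact ⟨a, by simp [hk]⟩
    have hex : ∃ v : ℕ, v ≠ 0 ∧ ∃ B, MeasurableSet B ∧ μ B = v :=
      ⟨n + 1, by simp, Set.univ, MeasurableSet.univ, hμ⟩
    obtain ⟨hv0, B, hB, hμB⟩ := Nat.find_spec hex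
    set v := Nat.find hex with hv
    have hv0' : (v : ℝ≥0∞) ≠ 0 := by exact_mod_cast hv0
    have hvt : (v : ℝ≥0∞) ≠ ∞ := ENNReal.natCast_ne_top _
    set β : Measure X := (v : ℝ≥0∞)⁻¹ • μ.restrict B with hβ
    have hβ01 : ZeroOne β := by
      intro C hC
      obtain ⟨k, hk⟩ := hnat (C ∩ B) (hC.inter hB)
      have hβC : β C = (v : ℝ≥0∞)⁻¹ * k := by
        rw [hβ, Measure.smul_apply, Measure.restrict_apply hC, hk, smul_eq_mul]
      by_cases hk0 : k = 0
      · left; simp [hβC, hk0]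
      · right
        have h1 : v ≤ k := Nat.find_min' hex ⟨hk0, _, hC.inter hB, hk⟩
        have h2 : k ≤ v := by
          have : (k : ℝ≥0∞) ≤ v := by
            rw [← hk, ← hμB]; exact measure_mono Set.inter_subset_right
          exact_mod_cast this
        rw [hβC, le_antisymm h2 h1, ENNReal.inv_mul_cancel hv0' hvt]
    have hβB : β Set.univ = 1 := by
      rw [hβ, Measure.smul_apply, Measure.restrict_apply_univ, hμB, smul_eq_mul,
        ENNReal.inv_mul_cancel hv0' hvt]
    set ρ : Measure X := μ.restrict Bᶜ + ((v - 1 : ℕ) : ℝ≥0∞) • β with hρ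
    have hsplit : μ = β + ρ := by
      have h1 : μ.restrict B = (v : ℝ≥0∞) • β := by
        rw [hβ, smul_smul, ENNReal.mul_inv_cancel hv0' hvt, one_smul]
      have h2 : (v : ℝ≥0∞) = 1 + ((v - 1 : ℕ) : ℝ≥0∞) := by
        have : v = 1 + (v - 1) := by omega
        exact_mod_cast this
      calc μ = μ.restrict B + μ.restrict Bᶜ := (Measure.restrict_add_restrict_compl hB).symm
        _ = (1 + ((v - 1 : ℕ) : ℝ≥0∞)) • β + μ.restrict Bᶜ := by rw [h1, h2]
        _ = β + ρ := by rw [hρ, add_smul, one_smul]; abel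
    have hρu : ρ Set.univ = n := by
      have h := congrArg (fun m : Measure X => m Set.univ) hsplit
      simp only [Measure.add_apply] at h
      rw [hμ, hβB] at h
      push_cast at h
      rw [add_comm] at h
      exact ((ENNReal.add_right_inj ENNReal.one_ne_top).1 h).symm
    obtain ⟨α, hα, hsum⟩ := ih ρ hρu (by
      intro C hC
      obtain ⟨k, hk⟩ := hnat (C ∩ Bᶜ) (hC.inter hB.compl)
      rw [hρ, Measure.add_apply, Measure.restrict_apply hC, hk, Measure.smul_apply, smul_eq_mul]
      rcases hβ01 C hC with h | h
      · exact ⟨k, by simp [h]⟩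
      · exact ⟨((k + (v - 1) : ℕ) : ℕ∞), by simp [h]⟩)
    refine ⟨fun i => Nat.casesOn i β α, fun i => ?_, ?_⟩
    · cases i with
      | zero => exact hβ01
      | succ i => exact hα i
    · rw [measure_sum_succ]
      exact hsplit.trans (congrArg (β + ·) hsum)

/-- A `σ`-finite integer-valued measure is a countable sum of measures with values in
`{0, 1}`. -/
lemma exists_eq_sum_zeroOne (μ : Measure X) [SigmaFinite μ]
    (hint : ∀ B, MeasurableSet B → ∃ k : ℕ∞, μ B = (k : ℝ≥0∞)) :
    ∃ α : ℕ → Measure X, (∀ i, ZeroOne (α i)) ∧ μ = Measure.sum α := by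
  set D := disjointed (spanningSets μ) with hD
  have hDm : ∀ n, MeasurableSet (D n) :=
    fun n => MeasurableSet.disjointed (measurableSet_spanningSets μ) n
  have key : ∀ n, ∃ α : ℕ → Measure X, (∀ i, ZeroOne (α i)) ∧ μ.restrict (D n) = Measure.sum α := by
    intro n
    have hlt : μ (D n) < ∞ :=
      (measure_mono (disjointed_subset _ n)).trans_lt (measure_spanningSets_lt_top μ n)
    obtain ⟨k, hk⟩ := hint (D n) (hDm n)
    induction k using ENat.recTopCoe with
    | top => exact absurd hk (by simpa using hlt.ne)
    | coe a =>
      refine exists_eq_sum_zeroOne_of_finite a _ (by simpa using hk) fun B hB => ?_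
      rw [Measure.restrict_apply hB]
      exact hint _ (hB.inter (hDm n))
  choose α hα hsum using key
  refine ⟨fun i => α (Nat.unpair i).1 (Nat.unpair i).2, fun i => hα _ _, ?_⟩
  ext s hs
  conv_lhs => rw [← sum_restrict_disjointed_spanningSets μ μ]
  rw [Measure.sum_apply _ hs, Measure.sum_apply _ hs]
  rw [← Nat.pairEquiv.tsum_eq (fun i => (α (Nat.unpair i).1 (Nat.unpair i).2) s),
    ENNReal.tsum_prod']
  refine tsum_congr fun n => ?_
  rw [← hD, hsum, Measure.sum_apply _ hs]
  refine tsum_congr fun i => ?_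
  have h : Nat.unpair (Nat.pairEquiv (n, i)) = (n, i) := Nat.unpair_pair n i
  rw [h]

/-! ### Product measures over finite index sets -/

/-- Identifying variables is harmless for measures with values in `{0, 1}`: the image of
`⨂_b α_b` under the diagonal map that repeats the coordinate `π i` at the place `i` is again a
product measure. -/
lemma map_comp_pi_zeroOne {ι κ : Type*} [Fintype ι] [Fintype κ] {π : ι → κ}
    (hπ : Function.Surjective π) {α : κ → Measure X} (hα : ∀ b, ZeroOne (α b)) :
    (Measure.pi α).map (fun (y : κ → X) (i : ι) => y (π i)) = Measure.pi fun i => α (π i) := by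
  classical
  have := fun b => (hα b).isFiniteMeasure
  have hmeas : Measurable (fun (y : κ → X) (i : ι) => y (π i)) := by fun_prop
  refine (Measure.pi_eq fun s hs => ?_).symm
  rw [Measure.map_apply hmeas (MeasurableSet.univ_pi hs)]
  have : (fun (y : κ → X) (i : ι) => y (π i)) ⁻¹' Set.univ.pi s
      = Set.univ.pi fun b => ⋂ i ∈ Finset.univ.filter (fun i => π i = b), s i := by
    ext y
    simp only [Set.mem_preimage, Set.mem_univ_pi, Set.mem_iInter, Finset.mem_filter,
      Finset.mem_univ, true_and]
    exact ⟨fun h b i hi => hi ▸ h i, fun h i => h _ i rfl⟩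
  rw [this, Measure.pi_pi]
  have h1 : ∀ b, α b (⋂ i ∈ Finset.univ.filter (fun i => π i = b), s i)
      = ∏ i ∈ Finset.univ.filter (fun i => π i = b), α (π i) (s i) := by
    intro b
    obtain ⟨i, hi⟩ := hπ b
    rw [(hα b).measure_biInter ⟨i, by simp [hi]⟩ hs]
    refine Finset.prod_congr rfl fun i hi => ?_
    rw [(Finset.mem_filter.1 hi).2]
  simp_rw [h1]
  exact Finset.prod_fiberwise _ _ _

lemma prod_tsum_fin (n : ℕ) : ∀ {E : Fin n → Type*} (a : ∀ i, E i → ℝ≥0∞),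
    ∏ i, ∑' u, a i u = ∑' u : ∀ i, E i, ∏ i, a i (u i) := by
  induction n with
  | zero => intro E a; simp [tsum_fintype]
  | succ n ih =>
    intro E a
    rw [Fin.prod_univ_succ, ih fun i => a i.succ, ← (Fin.consEquiv E).tsum_eq, ENNReal.tsum_prod',
      ← ENNReal.tsum_mul_right]
    refine tsum_congr fun u => ?_
    rw [← ENNReal.tsum_mul_left]
    refine tsum_congr fun v => ?_
    rw [Fin.prod_univ_succ]
    simp [Fin.consEquiv]

/-- Distributivity of a finite product over infinite sums in `[0, ∞]`. -/
lemma prod_tsum {R : Type*} [Fintype R] {E : R → Type*} (a : ∀ r, E r → ℝ≥0∞) :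
    ∏ r, ∑' u, a r u = ∑' u : ∀ r, E r, ∏ r, a r (u r) := by
  classical
  let e := (Fintype.equivFin R).symm
  rw [← Fintype.prod_equiv e (fun i => ∑' u, a (e i) u) (fun r => ∑' u, a r u) fun i => rfl,
    prod_tsum_fin, ← (Equiv.piCongrLeft E e).tsum_eq]
  refine tsum_congr fun u => ?_
  refine Fintype.prod_equiv e _ _ fun i => ?_
  rw [Equiv.piCongrLeft_apply_apply]

lemma lintegral_fin_prod_eq_prod (n : ℕ) : ∀ {E : Fin n → Type*} [∀ i, MeasurableSpace (E i)]
    (μ : ∀ i, Measure (E i)) [∀ i, SigmaFinite (μ i)] (g : ∀ i, E i → ℝ≥0∞),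
    (∀ i, Measurable (g i)) →
    ∫⁻ x, ∏ i, g i (x i) ∂(Measure.pi μ) = ∏ i, ∫⁻ x, g i x ∂(μ i) := by
  induction n with
  | zero => intro E _ μ _ g _; simp
  | succ n ih =>
    intro E _ μ _ g hg
    rw [← ((measurePreserving_piFinSuccAbove μ 0).symm).lintegral_comp_emb
      (MeasurableEquiv.measurableEmbedding _), Fin.prod_univ_succ, ← ih (fun i => μ i.succ)
      (fun i => g i.succ) fun i => hg _]
    simp_rw [Fin.prod_univ_succ]
    rw [← lintegral_prod_mul (hg 0).aemeasurable]
    · rfl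
    · exact (Finset.measurable_prod
        (f := fun (i : Fin n) (x : ∀ i : Fin n, E i.succ) => g i.succ (x i)) _
        fun i _ => (hg i.succ).comp (measurable_pi_apply i)).aemeasurable

lemma lintegral_fintype_prod_eq_prod {R : Type*} [Fintype R] {E : R → Type*}
    [∀ i, MeasurableSpace (E i)] (μ : ∀ i, Measure (E i)) [∀ i, SigmaFinite (μ i)]
    (g : ∀ i, E i → ℝ≥0∞) (hg : ∀ i, Measurable (g i)) :
    ∫⁻ x, ∏ i, g i (x i) ∂(Measure.pi μ) = ∏ i, ∫⁻ x, g i x ∂(μ i) := by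
  classical
  let e := (Fintype.equivFin R).symm
  rw [← Fintype.prod_equiv e (fun i => ∫⁻ x, g (e i) x ∂(μ (e i))) (fun r => ∫⁻ x, g r x ∂(μ r))
    fun i => rfl, ← lintegral_fin_prod_eq_prod _ (fun i => μ (e i)) _ fun i => hg _,
    ← (measurePreserving_piCongrLeft μ e).lintegral_comp_emb
      (MeasurableEquiv.measurableEmbedding _)]
  refine lintegral_congr fun x => ?_
  refine (Fintype.prod_equiv e _ _ fun i => ?_).symm
  rw [MeasurableEquiv.piCongrLeft, MeasurableEquiv.coe_mk, Equiv.piCongrLeft_apply_apply]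

/-- The product measure over the pairs `⟨r, j⟩` is the product over `r` of the product measures
over `j`. -/
lemma measurePreserving_sigmaCurry {R : Type*} [Fintype R] {κ : R → Type*} [∀ r, Fintype (κ r)]
    (μ : ∀ r, κ r → Measure X) [∀ r j, SigmaFinite (μ r j)] :
    MeasurePreserving (fun (x : ∀ r, κ r → X) (p : Σ r, κ r) => x p.1 p.2)
      (Measure.pi fun r => Measure.pi (μ r)) (Measure.pi fun p : Σ r, κ r => μ p.1 p.2) := by
  have hm : Measurable (fun (x : ∀ r, κ r → X) (p : Σ r, κ r) => x p.1 p.2) := by fun_prop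
  refine ⟨hm, (Measure.pi_eq fun s hs => ?_).symm⟩
  rw [Measure.map_apply hm (MeasurableSet.univ_pi hs)]
  have : (fun (x : ∀ r, κ r → X) (p : Σ r, κ r) => x p.1 p.2) ⁻¹' Set.univ.pi s
      = Set.univ.pi fun r => Set.univ.pi fun j => s ⟨r, j⟩ := by
    ext x; simp [Sigma.forall]
  rw [this, Measure.pi_pi, Fintype.prod_sigma]
  simp_rw [Measure.pi_pi]

lemma prod_lintegral_pi_eq {R : Type*} [Fintype R] {κ : R → Type*} [∀ r, Fintype (κ r)]
    (μ : ∀ r, κ r → Measure X) [∀ r j, SigmaFinite (μ r j)] (g : ∀ r, (κ r → X) → ℝ≥0∞)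
    (hg : ∀ r, Measurable (g r)) :
    ∏ r, ∫⁻ x, g r x ∂(Measure.pi (μ r))
      = ∫⁻ x : (Σ r, κ r) → X, ∏ r, g r (fun j => x ⟨r, j⟩)
          ∂(Measure.pi fun p : Σ r, κ r => μ p.1 p.2) := by
  rw [← lintegral_fintype_prod_eq_prod _ _ hg, ← (measurePreserving_sigmaCurry μ).lintegral_comp]
  exact Finset.measurable_prod _ fun r _ => (hg r).comp (by fun_prop)

/-! ### Factorial measures -/

/-- Finite products of measures with values in `{0, 1}` take values in `{0, 1}`: this is clear on
boxes, and the class of sets of measure `0` or `1` is closed under complements and disjoint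
unions. -/
lemma ZeroOne.pi {κ : Type*} [Fintype κ] {α : κ → Measure X} (hα : ∀ b, ZeroOne (α b)) :
    ZeroOne (Measure.pi α) := by
  have := fun b => (hα b).isFiniteMeasure
  have huniv : Measure.pi α Set.univ = 0 ∨ Measure.pi α Set.univ = 1 := by
    rw [Measure.pi_univ]
    by_cases h : ∃ b, α b Set.univ = 0
    · obtain ⟨b, hb⟩ := h
      exact Or.inl (Finset.prod_eq_zero (Finset.mem_univ b) hb)
    · push Not at h
      exact Or.inr (Finset.prod_eq_one fun b _ => (hα b _ MeasurableSet.univ).resolve_left (h b))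
  intro t ht
  refine MeasurableSpace.induction_on_inter
    (C := fun t _ => Measure.pi α t = 0 ∨ Measure.pi α t = 1)
    generateFrom_pi.symm isPiSystem_pi ?_ ?_ ?_ ?_ t ht
  · simp
  · rintro _ ⟨s, hs, rfl⟩
    rw [Measure.pi_pi]
    by_cases h : ∃ b, α b (s b) = 0
    · obtain ⟨b, hb⟩ := h
      exact Or.inl (Finset.prod_eq_zero (Finset.mem_univ b) hb)
    · push Not at h
      exact Or.inr (Finset.prod_eq_one fun b _ =>
        (hα b _ (hs b (Set.mem_univ b))).resolve_left (h b))
  · intro t ht h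
    rw [measure_compl ht (measure_ne_top _ _)]
    have hle : Measure.pi α t ≤ Measure.pi α Set.univ := measure_mono (Set.subset_univ t)
    rcases huniv with h0 | h1
    · rw [h0]; left; simp
    · rw [h1]
      rcases h with h | h <;> simp [h]
  · intro f hd hm h
    by_cases h0 : ∀ i, Measure.pi α (f i) = 0
    · left; exact measure_iUnion_null h0
    · push Not at h0
      obtain ⟨i, hi⟩ := h0
      right
      apply le_antisymm
      · refine (measure_mono (Set.subset_univ _)).trans ?_
        rcases huniv with h | h <;> simp [h]
      · rw [← (h i).resolve_left hi]
        exact measure_mono (Set.subset_iUnion f i)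

/-- The factorial measure of `∑ᵢ αᵢ` over the finite index set `κ`: the sum over all injective
assignments of the summands `αᵢ` to the places in `κ` of the corresponding product measures. -/
noncomputable def facMeasure (α : ℕ → Measure X) (κ : Type*) [Fintype κ] : Measure (κ → X) :=
  Measure.sum fun u : κ ↪ ℕ => Measure.pi fun k => α (u k)

lemma lintegral_facMeasure (α : ℕ → Measure X) (κ : Type*) [Fintype κ] (g : (κ → X) → ℝ≥0∞) :
    ∫⁻ x, g x ∂(facMeasure α κ) = ∑' u : κ ↪ ℕ, ∫⁻ x, g x ∂(Measure.pi fun k => α (u k)) :=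
  lintegral_sum_measure _ _

lemma tsum_embedding_succ (m : ℕ) (A : (Fin (m + 1) → ℕ) → ℝ≥0∞) :
    ∑' u : Fin (m + 1) ↪ ℕ, A u
      = ∑' e : Fin m ↪ ℕ, ∑' i : {i // i ∉ Set.range e},
          A (Fin.snoc (α := fun _ => ℕ) (e : Fin m → ℕ) i) := by
  let F : (Σ e : Fin m ↪ ℕ, {i // i ∉ Set.range e}) → (Fin (m + 1) ↪ ℕ) := fun p =>
    ⟨Fin.snoc (α := fun _ => ℕ) p.1 p.2.1, Fin.snoc_injective_of_injective p.1.injective p.2.2⟩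
  have hF : Function.Bijective F := by
    constructor
    · rintro ⟨e, i, hi⟩ ⟨e', i', hi'⟩ h
      have h' : (Fin.snoc (α := fun _ => ℕ) (e : Fin m → ℕ) i : Fin (m + 1) → ℕ)
          = Fin.snoc (α := fun _ => ℕ) (e' : Fin m → ℕ) i' := congrArg DFunLike.coe h
      obtain ⟨h1, h2⟩ := Fin.snoc_injective2 h'
      obtain rfl := DFunLike.coe_injective h1
      subst h2
      rfl
    · intro u
      refine ⟨⟨⟨fun j => u j.castSucc, fun a b h => Fin.castSucc_injective _ (u.injective h)⟩,
        u (Fin.last m), ?_⟩, ?_⟩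
      · rintro ⟨j, hj⟩
        exact (Fin.castSucc_lt_last j).ne (u.injective hj)
      · ext j
        refine Fin.lastCases ?_ (fun j => ?_) j
        · simp [F]
        · simp only [F, Function.Embedding.coeFn_mk, Fin.snoc_castSucc]
          rfl
  rw [← (Equiv.ofBijective F hF).tsum_eq, ENNReal.tsum_sigma']
  rfl

lemma measurable_snoc {m : ℕ} : Measurable (fun p : (Fin m → X) × X =>
    (Fin.snoc (α := fun _ => X) p.1 p.2 : Fin (m + 1) → X)) := by
  refine measurable_pi_iff.2 fun j => ?_
  refine Fin.lastCases ?_ (fun j => ?_) j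
  · simpa using measurable_snd
  · simp only [Fin.snoc_castSucc]
    fun_prop

lemma map_snoc_prod_pi {m : ℕ} (μ : Fin m → Measure X) (ν : Measure X) [∀ i, SigmaFinite (μ i)]
    [SigmaFinite ν] :
    ((Measure.pi μ).prod ν).map (fun p => Fin.snoc (α := fun _ => X) p.1 p.2)
      = Measure.pi (Fin.snoc (α := fun _ => Measure X) μ ν) := by
  have : ∀ i, SigmaFinite (Fin.snoc (α := fun _ => Measure X) μ ν i) := fun i => by
    refine Fin.lastCases ?_ (fun j => ?_) i <;> simp <;> infer_instance
  refine (Measure.pi_eq fun s hs => ?_).symm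
  rw [Measure.map_apply measurable_snoc (MeasurableSet.univ_pi hs)]
  have : (fun p : (Fin m → X) × X => (Fin.snoc (α := fun _ => X) p.1 p.2 : Fin (m + 1) → X)) ⁻¹'
      Set.univ.pi s = (Set.univ.pi fun j : Fin m => s j.castSucc) ×ˢ s (Fin.last m) := by
    ext p
    simp only [Set.mem_preimage, Set.mem_univ_pi, Set.mem_prod]
    constructor
    · intro h
      exact ⟨fun j => by simpa using h j.castSucc, by simpa using h (Fin.last m)⟩
    · rintro ⟨h1, h2⟩ j
      refine Fin.lastCases (by simpa using h2) (fun j => by simpa using h1 j) j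
  rw [this, Measure.prod_prod, Measure.pi_pi, Fin.prod_univ_castSucc]
  simp

lemma snoc_comp_eq {m : ℕ} {β : Type*} (x : Fin m → β) (j : Fin m) :
    (fun i : Fin (m + 1) => x (Fin.snoc (α := fun _ => Fin m) id j i))
      = Fin.snoc (α := fun _ => β) x (x j) := by
  ext i
  refine Fin.lastCases ?_ (fun i => ?_) i <;> simp

/-- Under a product of measures with values in `{0, 1}`, integrating the last variable against the
`j`-th factor is the same as setting it equal to the `j`-th variable. -/
lemma ae_integral_snoc_eq {m : ℕ} {α : Fin m → Measure X} (hα : ∀ b, ZeroOne (α b))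
    {f : (Fin (m + 1) → X) → ℝ} (hf : Measurable f) (j : Fin m) :
    ∀ᵐ x ∂(Measure.pi α), Integrable (fun y => f (Fin.snoc (α := fun _ => X) x y)) (α j) ∧
      ∫ y, f (Fin.snoc (α := fun _ => X) x y) ∂(α j)
        = f (Fin.snoc (α := fun _ => X) x (x j)) := by
  have := fun b => (hα b).isFiniteMeasure
  by_cases h0 : α j Set.univ = 0
  · have : Measure.pi α = 0 := by
      rw [← Measure.measure_univ_eq_zero, Measure.pi_univ]
      exact Finset.prod_eq_zero (Finset.mem_univ j) h0
    rw [this]; simp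
  have h1 : α j Set.univ = 1 := (hα j _ MeasurableSet.univ).resolve_left h0
  have hmap := map_snoc_prod_pi α (α j)
  have hmap2 := map_comp_pi_zeroOne (π := Fin.snoc (α := fun _ => Fin m) id j) (fun i =>
    ⟨i.castSucc, by simp⟩) hα
  rw [snoc_comp_eq α j] at hmap2
  have h01 : ZeroOne (Measure.pi (Fin.snoc (α := fun _ => Measure X) α (α j))) :=
    ZeroOne.pi fun b => by refine Fin.lastCases ?_ (fun i => ?_) b <;> simp [hα]
  obtain ⟨c, hc⟩ := h01.exists_ae_eq_const hf
  have e1 := hc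
  rw [← hmap] at e1
  have e1' := ae_of_ae_map measurable_snoc.aemeasurable e1
  have e2 := hc
  rw [← hmap2] at e2
  have e2' := ae_of_ae_map (measurable_pi_iff.2 fun i => measurable_pi_apply _).aemeasurable e2
  have e3 := Measure.ae_ae_of_ae_prod e1'
  filter_upwards [e2', e3] with x hx2 hx3
  rw [snoc_comp_eq] at hx2
  refine ⟨(integrable_const c).congr (hx3.mono fun y hy => hy.symm), ?_⟩
  rw [integral_congr_ae hx3, hx2]
  simp [Measure.real, h1]

/-- The iterated integral `factorialIntegral` is the integral against the factorial measure. -/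
lemma factorialIntegral_eq_integral {α : ℕ → Measure X} (hα : ∀ i, ZeroOne (α i)) (m : ℕ) :
    ∀ f : (Fin m → X) → ℝ, Measurable f → Integrable f (facMeasure α (Fin m)) →
      factorialIntegral (Measure.sum α) m f = ∫ x, f x ∂(facMeasure α (Fin m)) := by
  have := fun b => (hα b).isFiniteMeasure
  induction m with
  | zero =>
    intro f _ _
    have : facMeasure α (Fin 0) = Measure.dirac Fin.elim0 := by
      ext s hs
      rw [facMeasure, Measure.sum_apply _ hs]
      simp [Measure.pi_of_empty _ (Fin.elim0 : Fin 0 → X), tsum_fintype]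
    rw [this, factorialIntegral]
    have : Subsingleton (Fin 0 → X) := inferInstance
    rw [integral_dirac' _ _ (StronglyMeasurable.of_discrete)]
  | succ m ih =>
    intro f hf hint
    set h : (Fin m → X) → ℝ := fun x =>
      (∫ y, f (Fin.snoc (α := fun _ => X) x y) ∂(Measure.sum α))
        - ∑ j : Fin m, f (Fin.snoc (α := fun _ => X) x (x j)) with hh
    have hfs : Measurable (fun p : (Fin m → X) × X => f (Fin.snoc (α := fun _ => X) p.1 p.2)) :=
      hf.comp measurable_snoc
    let π : (Fin m ↪ ℕ) → Measure (Fin m → X) := fun e => Measure.pi fun k => α (e k)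
    let ρ : (Fin m ↪ ℕ) → Measure X := fun e =>
      Measure.sum fun i : {i // i ∉ Set.range e} => α i
    let ν : (Fin m ↪ ℕ) → Measure (Fin (m + 1) → X) := fun e =>
      ((π e).prod (ρ e)).map (fun p => Fin.snoc (α := fun _ => X) p.1 p.2)
    have hfac : facMeasure α (Fin (m + 1)) = Measure.sum ν := by
      refine Measure.ext_of_lintegral _ fun g hg => ?_
      rw [lintegral_facMeasure, lintegral_sum_measure,
        tsum_embedding_succ m (fun u => ∫⁻ x, g x ∂(Measure.pi fun k => α (u k)))]
      refine tsum_congr fun e => ?_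
      rw [lintegral_map hg measurable_snoc, Measure.prod_sum_right, lintegral_sum_measure]
      refine tsum_congr fun i => ?_
      rw [← lintegral_map hg measurable_snoc, map_snoc_prod_pi]
      congr 2
      ext k : 1
      refine Fin.lastCases ?_ (fun k => ?_) k <;> simp
    have hmh : Measurable h := by
      refine Measurable.sub ?_ ?_
      · exact (hfs.stronglyMeasurable.integral_prod_right').measurable
      · refine Finset.measurable_fun_sum _ fun j _ => ?_
        exact hfs.comp (measurable_id.prodMk (measurable_pi_apply j))
    rw [hfac] at hint
    have hν : ∀ e, Integrable f (ν e) := fun e => hint.mono_measure (Measure.le_sum _ e)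
    have hprod : ∀ e, Integrable (fun p : (Fin m → X) × X =>
        f (Fin.snoc (α := fun _ => X) p.1 p.2)) ((π e).prod (ρ e)) := fun e =>
      (integrable_map_measure hf.aestronglyMeasurable measurable_snoc.aemeasurable).1 (hν e)
    have hae : ∀ e, h =ᵐ[π e] fun x => ∫ y, f (Fin.snoc (α := fun _ => X) x y) ∂(ρ e) := by
      intro e
      have hsum : Measure.sum α = ρ e + ∑ j : Fin m, α (e j) := by
        rw [← Measure.sum_fintype, ← Measure.sum_add_sum_compl (Set.range e) α, add_comm]
        congr 1
        refine Measure.ext fun s hs => ?_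
        rw [Measure.sum_apply _ hs, Measure.sum_apply _ hs,
          ← (Equiv.ofInjective e e.injective).tsum_eq]
        rfl
      have h1 := (hprod e).prod_right_ae
      have h2 : ∀ᵐ x ∂(π e), ∀ j, _ := ae_all_iff.2 fun j =>
        ae_integral_snoc_eq (fun b => hα (e b)) hf j
      filter_upwards [h1, h2] with x hx1 hx2
      have hx3 : Integrable (fun y => f (Fin.snoc (α := fun _ => X) x y))
          (∑ j : Fin m, α (e j)) :=
        integrable_finsetSum_measure.2 fun j _ => (hx2 j).1
      rw [hh]
      simp only
      rw [hsum, integral_add_measure hx1 hx3, integral_finsetSum_measure fun j _ => (hx2 j).1]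
      simp_rw [fun j => (hx2 j).2]
      ring
    have hih : Integrable h (facMeasure α (Fin m)) := by
      refine ⟨hmh.aestronglyMeasurable, ?_⟩
      refine lt_of_le_of_lt ?_ hint.2
      rw [lintegral_facMeasure, lintegral_sum_measure]
      refine ENNReal.tsum_le_tsum fun e => ?_
      rw [lintegral_map hf.enorm measurable_snoc, lintegral_prod _ hfs.enorm.aemeasurable]
      refine lintegral_mono_ae ?_
      filter_upwards [hae e] with x hx
      rw [hx]
      exact enorm_integral_le_lintegral_enorm _
    rw [factorialIntegral, ih h hmh hih, hfac, integral_sum_measure hint, facMeasure,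
      integral_sum_measure hih]
    refine tsum_congr fun e => ?_
    rw [integral_congr_ae (hae e),
      integral_map measurable_snoc.aemeasurable hf.aestronglyMeasurable, integral_prod _ (hprod e)]

/-! ### Products of factorial integrals -/

instance {ι : Type*} [Finite ι] : Finite (Setoid ι) :=
  Finite.of_injective (fun σ : Setoid ι => (fun x y => σ x y : ι → ι → Prop)) fun σ τ h => by
    ext x y
    exact iff_of_eq (congrFun (congrFun h x) y)

noncomputable instance {ι : Type*} [Finite ι] : Fintype (Setoid ι) := Fintype.ofFinite _

/-- No block of the partition `σ` of the pairs `⟨r, j⟩` contains two entries of the same row; the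
rows may be indexed by any type. -/
def RowSimple {R : Type*} {n : R → ℕ} (σ : Setoid (Σ r, Fin (n r))) : Prop :=
  ∀ (r : R) (j j' : Fin (n r)), σ ⟨r, j⟩ ⟨r, j'⟩ → j = j'

open Classical in
/-- A product of integrals against factorial measures is a sum, over the partitions of all
variables that separate the entries of each row, of integrals against factorial measures: a choice
of one injective assignment in each row amounts to a partition, recording which variables are
assigned the same point, together with an injective assignment of points to its blocks. -/
lemma prod_lintegral_facMeasure {α : ℕ → Measure X} (hα : ∀ i, ZeroOne (α i)) {R : Type*}
    [Fintype R] {n : R → ℕ} (g : ∀ r, (Fin (n r) → X) → ℝ≥0∞) (hg : ∀ r, Measurable (g r)) :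
    ∏ r, ∫⁻ x, g r x ∂(facMeasure α (Fin (n r)))
      = ∑ σ : {σ : Setoid (Σ r, Fin (n r)) // RowSimple σ},
          ∫⁻ y, ∏ r, g r (fun j => y (Quotient.mk σ.1 ⟨r, j⟩)) ∂(facMeasure α (Quotient σ.1)) := by
  have := fun b => (hα b).isFiniteMeasure
  simp_rw [lintegral_facMeasure]
  rw [prod_tsum]
  let G : (Σ σ : {σ : Setoid (Σ r, Fin (n r)) // RowSimple σ}, Quotient σ.1 ↪ ℕ) →
      ∀ r, Fin (n r) ↪ ℕ := fun p r =>
    ⟨fun j => p.2 (Quotient.mk p.1.1 ⟨r, j⟩), fun j j' h =>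
      p.1.2 r j j' (Quotient.exact (p.2.injective h))⟩
  have hGv : ∀ p r j, G p r j = p.2 (Quotient.mk p.1.1 ⟨r, j⟩) := fun _ _ _ => rfl
  have hG : Function.Bijective G := by
    constructor
    · rintro ⟨⟨σ, hσ⟩, v⟩ ⟨⟨τ, hτ⟩, w⟩ h
      have hv : ∀ x : Σ r, Fin (n r), v (Quotient.mk σ x) = w (Quotient.mk τ x) := by
        rintro ⟨r, j⟩
        exact DFunLike.congr_fun (congrFun h r) j
      have hst : σ = τ := by
        ext x y
        have e1 : σ x y ↔ v (Quotient.mk σ x) = v (Quotient.mk σ y) := by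
          rw [v.injective.eq_iff]; exact Quotient.eq.symm
        have e2 : τ x y ↔ w (Quotient.mk τ x) = w (Quotient.mk τ y) := by
          rw [w.injective.eq_iff]; exact Quotient.eq.symm
        rw [e1, e2, hv, hv]
      subst hst
      have : v = w := by
        ext q
        induction q using Quotient.inductionOn with
        | h x => exact hv x
      rw [this]
    · intro u
      let û : (Σ r, Fin (n r)) → ℕ := fun p => u p.1 p.2
      refine ⟨⟨⟨Setoid.ker û, fun r j j' h => (u r).injective h⟩,
        ⟨Setoid.kerLift û, Setoid.kerLift_injective û⟩⟩, ?_⟩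
      rfl
  rw [← (Equiv.ofBijective G hG).tsum_eq, ENNReal.tsum_sigma', tsum_fintype]
  refine Finset.sum_congr rfl fun σ _ => tsum_congr fun v => ?_
  simp only [Equiv.ofBijective_apply]
  rw [prod_lintegral_pi_eq (fun r j => α (G ⟨σ, v⟩ r j)) g hg]
  have hmap := map_comp_pi_zeroOne (π := Quotient.mk σ.1) Quotient.mk_surjective
    (α := fun q => α (v q)) (fun q => hα _)
  simp only [hGv]
  rw [← hmap, lintegral_map]
  · exact Finset.measurable_fun_prod _ fun r _ => (hg r).comp (by fun_prop)
  · fun_prop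

/-! ### Campbell's formula for factorial measures -/

/-- The falling factorial `t (t - 1) ⋯ (t - d + 1)` in `[0, ∞]`; the truncated subtraction is
harmless because at a natural number `t < d` one of the factors vanishes. -/
noncomputable def falling (d : ℕ) (t : ℝ≥0∞) : ℝ≥0∞ := ∏ i ∈ Finset.range d, (t - i)

lemma falling_succ (d : ℕ) (t : ℝ≥0∞) : falling (d + 1) t = falling d t * (t - d) := by
  rw [falling, Finset.prod_range_succ]; rfl

lemma measurable_falling (d : ℕ) : Measurable (falling d) :=
  Finset.measurable_fun_prod _ fun _ _ => measurable_id.sub measurable_const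

lemma falling_natCast (d k : ℕ) : falling d k = (k.descFactorial d : ℝ≥0∞) := by
  induction d with
  | zero => simp [falling]
  | succ d ih =>
    rw [falling_succ, ih, Nat.descFactorial_succ, ← ENNReal.natCast_sub]
    push_cast
    ring

/-- The factorial moments of the Poisson distribution are the powers of its mean. -/
lemma lintegral_falling_poissonMeasure (r : ℝ≥0) (d : ℕ) :
    ∫⁻ k, falling d (k : ℝ≥0∞) ∂(poissonMeasure r) = (r : ℝ≥0∞) ^ d := by
  have key : ∀ d, ∫⁻ k, falling d (k : ℝ≥0∞) ∂(poissonMeasure r)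
      = ∑' k : ℕ, ENNReal.ofReal (Real.exp (-r) * r ^ k / k !) * (k.descFactorial d : ℝ≥0∞) := by
    intro d
    rw [poissonMeasure, lintegral_sum_measure]
    refine tsum_congr fun k => ?_
    rw [lintegral_smul_measure, lintegral_dirac, falling_natCast, smul_eq_mul]
  induction d with
  | zero => simp [falling]
  | succ d ih =>
    rw [key, tsum_eq_zero_add' ENNReal.summable, pow_succ', ← ih, key, ← ENNReal.tsum_mul_left]
    simp only [Nat.zero_descFactorial_succ, Nat.cast_zero, mul_zero, zero_add]
    refine tsum_congr fun k => ?_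
    rw [Nat.succ_descFactorial_succ, Nat.cast_mul, ← mul_assoc, ← mul_assoc]
    congr 1
    rw [← ENNReal.ofReal_natCast (k + 1), ← ENNReal.ofReal_mul (by positivity),
      ← ENNReal.ofReal_coe_nnreal, ← ENNReal.ofReal_mul (by positivity)]
    congr 1
    rw [Nat.factorial_succ]
    push_cast
    have : ((k : ℝ) + 1) ≠ 0 := by positivity
    field_simp
    ring

/-- Counting injective assignments with prescribed colours: if each index has at most one of the
colours `j` and `N j` indices have colour `j`, then the number of injections along which the
colours are `c` is the product over the colours of falling factorials of `N j`. -/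
lemma tsum_embedding_prod_eq {A : Type*} [Fintype A] [DecidableEq A] {a : ℕ → A → ℝ≥0∞}
    (h01 : ∀ i j, a i j = 0 ∨ a i j = 1) (hdisj : ∀ i j j', j ≠ j' → a i j * a i j' = 0)
    (m : ℕ) : ∀ c : Fin m → A,
    ∑' u : Fin m ↪ ℕ, ∏ k, a (u k) (c k)
      = ∏ j, falling (∑ k, if c k = j then 1 else 0) (∑' i, a i j) := by
  induction m with
  | zero => intro c; simp [tsum_fintype, falling]
  | succ m ih =>
    intro c
    rw [tsum_embedding_succ m fun u => ∏ k, a (u k) (c k)]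
    set d : A → ℕ := fun j => ∑ k : Fin m, if c k.castSucc = j then 1 else 0 with hd
    set l := c (Fin.last m) with hl
    have key : ∀ e : Fin m ↪ ℕ, ∑' i : {i // i ∉ Set.range e},
        ∏ k, a (Fin.snoc (α := fun _ => ℕ) (e : Fin m → ℕ) i k) (c k)
          = (∏ k : Fin m, a (e k) (c k.castSucc)) * ((∑' i, a i l) - d l) := by
      intro e
      simp_rw [Fin.prod_univ_castSucc, Fin.snoc_castSucc, Fin.snoc_last]
      rw [ENNReal.tsum_mul_left]
      by_cases h0 : ∏ k : Fin m, a (e k) (c k.castSucc) = 0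
      · rw [h0, zero_mul, zero_mul]
      congr 1
      have h1 : ∀ k : Fin m, a (e k) (c k.castSucc) = 1 := fun k =>
        (h01 _ _).resolve_left fun h => h0 (Finset.prod_eq_zero (Finset.mem_univ k) h)
      have h2 : ∀ k : Fin m, a (e k) l = ((if c k.castSucc = l then 1 else 0 : ℕ) : ℝ≥0∞) := by
        intro k
        split_ifs with h
        · rw [← h, h1, Nat.cast_one]
        · have := hdisj (e k) _ _ h
          rw [h1, one_mul] at this
          simpa using this
      have h3 : ∑' i : Set.range e, a i l = d l := by
        rw [← (Equiv.ofInjective e e.injective).tsum_eq, tsum_fintype, hd]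
        push_cast
        exact Finset.sum_congr rfl fun k _ => by
          rw [Equiv.ofInjective_apply, h2]; push_cast; rfl
      have h4 := ENNReal.summable.tsum_add_tsum_compl (f := fun i => a i l) (s := Set.range e)
        ENNReal.summable
      rw [h3] at h4
      rw [← h4, ENNReal.add_sub_cancel_left (ENNReal.natCast_ne_top _)]
      rfl
    simp_rw [key]
    rw [ENNReal.tsum_mul_right, ih fun k => c k.castSucc]
    have hstep : ∀ j, falling (∑ k, if c k = j then 1 else 0) (∑' i, a i j)
        = falling (d j) (∑' i, a i j) * if l = j then (∑' i, a i j) - d j else 1 := by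
      intro j
      rw [Fin.sum_univ_castSucc, ← hl]
      split_ifs with h
      · rw [falling_succ]
      · rw [mul_one, add_zero]
    simp_rw [hstep, Finset.prod_mul_distrib]
    congr 1
    simp

section Campbell

variable {Ω : Type*} [MeasurableSpace Ω] {P : Measure Ω} {lam : Measure X} {η : Ω → Measure X}

lemma IsPoissonProcess.measurable_apply (hη : IsPoissonProcess P lam η) {B : Set X}
    (hB : MeasurableSet B) : Measurable fun ω => η ω B :=
  (Measure.measurable_coe hB).comp hη.measurable

lemma IsPoissonProcess.lintegral_falling (hη : IsPoissonProcess P lam η) {B : Set X}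
    (hB : MeasurableSet B) (hfin : lam B ≠ ∞) (d : ℕ) :
    ∫⁻ ω, falling d (η ω B) ∂P = lam B ^ d := by
  rw [← lintegral_map (measurable_falling d) (hη.measurable_apply hB), hη.poisson_law B hB hfin,
    lintegral_map (measurable_falling d) (measurable_of_countable _),
    lintegral_falling_poissonMeasure, ENNReal.coe_toNNReal hfin]

lemma IsPoissonProcess.iIndepFun_apply (hη : IsPoissonProcess P lam η) {A : Type*} [Fintype A]
    {b : A → Set X} (hb : ∀ j, MeasurableSet (b j))
    (hdisj : Pairwise fun i j => Disjoint (b i) (b j)) :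
    iIndepFun (fun j ω => η ω (b j)) P := by
  have e := Fintype.equivFin A
  have h := hη.indep _ (fun i => b (e.symm i)) (fun i => hb _)
    (fun i j hij => hdisj (e.symm.injective.ne hij))
  simpa using h.precomp e.injective

variable (hη : IsPoissonProcess P lam η) {α : Ω → ℕ → Measure X} (hα : ∀ ω i, ZeroOne (α ω i))
  (hsum : ∀ ω, η ω = Measure.sum (α ω))

include hη hα hsum

/-- Campbell's formula for boxes whose sides are taken from a family of disjoint sets of finite
measure: the factorial measure is a product of falling factorials of independent Poisson
variables. -/
lemma facMeasure_disjoint_boxes {A : Type*} [Fintype A] {b : A → Set X}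
    (hb : ∀ j, MeasurableSet (b j)) (hdisj : Pairwise fun i j => Disjoint (b i) (b j))
    (hfin : ∀ j, lam (b j) ≠ ∞) {κ : Type*} [Fintype κ] (c : κ → A) :
    AEMeasurable (fun ω => ∑' u : κ ↪ ℕ, ∏ k, α ω (u k) (b (c k))) P ∧
      ∫⁻ ω, ∑' u : κ ↪ ℕ, ∏ k, α ω (u k) (b (c k)) ∂P = ∏ k, lam (b (c k)) := by
  classical
  let e := Fintype.equivFin κ
  have hae : ∀ ω, ∑' u : κ ↪ ℕ, ∏ k, α ω (u k) (b (c k))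
      = ∏ j, falling (∑ k, if c (e.symm k) = j then 1 else 0) (η ω (b j)) := by
    intro ω
    have h := tsum_embedding_prod_eq (a := fun i j => α ω i (b j)) (fun i j => hα ω i _ (hb j))
      (fun i j j' hj => by
        rw [← (hα ω i).measure_inter (hb j) (hb j'), (hdisj hj).inter_eq, measure_empty])
      _ fun k => c (e.symm k)
    rw [← (e.embeddingCongr (Equiv.refl ℕ)).symm.tsum_eq]
    convert h using 1
    · refine tsum_congr fun u => ?_
      exact Fintype.prod_equiv e _ _ fun k => by simp
    · refine Finset.prod_congr rfl fun j _ => ?_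
      rw [hsum ω, Measure.sum_apply _ (hb j)]
  simp_rw [hae]
  have hm : ∀ j, Measurable fun ω => falling (∑ k, if c (e.symm k) = j then 1 else 0) (η ω (b j)) :=
    fun j => (measurable_falling _).comp (hη.measurable_apply (hb j))
  refine ⟨(Finset.measurable_fun_prod _ fun j _ => hm j).aemeasurable, ?_⟩
  have hind := (hη.iIndepFun_apply hb hdisj).comp
    (fun j => falling (∑ k, if c (e.symm k) = j then 1 else 0)) fun j => measurable_falling _
  rw [lintegral_prod_eq_prod_lintegral_of_indepFun Finset.univ
    (fun j ω => falling (∑ k, if c (e.symm k) = j then 1 else 0) (η ω (b j))) hind hm]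
  simp_rw [fun j => hη.lintegral_falling (hb j) (hfin j)]
  rw [← Finset.prod_fiberwise Finset.univ c fun k => lam (b (c k))]
  refine Finset.prod_congr rfl fun j _ => ?_
  rw [Finset.prod_congr rfl (g := fun _ => lam (b j)) fun k hk => by
    rw [(Finset.mem_filter.1 hk).2], Finset.prod_const]
  congr 1
  rw [Finset.sum_boole]
  simp only [Nat.cast_id]
  exact Finset.card_bij (fun k _ => e.symm k) (by simp) (by simp) fun k hk =>
    ⟨e k, by simpa using hk, by simp⟩

/-- Campbell's formula for boxes of finite measure, which are cut along the atoms of the finite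
algebra generated by their sides. -/
lemma facMeasure_boxes {κ : Type*} [Fintype κ] {C : κ → Set X} (hC : ∀ k, MeasurableSet (C k))
    (hfin : ∀ k, lam (C k) ≠ ∞) :
    AEMeasurable (fun ω => facMeasure (α ω) κ (Set.univ.pi C)) P ∧
      ∫⁻ ω, facMeasure (α ω) κ (Set.univ.pi C) ∂P = ∏ k, lam (C k) := by
  classical
  have := fun ω b => (hα ω b).isFiniteMeasure
  -- The atom `b S` is the set of points that lie in `C k` exactly for `k ∈ S`; the atom `b ∅`,
  -- whose measure may be infinite, is not used.
  let b : {S : Finset κ // S.Nonempty} → Set X := fun S => {x | ∀ k, x ∈ C k ↔ k ∈ S.1}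
  have hbm : ∀ S, MeasurableSet (b S) := fun S => by
    have : b S = ⋂ k, {x | x ∈ C k ↔ k ∈ S.1} := by ext x; simp [b]
    rw [this]
    refine MeasurableSet.iInter fun k => ?_
    by_cases hk : k ∈ S.1
    · simpa [hk] using hC k
    · have : {x | x ∈ C k ↔ k ∈ S.1} = (C k)ᶜ := by ext; simp [hk]
      rw [this]
      exact (hC k).compl
  have hbd : Pairwise fun S T => Disjoint (b S) (b T) := fun S T hST => by
    refine Set.disjoint_left.2 ?_
    intro x hx hx'
    exact hST (Subtype.ext (Finset.ext fun k => (hx k).symm.trans (hx' k)))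
  have hbC : ∀ S : {S : Finset κ // S.Nonempty}, ∀ k ∈ S.1, b S ⊆ C k :=
    fun S k hk x hx => (hx k).2 hk
  have hbfin : ∀ S, lam (b S) ≠ ∞ := fun S => by
    obtain ⟨k, hk⟩ := S.2
    exact ((measure_mono (hbC S k hk)).trans_lt (hfin k).lt_top).ne
  have hdec : ∀ (m : Measure X) k, m (C k) = ∑ S, if k ∈ S.1 then m (b S) else 0 := by
    intro m k
    rw [← Finset.sum_filter, ← measure_biUnion_finset (fun S _ T _ h => hbd h) fun S _ => hbm S]
    congr 1
    ext x
    simp only [Set.mem_iUnion, Finset.mem_filter, Finset.mem_univ, true_and, exists_prop]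
    constructor
    · intro hx
      refine ⟨⟨Finset.univ.filter fun k => x ∈ C k, k, by simpa using hx⟩, by simpa using hx, ?_⟩
      intro k'; simp
    · rintro ⟨S, hkS, hx⟩
      exact hbC S k hkS hx
  have hexp : ∀ m : κ → Measure X, ∏ k, m k (C k) = ∑ c : κ → {S : Finset κ // S.Nonempty},
      if ∀ k, k ∈ (c k).1 then ∏ k, m k (b (c k)) else 0 := by
    intro m
    simp_rw [hdec _ _, Finset.prod_univ_sum, Fintype.piFinset_univ]
    refine Finset.sum_congr rfl fun c _ => ?_
    split_ifs with h
    · exact Finset.prod_congr rfl fun k _ => by rw [if_pos (h k)]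
    · push Not at h
      obtain ⟨k, hk⟩ := h
      exact Finset.prod_eq_zero (Finset.mem_univ k) (if_neg hk)
  have hfac : ∀ ω, facMeasure (α ω) κ (Set.univ.pi C)
      = ∑ c : κ → {S : Finset κ // S.Nonempty},
        if ∀ k, k ∈ (c k).1 then ∑' u : κ ↪ ℕ, ∏ k, α ω (u k) (b (c k)) else 0 := by
    intro ω
    rw [facMeasure, Measure.sum_apply _ (MeasurableSet.univ_pi hC)]
    simp_rw [Measure.pi_pi, hexp]
    rw [Summable.tsum_finsetSum fun _ _ => ENNReal.summable]
    refine Finset.sum_congr rfl fun c _ => ?_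
    split_ifs <;> simp
  simp_rw [hfac]
  have hbox := fun c : κ → {S : Finset κ // S.Nonempty} =>
    facMeasure_disjoint_boxes hη hα hsum hbm hbd hbfin c
  have hm : ∀ c : κ → {S : Finset κ // S.Nonempty}, AEMeasurable (fun ω =>
      if ∀ k, k ∈ (c k).1 then ∑' u : κ ↪ ℕ, ∏ k, α ω (u k) (b (c k)) else 0) P := by
    intro c
    split_ifs
    · exact (hbox c).1
    · exact aemeasurable_const
  refine ⟨Finset.aemeasurable_fun_sum _ fun c _ => hm c, ?_⟩
  rw [lintegral_finsetSum' _ fun c _ => hm c, hexp fun _ => lam]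
  refine Finset.sum_congr rfl fun c _ => ?_
  split_ifs
  · exact (hbox c).2
  · simp

/-- Campbell's formula for measurable subsets of a cube of finite measure, by a monotone class
argument starting from boxes. -/
lemma facMeasure_inter_box {κ : Type*} [Fintype κ] [SigmaFinite lam] {A : Set X}
    (hA : MeasurableSet A) (hfin : lam A ≠ ∞) {t : Set (κ → X)} (ht : MeasurableSet t) :
    AEMeasurable (fun ω => facMeasure (α ω) κ (t ∩ Set.univ.pi fun _ => A)) P ∧
      ∫⁻ ω, facMeasure (α ω) κ (t ∩ Set.univ.pi fun _ => A) ∂P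
        = Measure.pi (fun _ : κ => lam) (t ∩ Set.univ.pi fun _ => A) := by
  set W : Set (κ → X) := Set.univ.pi fun _ => A with hW
  have hWm : MeasurableSet W := MeasurableSet.univ_pi fun _ => hA
  have hWbox := facMeasure_boxes hη hα hsum (κ := κ) (C := fun _ => A) (fun _ => hA) fun _ => hfin
  have hWfin : ∏ _k : κ, lam A ≠ ∞ := ENNReal.prod_ne_top fun _ _ => hfin
  have hWlam : Measure.pi (fun _ : κ => lam) W ≠ ∞ := by rw [hW, Measure.pi_pi]; exact hWfin
  have hWae : ∀ᵐ ω ∂P, facMeasure (α ω) κ W ≠ ∞ := by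
    filter_upwards [ae_lt_top' hWbox.1 (by rw [hWbox.2]; exact hWfin)] with ω hω
    exact hω.ne
  refine MeasurableSpace.induction_on_inter
    (C := fun t _ => AEMeasurable (fun ω => facMeasure (α ω) κ (t ∩ W)) P ∧
      ∫⁻ ω, facMeasure (α ω) κ (t ∩ W) ∂P = Measure.pi (fun _ : κ => lam) (t ∩ W))
    generateFrom_pi.symm isPiSystem_pi ?_ ?_ ?_ ?_ t ht
  · simp
  · rintro _ ⟨s, hs, rfl⟩
    rw [hW, ← Set.pi_inter_distrib, Measure.pi_pi]
    exact facMeasure_boxes hη hα hsum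
      (fun k => (hs k (Set.mem_univ k)).inter hA)
      fun k => ((measure_mono Set.inter_subset_right).trans_lt hfin.lt_top).ne
  · rintro t ht ⟨h1, h2⟩
    have hc : ∀ m : Measure (κ → X), m W ≠ ∞ → m (tᶜ ∩ W) = m W - m (t ∩ W) := by
      intro m hm
      have : tᶜ ∩ W = W \ (t ∩ W) := by
        ext x
        simp only [Set.mem_inter_iff, Set.mem_compl_iff, Set.mem_sdiff]
        tauto
      rw [this, measure_sdiff Set.inter_subset_right (ht.inter hWm).nullMeasurableSet
        ((measure_mono Set.inter_subset_right).trans_lt hm.lt_top).ne]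
    have hae : (fun ω => facMeasure (α ω) κ (tᶜ ∩ W)) =ᵐ[P]
        fun ω => facMeasure (α ω) κ W - facMeasure (α ω) κ (t ∩ W) := by
      filter_upwards [hWae] with ω hω using hc _ hω
    refine ⟨(hWbox.1.sub h1).congr hae.symm, ?_⟩
    rw [lintegral_congr_ae hae, lintegral_sub' h1, h2, hWbox.2, hc _ hWlam, hW, Measure.pi_pi]
    · rw [h2]
      exact ((measure_mono Set.inter_subset_right).trans_lt hWlam.lt_top).ne
    · exact ae_of_all _ fun ω => measure_mono Set.inter_subset_right
  · intro f hd hm h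
    have hU : ∀ m : Measure (κ → X), m ((⋃ i, f i) ∩ W) = ∑' i, m (f i ∩ W) := by
      intro m
      rw [Set.iUnion_inter, measure_iUnion _ fun i => (hm i).inter hWm]
      exact fun i j hij => (hd hij).mono Set.inter_subset_left Set.inter_subset_left
    simp_rw [hU]
    refine ⟨AEMeasurable.tsum fun i => (h i).1, ?_⟩
    rw [lintegral_tsum fun i => (h i).1]
    exact tsum_congr fun i => (h i).2

/-- Campbell's formula: the mean of the `κ`-th factorial measure of a Poisson process is the
product measure `lam^κ`. -/
lemma campbell {κ : Type*} [Fintype κ] [SigmaFinite lam] {g : (κ → X) → ℝ≥0∞}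
    (hg : Measurable g) :
    AEMeasurable (fun ω => ∫⁻ x, g x ∂(facMeasure (α ω) κ)) P ∧
      ∫⁻ ω, ∫⁻ x, g x ∂(facMeasure (α ω) κ) ∂P = ∫⁻ x, g x ∂(Measure.pi fun _ : κ => lam) := by
  have hset : ∀ t : Set (κ → X), MeasurableSet t →
      AEMeasurable (fun ω => facMeasure (α ω) κ t) P ∧
      ∫⁻ ω, facMeasure (α ω) κ t ∂P = Measure.pi (fun _ : κ => lam) t := by
    intro t ht
    let W : ℕ → Set (κ → X) := fun N => Set.univ.pi fun _ => spanningSets lam N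
    have hWmono : Monotone W := fun a b hab =>
      Set.pi_mono fun _ _ => monotone_spanningSets lam hab
    have hWU : t = ⋃ N, t ∩ W N := by
      rw [← Set.inter_iUnion]
      refine (Set.inter_eq_left.2 fun x _ => ?_).symm
      have hx : ∀ k, ∃ N, x k ∈ spanningSets lam N := fun k =>
        ⟨_, mem_spanningSetsIndex lam (x k)⟩
      choose N hN using hx
      refine Set.mem_iUnion.2 ⟨Finset.univ.sup N, fun k _ => ?_⟩
      exact monotone_spanningSets lam (Finset.le_sup (Finset.mem_univ k)) (hN k)
    have hmono : Monotone fun N => t ∩ W N := fun a b hab =>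
      Set.inter_subset_inter_right _ (hWmono hab)
    have hsup : ∀ m : Measure (κ → X), m t = ⨆ N, m (t ∩ W N) := by
      intro m
      conv_lhs => rw [hWU]
      exact hmono.measure_iUnion
    have h := fun N => facMeasure_inter_box hη hα hsum (κ := κ)
      (measurableSet_spanningSets lam N) (measure_spanningSets_lt_top lam N).ne ht
    simp_rw [hsup]
    refine ⟨AEMeasurable.iSup fun N => (h N).1, ?_⟩
    rw [lintegral_iSup' (fun N => (h N).1)
      (ae_of_all _ fun ω a b hab => measure_mono (hmono hab))]
    exact iSup_congr fun N => (h N).2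
  refine Measurable.ennreal_induction (motive := fun g =>
    AEMeasurable (fun ω => ∫⁻ x, g x ∂(facMeasure (α ω) κ)) P ∧
      ∫⁻ ω, ∫⁻ x, g x ∂(facMeasure (α ω) κ) ∂P = ∫⁻ x, g x ∂(Measure.pi fun _ : κ => lam))
    ?_ ?_ ?_ hg
  · intro c s hs
    simp_rw [lintegral_indicator_const hs]
    exact ⟨(hset s hs).1.const_mul c, by rw [lintegral_const_mul'' _ (hset s hs).1, (hset s hs).2]⟩
  · intro f g _ hf hg h1 h2
    simp only [Pi.add_apply]
    simp_rw [lintegral_add_left hf]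
    exact ⟨h1.1.add h2.1, by rw [lintegral_add_left' h1.1, h1.2, h2.2]⟩
  · intro f hf hmono h
    simp_rw [lintegral_iSup hf hmono]
    refine ⟨AEMeasurable.iSup fun N => (h N).1, ?_⟩
    rw [lintegral_iSup' (fun N => (h N).1)
      (ae_of_all _ fun ω a b hab => lintegral_mono (hmono hab))]
    exact iSup_congr fun N => (h N).2

end Campbell

/-! ### Weights of partitions -/

open Classical in
/-- The integral of `g_σ` for a function `g` with values in `[0, ∞]`. -/
noncomputable def weight {ι : Type*} [Fintype ι] (lam : Measure X) (σ : Setoid ι)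
    (g : (ι → X) → ℝ≥0∞) : ℝ≥0∞ :=
  ∫⁻ y, g (fun i => y (Quotient.mk σ i)) ∂(Measure.pi fun _ : Quotient σ => lam)

/-- The blocks of `σ` can be labelled by the values of any surjective map with kernel `σ`. -/
lemma weight_eq_of_surjective {ι κ : Type*} [Fintype ι] [Fintype κ] {lam : Measure X}
    [SigmaFinite lam] {σ : Setoid ι} {lab : ι → κ} (hlab : Function.Surjective lab)
    (hσ : ∀ x y, σ x y ↔ lab x = lab y) (g : (ι → X) → ℝ≥0∞) :
    weight lam σ g = ∫⁻ y : κ → X, g (fun i => y (lab i)) ∂(Measure.pi fun _ : κ => lam) := by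
  classical
  have hb : Function.Bijective (Quotient.lift lab fun x y h => (hσ x y).1 h) := by
    constructor
    · intro a b h
      induction a using Quotient.inductionOn
      induction b using Quotient.inductionOn
      exact Quotient.sound ((hσ _ _).2 h)
    · intro b
      obtain ⟨x, rfl⟩ := hlab b
      exact ⟨Quotient.mk σ x, rfl⟩
  let e := Equiv.ofBijective _ hb
  rw [weight, ← (measurePreserving_piCongrLeft (fun _ : κ => lam) e).lintegral_comp_emb
    (MeasurableEquiv.measurableEmbedding _)]
  refine lintegral_congr fun y => ?_
  congr 1
  ext i
  have : lab i = e (Quotient.mk σ i) := rfl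
  rw [this, MeasurableEquiv.piCongrLeft, MeasurableEquiv.coe_mk, Equiv.piCongrLeft_apply_apply]

lemma measurable_glue {n : ℕ} (J : Finset (Fin n)) :
    Measurable fun p : (Fin J.card → X) × ({i : Fin n // i ∉ J} → X) => glue J p.1 p.2 := by
  refine measurable_pi_iff.2 fun i => ?_
  unfold glue
  split_ifs <;> fun_prop

/-- The integral of `h` in which the variables in `J` are integrated against the factorial
measure of `∑ᵢ αᵢ` and the other ones against `lam`. -/
noncomputable def mixedIntegral (lam : Measure X) (α : ℕ → Measure X) {n : ℕ} (J : Finset (Fin n))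
    (h : (Fin n → X) → ℝ≥0∞) : ℝ≥0∞ :=
  ∫⁻ u, ∫⁻ z, h (glue J u z) ∂(Measure.pi fun _ : {i : Fin n // i ∉ J} => lam)
    ∂(facMeasure α (Fin J.card))

/-- For non-negative integrands, the multiple integral is the alternating sum of mixed integrals
in `[0, ∞]`, provided that these are finite. -/
lemma wienerIto_eq_sum {lam : Measure X} [SigmaFinite lam] {α : ℕ → Measure X}
    (hα : ∀ i, ZeroOne (α i)) {n : ℕ} {f : (Fin n → X) → ℝ} (hf : Measurable f)
    (h0 : ∀ x, 0 ≤ f x)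
    (hfin : ∀ J, mixedIntegral lam α J (fun x => ENNReal.ofReal (f x)) ≠ ∞) :
    wienerIto lam n f (Measure.sum α) = ∑ J : Finset (Fin n), (-1 : ℝ) ^ (n - J.card) *
      (mixedIntegral lam α J fun x => ENNReal.ofReal (f x)).toReal := by
  have := fun b => (hα b).isFiniteMeasure
  have : ∀ m, SFinite (facMeasure α (Fin m)) := fun m => by
    have : Countable (Fin m ↪ ℕ) := DFunLike.coe_injective.countable
    unfold facMeasure
    infer_instance
  rw [wienerIto]
  refine Finset.sum_congr rfl fun J _ => ?_
  congr 1
  have hm : Measurable fun p : ({i : Fin n // i ∉ J} → X) × (Fin J.card → X) =>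
      ENNReal.ofReal (f (glue J p.2 p.1)) :=
    (hf.comp ((measurable_glue J).comp measurable_swap)).ennreal_ofReal
  have hswap : mixedIntegral lam α J (fun x => ENNReal.ofReal (f x))
      = ∫⁻ z, ∫⁻ u, ENNReal.ofReal (f (glue J u z)) ∂(facMeasure α (Fin J.card))
        ∂(Measure.pi fun _ : {i : Fin n // i ∉ J} => lam) :=
    lintegral_lintegral_swap (hm.comp measurable_swap).aemeasurable
  have hJ := hfin J
  rw [hswap] at hJ
  have hmz := hm.lintegral_prod_right' (ν := facMeasure α (Fin J.card))
  have hlt := ae_lt_top hmz hJ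
  rw [hswap, ← integral_toReal hmz.aemeasurable hlt]
  refine integral_congr_ae ?_
  filter_upwards [hlt] with z hz
  have hfz : Measurable fun u => f (glue J u z) :=
    hf.comp ((measurable_glue J).comp (measurable_id.prodMk measurable_const))
  have hint : Integrable (fun u => f (glue J u z)) (facMeasure α (Fin J.card)) := by
    refine ⟨hfz.aestronglyMeasurable, ?_⟩
    rw [hasFiniteIntegral_iff_ofReal (ae_of_all _ fun _ => h0 _)]
    exact hz
  rw [factorialIntegral_eq_integral hα _ _ hfz hint,
    integral_eq_lintegral_of_nonneg_ae (ae_of_all _ fun _ => h0 _) hfz.aestronglyMeasurable]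

section Merge

variable {R : Type*} {n : R → ℕ} (J : ∀ r, Finset (Fin (n r)))

/-- The inclusion of the variables selected by `J` into all variables. -/
def selectIncl : (Σ r, Fin (J r).card) → Σ r, Fin (n r) :=
  fun p => ⟨p.1, (J p.1).orderIsoOfFin rfl p.2⟩

/-- Labels for the blocks of the partition that agrees with `τ` on the variables selected by `J`
and in which the other variables form singletons. -/
def selectLabel (τ : Setoid (Σ r, Fin (J r).card)) (p : Σ r, Fin (n r)) :
    Quotient τ ⊕ (Σ r, {i : Fin (n r) // i ∉ J r}) :=
  if h : p.2 ∈ J p.1 then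
    Sum.inl (Quotient.mk τ ⟨p.1, ((J p.1).orderIsoOfFin rfl).symm ⟨p.2, h⟩⟩)
  else Sum.inr ⟨p.1, p.2, h⟩

lemma selectLabel_incl (τ : Setoid (Σ r, Fin (J r).card)) (x : Σ r, Fin (J r).card) :
    selectLabel J τ (selectIncl J x) = Sum.inl (Quotient.mk τ x) := by
  obtain ⟨r, k⟩ := x
  have h : ((J r).orderIsoOfFin rfl k : Fin (n r)) ∈ J r := ((J r).orderIsoOfFin rfl k).2
  rw [selectLabel, dif_pos (show (selectIncl J ⟨r, k⟩).2 ∈ J (selectIncl J ⟨r, k⟩).1 from h)]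
  exact congrArg (fun l => Sum.inl (Quotient.mk τ ⟨r, l⟩))
    (((J r).orderIsoOfFin rfl).symm_apply_apply k)

lemma exists_selectIncl {p : Σ r, Fin (n r)} (h : p.2 ∈ J p.1) : ∃ x, selectIncl J x = p :=
  ⟨⟨p.1, ((J p.1).orderIsoOfFin rfl).symm ⟨p.2, h⟩⟩, by simp [selectIncl]⟩

lemma selectLabel_surjective (τ : Setoid (Σ r, Fin (J r).card)) :
    Function.Surjective (selectLabel J τ) := by
  rintro (q | ⟨r, i, hi⟩)
  · induction q using Quotient.inductionOn with
    | h x => exact ⟨_, selectLabel_incl J τ x⟩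
  · exact ⟨⟨r, i⟩, by simp [selectLabel, hi]⟩

/-- The partitions separating the entries of each row in which all variables outside `J` are
singletons. -/
def SingletonOff (σ : Setoid (Σ r, Fin (n r))) : Prop :=
  RowSimple σ ∧ ∀ p : Σ r, Fin (n r), p.2 ∉ J p.1 → ∀ q, σ p q → p = q

lemma singletonOff_iff {σ : Setoid (Σ r, Fin (n r))} (hσ : SingletonOff J σ) (p q) :
    σ p q ↔ selectLabel J (Setoid.comap (selectIncl J) σ) p
      = selectLabel J (Setoid.comap (selectIncl J) σ) q := by
  by_cases hp : p.2 ∈ J p.1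
  · obtain ⟨x, rfl⟩ := exists_selectIncl J hp
    rw [selectLabel_incl]
    by_cases hq : q.2 ∈ J q.1
    · obtain ⟨y, rfl⟩ := exists_selectIncl J hq
      rw [selectLabel_incl, Sum.inl.injEq]
      exact (Quotient.eq (r := Setoid.comap (selectIncl J) σ)).symm
    · refine iff_of_false (fun h => ?_) (by simp [selectLabel, hq])
      rw [hσ.2 q hq _ (σ.symm h)] at hq
      exact hq hp
  · by_cases hq : q.2 ∈ J q.1
    · refine iff_of_false (fun h => ?_) (by simp [selectLabel, hq, hp])
      rw [← hσ.2 p hp _ h] at hq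
      exact hp hq
    · constructor
      · intro h; rw [hσ.2 p hp _ h]
      · intro h
        have : p = q := by
          obtain ⟨r, i⟩ := p
          obtain ⟨s, j⟩ := q
          simp only [selectLabel, hp, hq, dite_false, Sum.inr.injEq, Sigma.mk.injEq] at h
          obtain ⟨rfl, h⟩ := h
          simpa using h
        rw [this]

lemma rowSimple_comap {σ : Setoid (Σ r, Fin (n r))} (hσ : RowSimple σ) :
    RowSimple (Setoid.comap (selectIncl J) σ) := fun r j j' h => by
  have h1 := hσ r ((J r).orderIsoOfFin rfl j) ((J r).orderIsoOfFin rfl j') h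
  simpa using h1

/-- Restriction to the variables selected by `J` identifies the partitions with singletons off `J`
and the partitions of the selected variables. -/
lemma bijective_comap_selectIncl :
    Function.Bijective (fun σ : {σ : Setoid (Σ r, Fin (n r)) // SingletonOff J σ} =>
      (⟨Setoid.comap (selectIncl J) σ.1, rowSimple_comap J σ.2.1⟩ :
        {τ : Setoid (Σ r, Fin (J r).card) // RowSimple τ})) := by
  constructor
  · rintro ⟨σ, hσ⟩ ⟨σ', hσ'⟩ h
    have h' : Setoid.comap (selectIncl J) σ = Setoid.comap (selectIncl J) σ' :=
      congrArg Subtype.val h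
    refine Subtype.ext (Setoid.ext fun p q => ?_)
    rw [singletonOff_iff J hσ, singletonOff_iff J hσ', h']
  · rintro ⟨τ, hτ⟩
    have hk : ∀ x y, selectLabel J τ x = selectLabel J τ y → x.2 ∉ J x.1 → x = y := by
      rintro ⟨r, i⟩ ⟨s, j⟩ h hp
      by_cases hq : j ∈ J s
      · simp [selectLabel, hp, hq] at h
      · simp only [selectLabel, hp, hq, dite_false, Sum.inr.injEq, Sigma.mk.injEq] at h
        obtain ⟨rfl, h⟩ := h
        simpa using h
    refine ⟨⟨Setoid.ker (selectLabel J τ), ?_, fun p hp q h => hk p q h hp⟩, ?_⟩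
    · intro r j j' h
      by_cases hj : j ∈ J r
      · by_cases hj' : j' ∈ J r
        · obtain ⟨x, hx⟩ := exists_selectIncl J (p := ⟨r, j⟩) hj
          obtain ⟨y, hy⟩ := exists_selectIncl J (p := ⟨r, j'⟩) hj'
          have h2 : selectLabel J τ ⟨r, j⟩ = selectLabel J τ ⟨r, j'⟩ := h
          obtain ⟨r1, k⟩ := x
          obtain ⟨r2, l⟩ := y
          obtain rfl : r1 = r := congrArg Sigma.fst hx
          obtain rfl : r2 = r1 := congrArg Sigma.fst hy
          rw [← hx, ← hy, selectLabel_incl, selectLabel_incl, Sum.inl.injEq] at h2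
          have h3 := hτ _ _ _ (Quotient.exact h2)
          rw [h3, hy] at hx
          exact (eq_of_heq (Sigma.mk.inj hx).2).symm
        · exact (eq_of_heq (Sigma.mk.inj (hk ⟨r, j'⟩ ⟨r, j⟩ (Eq.symm h) hj')).2).symm
      · exact eq_of_heq (Sigma.mk.inj (hk ⟨r, j⟩ ⟨r, j'⟩ h hj)).2
    · refine Subtype.ext (Setoid.ext fun x y => ?_)
      change selectLabel J τ (selectIncl J x) = selectLabel J τ (selectIncl J y) ↔ _
      rw [selectLabel_incl, selectLabel_incl, Sum.inl.injEq]
      exact Quotient.eq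

open Classical in
/-- The singletons off `J` can be integrated out row by row, as in `mixedIntegral`. -/
lemma weight_eq_of_singletonOff [Fintype R] {lam : Measure X} [SigmaFinite lam]
    {σ : Setoid (Σ r, Fin (n r))} (hσ : SingletonOff J σ) (g : ∀ r, (Fin (n r) → X) → ℝ≥0∞)
    (hg : ∀ r, Measurable (g r)) :
    weight lam σ (fun x => ∏ r, g r fun j => x ⟨r, j⟩)
      = ∫⁻ y, ∏ r, ∫⁻ z, g r (glue (J r)
            (fun k => y (Quotient.mk (Setoid.comap (selectIncl J) σ) ⟨r, k⟩)) z)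
          ∂(Measure.pi fun _ : {i : Fin (n r) // i ∉ J r} => lam)
        ∂(Measure.pi fun _ : Quotient (Setoid.comap (selectIncl J) σ) => lam) := by
  rw [weight_eq_of_surjective (selectLabel_surjective J _) (singletonOff_iff J hσ),
    ← (measurePreserving_sumPiEquivProdPi_symm fun _ => lam).lintegral_comp_emb
      (MeasurableEquiv.measurableEmbedding _), lintegral_prod]
  · refine lintegral_congr fun y => ?_
    rw [prod_lintegral_pi_eq (fun r (_ : {i : Fin (n r) // i ∉ J r}) => lam)]
    · refine lintegral_congr fun z => Finset.prod_congr rfl fun r _ => ?_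
      congr 1
      ext i
      by_cases hi : i ∈ J r
      · simp [selectLabel, glue, hi, MeasurableEquiv.coe_sumPiEquivProdPi_symm,
          Equiv.sumPiEquivProdPi]
      · simp [selectLabel, glue, hi, MeasurableEquiv.coe_sumPiEquivProdPi_symm,
          Equiv.sumPiEquivProdPi]
    · intro r
      have h : ∀ u, Measurable fun z => glue (X := X) (J r) u z := fun u =>
        (measurable_glue (J r)).comp (measurable_const.prodMk measurable_id)
      exact (hg r).comp (h _)
  · refine Measurable.aemeasurable ?_
    refine Finset.measurable_fun_prod _ fun r _ => (hg r).comp ?_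
    exact measurable_pi_iff.2 fun i => (measurable_pi_apply _).comp
      (MeasurableEquiv.measurable _)

end Merge

section Moments

variable {Ω : Type*} [MeasurableSpace Ω] {P : Measure Ω} {lam : Measure X} {η : Ω → Measure X}
variable (hη : IsPoissonProcess P lam η) {α : Ω → ℕ → Measure X} (hα : ∀ ω i, ZeroOne (α ω i))
  (hsum : ∀ ω, η ω = Measure.sum (α ω))

include hη hα hsum

open Classical in
/-- The mean of a product of mixed integrals: all variables in one row are kept apart, and those
integrated against `lam` are not identified with any other variable. -/
lemma lintegral_prod_mixedIntegral [SigmaFinite lam] {R : Type*} [Fintype R] {n : R → ℕ}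
    (J : ∀ r, Finset (Fin (n r))) (g : ∀ r, (Fin (n r) → X) → ℝ≥0∞)
    (hg : ∀ r, Measurable (g r)) :
    AEMeasurable (fun ω => ∏ r, mixedIntegral lam (α ω) (J r) (g r)) P ∧
      ∫⁻ ω, ∏ r, mixedIntegral lam (α ω) (J r) (g r) ∂P
        = ∑ σ : {σ : Setoid (Σ r, Fin (n r)) // SingletonOff J σ},
            weight lam σ.1 fun x => ∏ r, g r fun j => x ⟨r, j⟩ := by
  have hG : ∀ r, Measurable fun u => ∫⁻ z, g r (glue (J r) u z)
      ∂(Measure.pi fun _ : {i : Fin (n r) // i ∉ J r} => lam) := fun r =>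
    ((hg r).comp (measurable_glue (J r))).lintegral_prod_right'
  have hprod : ∀ ω, ∏ r, mixedIntegral lam (α ω) (J r) (g r) = _ := fun ω =>
    prod_lintegral_facMeasure (hα ω) (n := fun r => (J r).card)
      (fun r u => ∫⁻ z, g r (glue (J r) u z)
        ∂(Measure.pi fun _ : {i : Fin (n r) // i ∉ J r} => lam)) hG
  have hc : ∀ τ : {τ : Setoid (Σ r, Fin (J r).card) // RowSimple τ}, _ := fun τ =>
    campbell hη hα hsum (κ := Quotient τ.1) (g := fun y => ∏ r, ∫⁻ z,
        g r (glue (J r) (fun k => y (Quotient.mk τ.1 ⟨r, k⟩)) z)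
        ∂(Measure.pi fun _ : {i : Fin (n r) // i ∉ J r} => lam))
      (Finset.measurable_fun_prod _ fun r _ => (hG r).comp
        (measurable_pi_iff.2 fun k => measurable_pi_apply _))
  simp_rw [hprod]
  refine ⟨Finset.aemeasurable_fun_sum _ fun τ _ => (hc τ).1, ?_⟩
  rw [lintegral_finsetSum' _ fun τ _ => (hc τ).1]
  simp_rw [fun τ => (hc τ).2]
  refine (Fintype.sum_bijective _ (bijective_comap_selectIncl J) _ _ fun σ => ?_).symm
  exact weight_eq_of_singletonOff J σ.2 g hg

end Moments

/-! ### Moments of multiple integrals -/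

/-- The partitions in the moment formula: they separate the entries of each row, and all their
blocks have at least two elements. -/
def Good {R : Type*} {n : R → ℕ} (σ : Setoid (Σ r, Fin (n r))) : Prop :=
  RowSimple σ ∧ ∀ p, ∃ q, q ≠ p ∧ σ p q

/-- The tensor product of the functions `f (n r)`, with values in `[0, ∞]`. -/
noncomputable def rowProd (f : (n : ℕ) → (Fin n → X) → ℝ) {R : Type*} [Fintype R] (n : R → ℕ)
    (x : (Σ r, Fin (n r)) → X) : ℝ≥0∞ :=
  ∏ r, ENNReal.ofReal (f (n r) fun j => x ⟨r, j⟩)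

open Classical in
/-- Inclusion–exclusion in one row: the alternating sum over the sets `J` whose complement lies in
`S` vanishes unless `S` is empty. -/
lemma sum_finset_neg_one_pow (n : ℕ) (S : Fin n → Prop) :
    ∑ J : Finset (Fin n), (-1 : ℝ) ^ (n - J.card) * (if ∀ i, i ∉ J → S i then 1 else 0)
      = if ∀ i, ¬ S i then 1 else 0 := by
  have h1 : ∑ J : Finset (Fin n), (-1 : ℝ) ^ (n - J.card) * (if ∀ i, i ∉ J → S i then 1 else 0)
      = ∑ D : Finset (Fin n), if D ⊆ Finset.univ.filter S then (-1 : ℝ) ^ D.card else 0 := by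
    refine Fintype.sum_bijective (fun J => Jᶜ) compl_bijective _ _ fun J => ?_
    have : (∀ i, i ∉ J → S i) ↔ Jᶜ ⊆ Finset.univ.filter S := by
      simp [Finset.subset_iff]
    rw [Finset.card_compl, Fintype.card_fin]
    by_cases h : ∀ i, i ∉ J → S i
    · rw [if_pos h, if_pos (this.1 h), mul_one]
    · rw [if_neg h, if_neg fun h' => h (this.2 h'), mul_zero]
  have h2 : (Finset.univ.filter fun D : Finset (Fin n) => D ⊆ Finset.univ.filter S)
      = (Finset.univ.filter S).powerset := by ext D; simp
  rw [h1, ← Finset.sum_filter, h2]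
  have h3 := Finset.sum_powerset_neg_one_pow_card (x := Finset.univ.filter S)
  have h4 : (∑ D ∈ (Finset.univ.filter S).powerset, (-1 : ℝ) ^ D.card)
      = ((∑ D ∈ (Finset.univ.filter S).powerset, (-1 : ℤ) ^ D.card : ℤ) : ℝ) := by push_cast; rfl
  rw [h4, h3]
  have h5 : Finset.univ.filter S = ∅ ↔ ∀ i, ¬ S i := by
    simp [Finset.filter_eq_empty_iff]
  by_cases h : ∀ i, ¬ S i
  · rw [if_pos h, if_pos (h5.2 h)]; simp
  · rw [if_neg h, if_neg fun h' => h (h5.1 h')]; simp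

open Classical in
/-- Inclusion–exclusion over the sets of compensated variables removes exactly the partitions that
have a singleton. -/
lemma sum_sign_singletonOff {R : Type*} [Fintype R] {n : R → ℕ} (σ : Setoid (Σ r, Fin (n r))) :
    ∑ J : ∀ r, Finset (Fin (n r)), (∏ r, (-1 : ℝ) ^ (n r - (J r).card)) *
      (if SingletonOff J σ then 1 else 0) = if Good σ then 1 else 0 := by
  by_cases hσ : RowSimple σ
  swap
  · rw [if_neg fun h => hσ h.1]
    exact Finset.sum_eq_zero fun J _ => by rw [if_neg fun h => hσ h.1, mul_zero]
  let S : ∀ r, Fin (n r) → Prop := fun r i => ∀ q, σ ⟨r, i⟩ q → (⟨r, i⟩ : Σ r, Fin (n r)) = q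
  have h1 : ∀ J : ∀ r, Finset (Fin (n r)), (if SingletonOff J σ then (1 : ℝ) else 0)
      = ∏ r, if ∀ i, i ∉ J r → S r i then 1 else 0 := by
    intro J
    by_cases h : SingletonOff J σ
    · rw [if_pos h, Finset.prod_eq_one]
      intro r _
      rw [if_pos]
      exact fun i hi => h.2 ⟨r, i⟩ hi
    · have : ∃ r, ¬ ∀ i, i ∉ J r → S r i := by
        by_contra hcon
        push Not at hcon
        exact h ⟨hσ, fun p hp => hcon p.1 p.2 hp⟩
      obtain ⟨r, hr⟩ := this
      rw [if_neg h, Finset.prod_eq_zero (Finset.mem_univ r) (if_neg hr)]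
  simp_rw [h1, ← Finset.prod_mul_distrib]
  have h2 := Finset.prod_univ_sum (fun r => (Finset.univ : Finset (Finset (Fin (n r)))))
    (fun r J => (-1 : ℝ) ^ (n r - J.card) * (if ∀ i, i ∉ J → S r i then 1 else 0))
  rw [Fintype.piFinset_univ] at h2
  rw [← h2]
  have h3 : ∀ r, ∑ J : Finset (Fin (n r)), (-1 : ℝ) ^ (n r - J.card) *
      (if ∀ i, i ∉ J → S r i then 1 else 0) = if ∀ i, ¬ S r i then 1 else 0 := fun r => by
    convert sum_finset_neg_one_pow (n r) (S r)
  rw [Finset.prod_congr rfl fun r _ => h3 r]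
  by_cases hg : Good σ
  · rw [if_pos hg]
    refine Finset.prod_eq_one fun r _ => if_pos fun i hi => ?_
    obtain ⟨q, hq, hq'⟩ := hg.2 ⟨r, i⟩
    exact hq (hi q hq').symm
  · have : ∃ p : Σ r, Fin (n r), S p.1 p.2 := by
      by_contra hcon
      push Not at hcon
      refine hg ⟨hσ, fun p => ?_⟩
      have := hcon p
      simp only [S] at this
      push Not at this
      obtain ⟨q, h, h'⟩ := this
      exact ⟨q, fun h'' => h' h''.symm, h⟩
    obtain ⟨p, hp⟩ := this
    rw [if_neg hg, Finset.prod_eq_zero (Finset.mem_univ p.1) (if_neg fun h => h p.2 hp)]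

section Moments

variable {Ω : Type*} [MeasurableSpace Ω] {P : Measure Ω} {lam : Measure X} {η : Ω → Measure X}

open Classical in
/-- The moment formula for products of multiple Wiener–Itô integrals of non-negative functions. -/
theorem integral_prod_wienerIto [SigmaFinite lam] (hη : IsPoissonProcess P lam η)
    {f : (n : ℕ) → (Fin n → X) → ℝ} {R : Type*} [Fintype R] {n : R → ℕ}
    (hf : ∀ r, Measurable (f (n r))) (h0 : ∀ r x, 0 ≤ f (n r) x)
    (hfin : ∀ σ : Setoid (Σ r, Fin (n r)), RowSimple σ → weight lam σ (rowProd f n) ≠ ∞)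
    (hfin1 : ∀ r, ∀ σ : Setoid (Σ _ : Unit, Fin (n r)), RowSimple σ →
      weight lam σ (rowProd f fun _ : Unit => n r) ≠ ∞) :
    Integrable (fun ω => ∏ r, wienerIto lam (n r) (f (n r)) (η ω)) P ∧
      ∫ ω, ∏ r, wienerIto lam (n r) (f (n r)) (η ω) ∂P
        = (∑ σ : Setoid (Σ r, Fin (n r)),
            if Good σ then weight lam σ (rowProd f n) else 0).toReal := by
  have hdec : ∀ ω, ∃ α : ℕ → Measure X, (∀ i, ZeroOne (α i)) ∧ η ω = Measure.sum α := fun ω =>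
    have := hη.sigmaFinite ω
    exists_eq_sum_zeroOne (η ω) (hη.integerValued ω)
  choose α hα hsum using hdec
  let g : ∀ r, (Fin (n r) → X) → ℝ≥0∞ := fun r x => ENNReal.ofReal (f (n r) x)
  have hg : ∀ r, Measurable (g r) := fun r => (hf r).ennreal_ofReal
  have hmix : ∀ᵐ ω ∂P, ∀ r (J : Finset (Fin (n r))), mixedIntegral lam (α ω) J (g r) ≠ ∞ := by
    refine ae_all_iff.2 fun r => ae_all_iff.2 fun J => ?_
    have h := lintegral_prod_mixedIntegral hη hα hsum (R := Unit) (n := fun _ => n r)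
      (fun _ => J) (fun _ => g r) fun _ => hg r
    simp only [Finset.univ_unique, Finset.prod_singleton] at h
    have hlt := ae_lt_top' h.1 (by
      rw [h.2]
      refine ENNReal.sum_ne_top.2 fun σ _ => ?_
      have := hfin1 r σ.1 σ.2.1
      have he : rowProd f (fun _ : Unit => n r)
          = fun x => ENNReal.ofReal (f (n r) fun j => x ⟨(), j⟩) := by
        funext x; simp [rowProd]
      rw [he] at this
      exact this)
    exact hlt.mono fun ω hω => hω.ne
  have hprod := fun J : ∀ r, Finset (Fin (n r)) =>
    lintegral_prod_mixedIntegral hη hα hsum J g hg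
  have hprodfin : ∀ J : ∀ r, Finset (Fin (n r)),
      ∫⁻ ω, ∏ r, mixedIntegral lam (α ω) (J r) (g r) ∂P ≠ ∞ := by
    intro J
    rw [(hprod J).2]
    exact ENNReal.sum_ne_top.2 fun σ _ => hfin σ.1 σ.2.1
  have hae : (fun ω => ∏ r, wienerIto lam (n r) (f (n r)) (η ω)) =ᵐ[P]
      fun ω => ∑ J : ∀ r, Finset (Fin (n r)), (∏ r, (-1 : ℝ) ^ (n r - (J r).card)) *
        (∏ r, mixedIntegral lam (α ω) (J r) (g r)).toReal := by
    filter_upwards [hmix] with ω hω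
    have h1 : ∀ r, wienerIto lam (n r) (f (n r)) (η ω) = _ := fun r => by
      rw [hsum ω, wienerIto_eq_sum (hα ω) (hf r) (h0 r) (hω r)]
    simp_rw [h1]
    rw [Finset.prod_univ_sum, Fintype.piFinset_univ]
    refine Finset.sum_congr rfl fun J _ => ?_
    rw [Finset.prod_mul_distrib, ENNReal.toReal_prod]
  have hint : ∀ J : ∀ r, Finset (Fin (n r)), Integrable (fun ω =>
      (∏ r, (-1 : ℝ) ^ (n r - (J r).card)) *
        (∏ r, mixedIntegral lam (α ω) (J r) (g r)).toReal) P := fun J =>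
    (integrable_toReal_of_lintegral_ne_top (hprod J).1 (hprodfin J)).const_mul _
  refine ⟨(integrable_finsetSum _ fun J _ => hint J).congr hae.symm, ?_⟩
  rw [integral_congr_ae hae, integral_finsetSum _ fun J _ => hint J]
  have h2 : ∀ J : ∀ r, Finset (Fin (n r)),
      ∫ ω, (∏ r, (-1 : ℝ) ^ (n r - (J r).card)) *
        (∏ r, mixedIntegral lam (α ω) (J r) (g r)).toReal ∂P
      = ∑ σ : Setoid (Σ r, Fin (n r)), ((∏ r, (-1 : ℝ) ^ (n r - (J r).card)) *
          if SingletonOff J σ then 1 else 0) * (weight lam σ (rowProd f n)).toReal := by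
    intro J
    rw [integral_const_mul, integral_toReal (hprod J).1 (ae_lt_top' (hprod J).1 (hprodfin J)),
      (hprod J).2, ENNReal.toReal_sum fun σ _ => hfin σ.1 σ.2.1]
    simp_rw [mul_assoc, ← Finset.mul_sum]
    congr 1
    simp_rw [ite_mul, one_mul, zero_mul]
    rw [← Finset.sum_filter, Finset.sum_subtype (p := fun σ => SingletonOff J σ)]
    · rfl
    · simp
  simp_rw [h2]
  rw [Finset.sum_comm]
  simp_rw [← Finset.sum_mul, sum_sign_singletonOff]
  rw [ENNReal.toReal_sum]
  · refine Finset.sum_congr rfl fun σ _ => ?_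
    split_ifs <;> simp
  · intro σ _
    split_ifs with h
    · exact hfin σ h.1
    · simp

end Moments

/-! ### Connected partitions -/

section Split

variable {R : Type*} {n : R → ℕ}

/-- A set of rows, given as a predicate `p`, is saturated if the blocks of `σ` do not link a row
in the set to a row outside it. -/
def Saturated (σ : Setoid (Σ r, Fin (n r))) (p : R → Prop) : Prop :=
  ∀ x y, σ x y → (p x.1 ↔ p y.1)

/-- The blocks of `σ` link all rows: only the trivial sets of rows are saturated. -/
def Connected (σ : Setoid (Σ r, Fin (n r))) : Prop :=
  ∀ p : R → Prop, Saturated σ p → (∀ r, p r) ∨ ∀ r, ¬ p r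

/-- The set of rows linked by `σ` to the row `r₀`: the smallest saturated set containing it. -/
def component (σ : Setoid (Σ r, Fin (n r))) (r₀ r : R) : Prop :=
  ∀ p : R → Prop, Saturated σ p → p r₀ → p r

lemma saturated_component (σ : Setoid (Σ r, Fin (n r))) (r₀ : R) :
    Saturated σ (component σ r₀) := fun x y h =>
  ⟨fun hx p hp h0 => (hp x y h).1 (hx p hp h0), fun hy p hp h0 => (hp x y h).2 (hy p hp h0)⟩

lemma component_self (σ : Setoid (Σ r, Fin (n r))) (r₀ : R) : component σ r₀ r₀ := fun _ _ h => h

lemma connected_iff_component (σ : Setoid (Σ r, Fin (n r))) (r₀ : R) :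
    Connected σ ↔ ∀ r, component σ r₀ r := by
  constructor
  · intro h
    exact (h _ (saturated_component σ r₀)).resolve_right fun h' => h' r₀ (component_self σ r₀)
  · intro h p hp
    by_cases h0 : p r₀
    · exact Or.inl fun r => h r p hp h0
    · exact Or.inr fun r => h r (fun r => ¬ p r) (fun x y hxy => not_congr (hp x y hxy)) h0

/-- The inclusion of the variables in the rows with `p` into all variables. -/
def rowIncl (p : R → Prop) : (Σ r : {r // p r}, Fin (n r)) → Σ r, Fin (n r) :=
  fun x => ⟨x.1.1, x.2⟩

/-- The restriction of a partition to the rows with `p`. -/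
abbrev restrictRows (p : R → Prop) (σ : Setoid (Σ r, Fin (n r))) :
    Setoid (Σ r : {r // p r}, Fin (n r)) :=
  Setoid.comap (rowIncl p) σ

lemma exists_rowIncl {p : R → Prop} {x : Σ r, Fin (n r)} (h : p x.1) :
    ∃ y, rowIncl p y = x := ⟨⟨⟨x.1, h⟩, x.2⟩, rfl⟩

lemma rowIncl_injective (p : R → Prop) : Function.Injective (rowIncl (n := n) p) := by
  rintro ⟨⟨r, hr⟩, k⟩ ⟨⟨s, hs⟩, l⟩ h
  simp only [rowIncl, Sigma.mk.injEq] at h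
  obtain ⟨rfl, h⟩ := h
  obtain rfl := eq_of_heq h
  rfl

open Classical in
/-- Labels for the blocks of the union of a partition of the variables in the rows with `p` and
one of the variables in the other rows. -/
noncomputable def splitLabel (p : R → Prop) (σ₁ : Setoid (Σ r : {r // p r}, Fin (n r)))
    (σ₂ : Setoid (Σ r : {r // ¬ p r}, Fin (n r))) (x : Σ r, Fin (n r)) :
    Quotient σ₁ ⊕ Quotient σ₂ :=
  if h : p x.1 then Sum.inl (Quotient.mk σ₁ ⟨⟨x.1, h⟩, x.2⟩)
  else Sum.inr (Quotient.mk σ₂ ⟨⟨x.1, h⟩, x.2⟩)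

lemma splitLabel_inl (p : R → Prop) (σ₁ : Setoid (Σ r : {r // p r}, Fin (n r)))
    (σ₂ : Setoid (Σ r : {r // ¬ p r}, Fin (n r))) (x : Σ r : {r // p r}, Fin (n r)) :
    splitLabel p σ₁ σ₂ (rowIncl p x) = Sum.inl (Quotient.mk σ₁ x) :=
  dif_pos x.1.2

lemma splitLabel_inr (p : R → Prop) (σ₁ : Setoid (Σ r : {r // p r}, Fin (n r)))
    (σ₂ : Setoid (Σ r : {r // ¬ p r}, Fin (n r))) (x : Σ r : {r // ¬ p r}, Fin (n r)) :
    splitLabel p σ₁ σ₂ (rowIncl (fun r => ¬ p r) x) = Sum.inr (Quotient.mk σ₂ x) :=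
  dif_neg x.1.2

lemma splitLabel_surjective (p : R → Prop) (σ₁ : Setoid (Σ r : {r // p r}, Fin (n r)))
    (σ₂ : Setoid (Σ r : {r // ¬ p r}, Fin (n r))) :
    Function.Surjective (splitLabel p σ₁ σ₂) := by
  rintro (q | q)
  · induction q using Quotient.inductionOn with
    | h x => exact ⟨_, splitLabel_inl p σ₁ σ₂ x⟩
  · induction q using Quotient.inductionOn with
    | h x => exact ⟨_, splitLabel_inr p σ₁ σ₂ x⟩

lemma saturated_iff_splitLabel {p : R → Prop} {σ : Setoid (Σ r, Fin (n r))}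
    (hσ : Saturated σ p) (x y) :
    σ x y ↔ splitLabel p (restrictRows p σ) (restrictRows (fun r => ¬ p r) σ) x
      = splitLabel p (restrictRows p σ) (restrictRows (fun r => ¬ p r) σ) y := by
  by_cases hx : p x.1 <;> by_cases hy : p y.1
  · obtain ⟨x, rfl⟩ := exists_rowIncl hx
    obtain ⟨y, rfl⟩ := exists_rowIncl hy
    rw [splitLabel_inl, splitLabel_inl, Sum.inl.injEq]
    exact (Quotient.eq (r := restrictRows p σ)).symm
  · exact iff_of_false (fun h => hy ((hσ x y h).1 hx)) (by simp [splitLabel, hx, hy])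
  · exact iff_of_false (fun h => hx ((hσ x y h).2 hy)) (by simp [splitLabel, hx, hy])
  · obtain ⟨x, rfl⟩ := exists_rowIncl (p := fun r => ¬ p r) hx
    obtain ⟨y, rfl⟩ := exists_rowIncl (p := fun r => ¬ p r) hy
    rw [splitLabel_inr, splitLabel_inr, Sum.inr.injEq]
    exact (Quotient.eq (r := restrictRows (fun r => ¬ p r) σ)).symm

/-- A partition with a saturated set of rows is given by its restrictions to this set and to the
complement. -/
lemma bijective_restrictRows (p : R → Prop) :
    Function.Bijective (fun σ : {σ : Setoid (Σ r, Fin (n r)) // Saturated σ p} =>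
      (restrictRows p σ.1, restrictRows (fun r => ¬ p r) σ.1)) := by
  constructor
  · rintro ⟨σ, hσ⟩ ⟨σ', hσ'⟩ h
    have h1 : restrictRows p σ = restrictRows p σ' := congrArg Prod.fst h
    have h2 : restrictRows (fun r => ¬ p r) σ = restrictRows (fun r => ¬ p r) σ' :=
      congrArg Prod.snd h
    refine Subtype.ext (Setoid.ext fun x y => ?_)
    rw [saturated_iff_splitLabel hσ, saturated_iff_splitLabel hσ', h1, h2]
  · rintro ⟨σ₁, σ₂⟩
    refine ⟨⟨Setoid.ker (splitLabel p σ₁ σ₂), fun x y h => ?_⟩, ?_⟩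
    · have h' : splitLabel p σ₁ σ₂ x = splitLabel p σ₁ σ₂ y := h
      by_cases hx : p x.1 <;> by_cases hy : p y.1
      · exact iff_of_true hx hy
      · simp [splitLabel, hx, hy] at h'
      · simp [splitLabel, hx, hy] at h'
      · exact iff_of_false hx hy
    · refine Prod.ext (Setoid.ext fun x y => ?_) (Setoid.ext fun x y => ?_)
      · change splitLabel p σ₁ σ₂ (rowIncl p x) = splitLabel p σ₁ σ₂ (rowIncl p y) ↔ _
        rw [splitLabel_inl, splitLabel_inl, Sum.inl.injEq]
        exact Quotient.eq
      · change splitLabel p σ₁ σ₂ (rowIncl _ x) = splitLabel p σ₁ σ₂ (rowIncl _ y) ↔ _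
        rw [splitLabel_inr, splitLabel_inr, Sum.inr.injEq]
        exact Quotient.eq

lemma good_iff_of_saturated {p : R → Prop} {σ : Setoid (Σ r, Fin (n r))} (hσ : Saturated σ p) :
    Good σ ↔ Good (restrictRows p σ) ∧ Good (restrictRows (fun r => ¬ p r) σ) := by
  have aux : ∀ q : R → Prop, Saturated σ q → Good σ → Good (restrictRows q σ) := by
    intro q hq hg
    refine ⟨fun r j j' h => hg.1 r.1 j j' h, fun x => ?_⟩
    obtain ⟨y, hy, hxy⟩ := hg.2 (rowIncl q x)
    obtain ⟨y, rfl⟩ := exists_rowIncl ((hq _ _ hxy).1 x.1.2)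
    exact ⟨y, fun h => hy (congrArg _ h), hxy⟩
  have hσ' : Saturated σ fun r => ¬ p r := fun x y h => not_congr (hσ x y h)
  refine ⟨fun h => ⟨aux p hσ h, aux _ hσ' h⟩, fun ⟨h1, h2⟩ => ⟨fun r j j' h => ?_, fun x => ?_⟩⟩
  · by_cases hr : p r
    · exact h1.1 ⟨r, hr⟩ j j' h
    · exact h2.1 ⟨r, hr⟩ j j' h
  · by_cases hr : p x.1
    · obtain ⟨x, rfl⟩ := exists_rowIncl hr
      obtain ⟨y, hy, hxy⟩ := h1.2 x
      exact ⟨rowIncl p y, fun h => hy (rowIncl_injective p h), hxy⟩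
    · obtain ⟨x, rfl⟩ := exists_rowIncl (p := fun r => ¬ p r) hr
      obtain ⟨y, hy, hxy⟩ := h2.2 x
      exact ⟨rowIncl _ y, fun h => hy (rowIncl_injective _ h), hxy⟩

/-- A saturated set of rows containing `r₀` is the component of `r₀` if and only if the restriction
to it is connected. -/
lemma component_eq_iff {p : R → Prop} {σ : Setoid (Σ r, Fin (n r))} (hσ : Saturated σ p)
    {r₀ : R} (h0 : p r₀) :
    (∀ r, component σ r₀ r ↔ p r) ↔ Connected (restrictRows p σ) := by
  rw [connected_iff_component _ ⟨r₀, h0⟩]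
  constructor
  · intro h r q hq hq0
    have hsat : Saturated σ fun s => ∃ hs : p s, q ⟨s, hs⟩ := by
      intro x y hxy
      constructor
      · rintro ⟨hx, hqx⟩
        have hy := (hσ x y hxy).1 hx
        exact ⟨hy, (hq ⟨⟨x.1, hx⟩, x.2⟩ ⟨⟨y.1, hy⟩, y.2⟩ hxy).1 hqx⟩
      · rintro ⟨hy, hqy⟩
        have hx := (hσ x y hxy).2 hy
        exact ⟨hx, (hq ⟨⟨x.1, hx⟩, x.2⟩ ⟨⟨y.1, hy⟩, y.2⟩ hxy).2 hqy⟩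
    obtain ⟨_, h'⟩ := (h r.1).2 r.2 _ hsat ⟨h0, hq0⟩
    exact h'
  · intro h r
    refine ⟨fun hr => hr p hσ h0, fun hr q hq hq0 => ?_⟩
    exact h ⟨r, hr⟩ (fun s => q s.1) (fun x y hxy => hq _ _ hxy) hq0

lemma measurable_rowProd {f : (n : ℕ) → (Fin n → X) → ℝ} [Fintype R]
    (hf : ∀ r, Measurable (f (n r))) : Measurable (rowProd f n) :=
  Finset.measurable_fun_prod _ fun r _ =>
    ((hf r).comp (measurable_pi_iff.2 fun _ => measurable_pi_apply _)).ennreal_ofReal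

open Classical in
/-- Weights are multiplicative: the variables in a saturated set of rows are independent of the
others. -/
lemma weight_eq_mul_of_saturated [Fintype R] {lam : Measure X} [SigmaFinite lam]
    {p : R → Prop} {σ : Setoid (Σ r, Fin (n r))} (hσ : Saturated σ p)
    {f : (n : ℕ) → (Fin n → X) → ℝ} (hf : ∀ r, Measurable (f (n r))) :
    weight lam σ (rowProd f n)
      = weight lam (restrictRows p σ) (rowProd f fun r : {r // p r} => n r)
        * weight lam (restrictRows (fun r => ¬ p r) σ) (rowProd f fun r : {r // ¬ p r} => n r) := by
  rw [weight_eq_of_surjective (splitLabel_surjective p _ _) (saturated_iff_splitLabel hσ),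
    ← (measurePreserving_sumPiEquivProdPi_symm fun _ => lam).lintegral_comp_emb
      (MeasurableEquiv.measurableEmbedding _), weight, weight, ← lintegral_prod_mul]
  · refine lintegral_congr fun y => ?_
    rw [rowProd, ← Fintype.prod_subtype_mul_prod_subtype p]
    congr 1
    · refine Finset.prod_congr rfl fun r _ => ?_
      congr 2
      ext j
      have := splitLabel_inl p (restrictRows p σ) (restrictRows (fun r => ¬ p r) σ) ⟨r, j⟩
      rw [rowIncl] at this
      rw [this]
      rfl
    · refine Finset.prod_congr rfl fun r _ => ?_
      congr 2
      ext j
      have := splitLabel_inr p (restrictRows p σ) (restrictRows (fun r => ¬ p r) σ) ⟨r, j⟩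
      rw [rowIncl] at this
      rw [this]
      rfl
  · exact ((measurable_rowProd fun r => hf _).comp
      (measurable_pi_iff.2 fun _ => measurable_pi_apply _)).aemeasurable
  · exact ((measurable_rowProd fun r => hf _).comp
      (measurable_pi_iff.2 fun _ => measurable_pi_apply _)).aemeasurable

end Split

open Classical in
/-- The sum of the weights in the moment formula for the rows `f (n r)`. -/
noncomputable def goodSum (lam : Measure X) (f : (n : ℕ) → (Fin n → X) → ℝ) {R : Type*} [Fintype R]
    (n : R → ℕ) : ℝ≥0∞ :=
  ∑ σ : Setoid (Σ r, Fin (n r)), if Good σ then weight lam σ (rowProd f n) else 0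

open Classical in
/-- The part of the sum in the moment formula that comes from connected partitions. -/
noncomputable def connectedSum (lam : Measure X) (f : (n : ℕ) → (Fin n → X) → ℝ) {R : Type*}
    [Fintype R] (n : R → ℕ) : ℝ≥0∞ :=
  ∑ σ : Setoid (Σ r, Fin (n r)), if Good σ ∧ Connected σ then weight lam σ (rowProd f n) else 0

/-- Classification of the good partitions by the component of the row `r₀`. -/
lemma goodSum_eq {R : Type*} [Fintype R] [DecidableEq R] {lam : Measure X} [SigmaFinite lam]
    {n : R → ℕ} {f : (n : ℕ) → (Fin n → X) → ℝ} (hf : ∀ r, Measurable (f (n r))) (r₀ : R) :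
    goodSum lam f n = connectedSum lam f n
      + ∑ B ∈ (Finset.univ : Finset (Finset R)).filter (fun B => r₀ ∈ B ∧ B ≠ Finset.univ),
          connectedSum lam f (fun r : {r // r ∈ B} => n r)
            * goodSum lam f (fun r : {r // r ∉ B} => n r) := by
  classical
  let comp : Setoid (Σ r, Fin (n r)) → Finset R := fun σ => Finset.univ.filter (component σ r₀)
  have hcomp : ∀ σ B, comp σ = B ↔ ∀ r, component σ r₀ r ↔ r ∈ B := by
    intro σ B
    simp [comp, Finset.ext_iff]
  have h1 : goodSum lam f n = ∑ B : Finset R, ∑ σ : Setoid (Σ r, Fin (n r)),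
      if Good σ ∧ comp σ = B then weight lam σ (rowProd f n) else 0 := by
    rw [Finset.sum_comm, goodSum]
    refine Finset.sum_congr rfl fun σ _ => ?_
    simp_rw [ite_and]
    split_ifs <;> simp
  have huniv : (∑ σ : Setoid (Σ r, Fin (n r)),
      if Good σ ∧ comp σ = Finset.univ then weight lam σ (rowProd f n) else 0)
      = connectedSum lam f n := by
    refine Finset.sum_congr rfl fun σ _ => ?_
    have : comp σ = Finset.univ ↔ Connected σ := by
      rw [hcomp, connected_iff_component σ r₀]; simp
    simp_rw [this]
  have hout : ∀ B : Finset R, r₀ ∉ B → (∑ σ : Setoid (Σ r, Fin (n r)),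
      if Good σ ∧ comp σ = B then weight lam σ (rowProd f n) else 0) = 0 := by
    intro B hB
    refine Finset.sum_eq_zero fun σ _ => if_neg fun h => hB ?_
    exact ((hcomp σ B).1 h.2 r₀).1 (component_self σ r₀)
  have hin : ∀ B : Finset R, r₀ ∈ B → (∑ σ : Setoid (Σ r, Fin (n r)),
      if Good σ ∧ comp σ = B then weight lam σ (rowProd f n) else 0)
      = connectedSum lam f (fun r : {r // r ∈ B} => n r)
            * goodSum lam f (fun r : {r // r ∉ B} => n r) := by
    intro B hB
    have hsat : ∀ σ : Setoid (Σ r, Fin (n r)), comp σ = B → Saturated σ (· ∈ B) := by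
      intro σ h x y hxy
      change x.1 ∈ B ↔ y.1 ∈ B
      rw [← (hcomp σ B).1 h, ← (hcomp σ B).1 h]
      exact saturated_component σ r₀ x y hxy
    have e1 : (∑ σ : Setoid (Σ r, Fin (n r)),
        if Good σ ∧ comp σ = B then weight lam σ (rowProd f n) else 0)
        = ∑ σ : {σ : Setoid (Σ r, Fin (n r)) // Saturated σ (· ∈ B)},
          if Good σ.1 ∧ comp σ.1 = B then weight lam σ.1 (rowProd f n) else 0 := by
      rw [← Finset.sum_subtype (Finset.univ.filter fun σ => Saturated σ (· ∈ B)) (by simp)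
        (fun σ => if Good σ ∧ comp σ = B then weight lam σ (rowProd f n) else 0),
        Finset.sum_filter]
      refine Finset.sum_congr rfl fun σ _ => ?_
      by_cases h : comp σ = B
      · rw [if_pos (hsat σ h)]
      · simp [h]
    rw [e1, connectedSum, goodSum, Finset.sum_mul_sum, ← Fintype.sum_prod_type']
    refine Fintype.sum_bijective _ (bijective_restrictRows (· ∈ B)) _ _ ?_
    rintro ⟨σ, hσ⟩
    have hg := good_iff_of_saturated hσ
    have hc : comp σ = B ↔ Connected (restrictRows (· ∈ B) σ) :=
      (hcomp σ B).trans (component_eq_iff hσ hB)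
    simp only
    rw [weight_eq_mul_of_saturated hσ hf]
    by_cases c1 : Good (restrictRows (· ∈ B) σ) ∧ Connected (restrictRows (· ∈ B) σ)
    · by_cases c2 : Good (restrictRows (fun r => ¬ r ∈ B) σ)
      · rw [if_pos ⟨hg.2 ⟨c1.1, c2⟩, hc.2 c1.2⟩, if_pos c1, if_pos c2]
        congr!
      · rw [if_neg fun h => c2 (hg.1 h.1).2, if_neg c2, mul_zero]
    · rw [if_neg fun h => c1 ⟨(hg.1 h.1).1, hc.1 h.2⟩, if_neg c1, zero_mul]
  rw [h1, ← Finset.add_sum_erase _ _ (Finset.mem_univ (Finset.univ : Finset R)), huniv]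
  congr 1
  rw [← Finset.sum_filter_add_sum_filter_not _ (fun B : Finset R => r₀ ∈ B),
    Finset.sum_eq_zero (s := Finset.filter (fun B : Finset R => ¬ r₀ ∈ B) _)
      fun B hB => hout B (Finset.mem_filter.1 hB).2, add_zero]
  refine Finset.sum_congr ?_ fun B hB => hin B ?_
  · ext B; simp [and_comm]
  · simp only [Finset.mem_filter] at hB
    exact hB.2.1

/-- The total weight in the formula for the moments of the sum of the first `N` chaoses. -/
noncomputable def momentSum (lam : Measure X) (f : (n : ℕ) → (Fin n → X) → ℝ) (N : ℕ) (R : Type*)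
    [Fintype R] [DecidableEq R] : ℝ≥0∞ :=
  ∑ n : R → Fin N, goodSum lam f fun r => (n r : ℕ) + 1

/-- The total weight of the connected partitions in the formula for the moments of the sum of the
first `N` chaoses. -/
noncomputable def cumulantSum (lam : Measure X) (f : (n : ℕ) → (Fin n → X) → ℝ) (N : ℕ)
    (R : Type*) [Fintype R] [DecidableEq R] : ℝ≥0∞ :=
  ∑ n : R → Fin N, connectedSum lam f fun r => (n r : ℕ) + 1

/-- The exponential formula: the component of a fixed row `r₀` is split off. -/
lemma momentSum_eq {R : Type*} [Fintype R] [DecidableEq R] {lam : Measure X} [SigmaFinite lam]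
    {f : (n : ℕ) → (Fin n → X) → ℝ} (hf : ∀ n, 1 ≤ n → Measurable (f n)) (N : ℕ) (r₀ : R) :
    momentSum lam f N R = cumulantSum lam f N R
      + ∑ B ∈ (Finset.univ : Finset (Finset R)).filter (fun B => r₀ ∈ B ∧ B ≠ Finset.univ),
          cumulantSum lam f N {r // r ∈ B} * momentSum lam f N {r // r ∉ B} := by
  rw [momentSum,
    Finset.sum_congr rfl fun n _ => goodSum_eq (fun r => hf _ (Nat.le_add_left 1 _)) r₀,
    Finset.sum_add_distrib, cumulantSum, Finset.sum_comm]
  congr 1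
  refine Finset.sum_congr rfl fun B _ => ?_
  rw [cumulantSum, momentSum, Finset.sum_mul_sum, ← Fintype.sum_prod_type']
  exact Fintype.sum_equiv (Equiv.piEquivPiSubtypeProd (· ∈ B) fun _ => Fin N) _ _ fun n => rfl

/-! ### Cumulants from moments -/

/-- The cumulants `κ_{s+1} = cumulantSeq m s` that belong to the moments `m`, defined by the
recursion `m_{s+1} = ∑_{j ≤ s} (s choose j) κ_{j+1} m_{s-j}` with `m_0 = 1`. -/
noncomputable def cumulantSeq (m : ℕ → ℝ) (s : ℕ) : ℝ :=
  m (s + 1) - ∑ j : Fin s, (s.choose j : ℝ) * cumulantSeq m j * m (s - j)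
decreasing_by exact j.2

/-- There are `s choose j` sets of `j + 1` rows that contain a fixed one of the `s + 1` rows. -/
lemma sum_finset_containing {R : Type*} [Fintype R] [DecidableEq R] (r₀ : R) {s : ℕ}
    (hs : Fintype.card R = s + 1) (G : ℕ → ℝ) :
    ∑ B ∈ (Finset.univ : Finset (Finset R)).filter (fun B => r₀ ∈ B ∧ B ≠ Finset.univ),
        G (B.card - 1) = ∑ j : Fin s, (s.choose j : ℝ) * G j := by
  set x := (Finset.univ : Finset R).erase r₀ with hx
  have hxc : x.card = s := by
    rw [hx, Finset.card_erase_of_mem (Finset.mem_univ _), Finset.card_univ, hs]; rfl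
  set G' : ℕ → ℝ := fun j => if j = s then 0 else G j with hG'
  have h1 : ∑ B ∈ (Finset.univ : Finset (Finset R)).filter (fun B => r₀ ∈ B ∧ B ≠ Finset.univ),
        G (B.card - 1) = ∑ B ∈ x.powerset.filter (fun B => B ≠ x), G' B.card := by
    refine Finset.sum_nbij' (fun B => B.erase r₀) (fun B => insert r₀ B) ?_ ?_ ?_ ?_ ?_
    · intro B hB
      simp only [Finset.mem_filter, Finset.mem_univ, true_and] at hB
      simp only [Finset.mem_filter, Finset.mem_powerset]
      refine ⟨Finset.erase_subset_erase _ (Finset.subset_univ _), fun h => hB.2 ?_⟩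
      rw [← Finset.insert_erase hB.1, h, hx, Finset.insert_erase (Finset.mem_univ _)]
    · intro B hB
      simp only [Finset.mem_filter, Finset.mem_powerset] at hB
      simp only [Finset.mem_filter, Finset.mem_univ, true_and]
      refine ⟨Finset.mem_insert_self _ _, fun h => hB.2 ?_⟩
      have hr : r₀ ∉ B := fun h' => by simpa [hx] using hB.1 h'
      rw [hx, ← h, Finset.erase_insert hr]
    · intro B hB
      simp only [Finset.mem_filter, Finset.mem_univ, true_and] at hB
      exact Finset.insert_erase hB.1
    · intro B hB
      simp only [Finset.mem_filter, Finset.mem_powerset] at hB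
      have hr : r₀ ∉ B := fun h' => by simpa [hx] using hB.1 h'
      exact Finset.erase_insert hr
    · intro B hB
      simp only [Finset.mem_filter, Finset.mem_univ, true_and] at hB
      have hlt : B.card < s + 1 := by
        rw [← hs]; exact (Finset.card_lt_iff_ne_univ B).2 hB.2
      have hpos : 0 < B.card := Finset.card_pos.2 ⟨_, hB.1⟩
      rw [Finset.card_erase_of_mem hB.1, hG']
      simp only
      rw [if_neg (by omega)]
  have h2 : ∑ B ∈ x.powerset.filter (fun B => B ≠ x), G' B.card
      = ∑ B ∈ x.powerset, G' B.card := by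
    refine Finset.sum_filter_of_ne fun B hB h => ?_
    rintro rfl
    exact h (by simp [hG', hxc])
  rw [h1, h2, Finset.sum_powerset_apply_card (fun j => G' j), hxc, Finset.sum_range_succ]
  rw [Finset.sum_range]
  simp only [hG', if_true, smul_zero, add_zero, nsmul_eq_mul]
  exact Finset.sum_congr rfl fun j _ => by rw [if_neg j.2.ne]

/-- The connected partitions account for the cumulants. -/
lemma toReal_cumulantSum {lam : Measure X} [SigmaFinite lam]
    {f : (n : ℕ) → (Fin n → X) → ℝ} (hf : ∀ n, 1 ≤ n → Measurable (f n)) {N : ℕ} {m : ℕ → ℝ}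
    (hM : ∀ (R : Type) [Fintype R] [DecidableEq R], momentSum lam f N R ≠ ∞ ∧
      (momentSum lam f N R).toReal = m (Fintype.card R)) (s : ℕ) :
    ∀ (R : Type) [Fintype R] [DecidableEq R], Fintype.card R = s + 1 →
      (cumulantSum lam f N R).toReal = cumulantSeq m s := by
  induction s using Nat.strong_induction_on with
  | _ s ih =>
    intro R _ _ hR
    obtain ⟨r₀⟩ : Nonempty R := Fintype.card_pos_iff.1 (by omega)
    have h := momentSum_eq (lam := lam) hf N r₀
    have hfin := (hM R).1
    rw [h] at hfin
    have h1 := (ENNReal.add_ne_top.1 hfin).1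
    have h2 := (ENNReal.add_ne_top.1 hfin).2
    have h3 := congrArg ENNReal.toReal h
    rw [(hM R).2, ENNReal.toReal_add h1 h2, ENNReal.toReal_sum (ENNReal.sum_ne_top.1 h2), hR] at h3
    rw [cumulantSeq, h3]
    have h4 : ∑ B ∈ (Finset.univ : Finset (Finset R)).filter
          (fun B => r₀ ∈ B ∧ B ≠ Finset.univ),
          (cumulantSum lam f N {r // r ∈ B} * momentSum lam f N {r // r ∉ B}).toReal
        = ∑ B ∈ (Finset.univ : Finset (Finset R)).filter
          (fun B => r₀ ∈ B ∧ B ≠ Finset.univ),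
          (fun j => cumulantSeq m j * m (s - j)) (B.card - 1) := by
      refine Finset.sum_congr rfl fun B hB => ?_
      simp only [Finset.mem_filter, Finset.mem_univ, true_and] at hB
      have hlt : B.card < s + 1 := by
        rw [← hR]; exact (Finset.card_lt_iff_ne_univ B).2 hB.2
      have hpos : 0 < B.card := Finset.card_pos.2 ⟨_, hB.1⟩
      rw [ENNReal.toReal_mul, (hM _).2, ih (B.card - 1) (by omega) {r // r ∈ B}
        (by rw [Fintype.card_coe]; omega)]
      congr 2
      rw [Fintype.card_subtype_compl, Fintype.card_coe, hR]
      omega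
    have h5 : ∑ B ∈ (Finset.univ : Finset (Finset R)).filter
          (fun B => r₀ ∈ B ∧ B ≠ Finset.univ),
          (fun j => cumulantSeq m j * m (s - j)) (B.card - 1)
        = ∑ j : Fin s, (s.choose j : ℝ) * (cumulantSeq m j * m (s - j)) := by
      convert sum_finset_containing r₀ hR fun j => cumulantSeq m j * m (s - j)
    rw [h4, h5]
    simp_rw [mul_assoc]
    ring

section Partial

variable {Ω : Type*} [MeasurableSpace Ω] {P : Measure Ω} {lam : Measure X} {η : Ω → Measure X}

/-- The sum of the first `N` chaoses. -/
noncomputable def partialChaos (lam : Measure X) (f : (n : ℕ) → (Fin n → X) → ℝ) (N : ℕ)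
    (μ : Measure X) : ℝ :=
  ∑ i : Fin N, wienerIto lam (i + 1) (f (i + 1)) μ

/-- The finiteness assumption for rows indexed by `Fin ℓ` implies it for arbitrary finite index
types. -/
lemma weight_ne_top [SigmaFinite lam] {f : (n : ℕ) → (Fin n → X) → ℝ}
    (hint : ∀ (ℓ : ℕ), 1 ≤ ℓ → ∀ n : Fin ℓ → ℕ, (∀ i, 1 ≤ n i) →
      ∀ σ : Setoid ((i : Fin ℓ) × Fin (n i)), NonFlat σ →
        blockIntegral lam σ (identify σ (tensor fun i x => |f (n i) x|)) < ∞)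
    (h0 : ∀ n : ℕ, 1 ≤ n → ∀ x : Fin n → X, 0 ≤ f n x)
    {R : Type*} [Fintype R] {n : R → ℕ} (hn : ∀ r, 1 ≤ n r)
    {σ : Setoid (Σ r, Fin (n r))} (hσ : RowSimple σ) : weight lam σ (rowProd f n) ≠ ∞ := by
  classical
  rcases isEmpty_or_nonempty R with hR | hR
  · simp [weight, rowProd]
  let e := (Fintype.equivFin R).symm
  let lab : (Σ i, Fin (n (e i))) → Quotient σ := fun p => Quotient.mk σ ⟨e p.1, p.2⟩
  have hlab : Function.Surjective lab := by
    intro q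
    induction q using Quotient.inductionOn with
    | h x =>
      obtain ⟨r, j⟩ := x
      obtain ⟨i, rfl⟩ := e.surjective r
      exact ⟨⟨i, j⟩, rfl⟩
  have h := hint (Fintype.card R) Fintype.card_pos (fun i => n (e i)) (fun i => hn _)
    (Setoid.ker lab) fun i j j' hj => hσ _ _ _ (Quotient.exact hj)
  have hw : blockIntegral lam (Setoid.ker lab)
      (identify (Setoid.ker lab) (tensor fun i x => |f (n (e i)) x|))
      = weight lam (Setoid.ker lab) fun x =>
        ENNReal.ofReal (tensor (fun i x => |f (n (e i)) x|) x) :=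
    rfl
  rw [hw, weight_eq_of_surjective hlab fun _ _ => Iff.rfl] at h
  refine ne_of_lt (lt_of_le_of_lt (le_of_eq ?_) h)
  rw [weight_eq_of_surjective Quotient.mk_surjective fun _ _ => Quotient.eq.symm]
  refine lintegral_congr fun y => ?_
  rw [tensor, ENNReal.ofReal_prod_of_nonneg fun i _ => abs_nonneg _, rowProd]
  refine (Fintype.prod_equiv e _ _ fun i => ?_).symm
  rw [abs_of_nonneg (h0 _ (hn _) _)]

variable [SigmaFinite lam] (hη : IsPoissonProcess P lam η) {f : (n : ℕ) → (Fin n → X) → ℝ}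
  (hf : ∀ n, 1 ≤ n → Measurable (f n)) (h0 : ∀ n : ℕ, 1 ≤ n → ∀ x : Fin n → X, 0 ≤ f n x)
  (hint : ∀ (ℓ : ℕ), 1 ≤ ℓ → ∀ n : Fin ℓ → ℕ, (∀ i, 1 ≤ n i) →
      ∀ σ : Setoid ((i : Fin ℓ) × Fin (n i)), NonFlat σ →
        blockIntegral lam σ (identify σ (tensor fun i x => |f (n i) x|)) < ∞)

include hη hf h0 hint

/-- The moments of the sum of the first `N` chaoses. -/
lemma partialChaos_pow (N : ℕ) (R : Type) [Fintype R] [DecidableEq R] :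
    Integrable (fun ω => partialChaos lam f N (η ω) ^ Fintype.card R) P ∧
      momentSum lam f N R ≠ ∞ ∧
      (momentSum lam f N R).toReal = ∫ ω, partialChaos lam f N (η ω) ^ Fintype.card R ∂P := by
  have hpow : ∀ ω, partialChaos lam f N (η ω) ^ Fintype.card R
      = ∑ n : R → Fin N, ∏ r, wienerIto lam (n r + 1) (f (n r + 1)) (η ω) := by
    intro ω
    rw [← Finset.card_univ, ← Finset.prod_const, partialChaos, Finset.prod_univ_sum,
      Fintype.piFinset_univ]
  have hI := fun n : R → Fin N => integral_prod_wienerIto (R := R) hη (f := f)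
    (n := fun r => (n r : ℕ) + 1)
    (fun r => hf _ (Nat.le_add_left 1 _)) (fun r => h0 _ (Nat.le_add_left 1 _))
    (fun σ hσ => weight_ne_top hint h0 (fun r => Nat.le_add_left 1 _) hσ)
    (fun r σ hσ => weight_ne_top hint h0 (fun _ => Nat.le_add_left 1 _) hσ)
  have hfin : ∀ n : R → Fin N, goodSum lam f (fun r => (n r : ℕ) + 1) ≠ ∞ := by
    intro n
    refine ENNReal.sum_ne_top.2 fun σ _ => ?_
    split_ifs with h
    · exact weight_ne_top hint h0 (fun r => Nat.le_add_left 1 _) h.1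
    · simp
  simp_rw [hpow]
  refine ⟨integrable_finsetSum _ fun n _ => (hI n).1, ENNReal.sum_ne_top.2 fun n _ => hfin n, ?_⟩
  rw [integral_finsetSum _ fun n _ => (hI n).1, momentSum, ENNReal.toReal_sum fun n _ => hfin n]
  exact Finset.sum_congr rfl fun n _ => (hI n).2.symm

lemma aemeasurable_wienerIto [IsProbabilityMeasure P] {n : ℕ} (hn : 1 ≤ n) :
    AEMeasurable (fun ω => wienerIto lam n (f n) (η ω)) P := by
  have h := integral_prod_wienerIto (R := Unit) hη (f := f) (n := fun _ => n)
    (fun _ => hf _ hn) (fun _ => h0 _ hn)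
    (fun σ hσ => weight_ne_top hint h0 (fun r => hn) hσ)
    (fun r σ hσ => weight_ne_top hint h0 (fun _ => hn) hσ)
  simpa using h.1.aemeasurable

/-- The cumulants of the sum of the first `N` chaoses are the sums over connected partitions. -/
lemma cumulantSum_eq_cumulantSeq (N : ℕ) (R : Type) [Fintype R] [DecidableEq R] {s : ℕ}
    (hR : Fintype.card R = s + 1) :
    cumulantSum lam f N R ≤ momentSum lam f N R ∧ (cumulantSum lam f N R).toReal
      = cumulantSeq (fun k => ∫ ω, partialChaos lam f N (η ω) ^ k ∂P) s := by
  constructor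
  · obtain ⟨r₀⟩ : Nonempty R := Fintype.card_pos_iff.1 (by omega)
    rw [momentSum_eq hf N r₀]
    exact le_self_add
  · exact toReal_cumulantSum hf (fun R _ _ => (partialChaos_pow hη hf h0 hint N R).2) s R hR

end Partial

/-! ### Convergence of moments and cumulants -/

open Filter Topology

/-- Dominated convergence: the moments of the partial sums of an absolutely convergent series
converge to those of its sum. -/
lemma tendsto_integral_sum_pow {Ω : Type*} [MeasurableSpace Ω] {P : Measure Ω}
    [IsProbabilityMeasure P] {I : ℕ → Ω → ℝ} (hI : ∀ n, AEMeasurable (I n) P)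
    (hmom : ∀ ℓ : ℕ, 1 ≤ ℓ → ∫⁻ ω, (∑' n, ENNReal.ofReal |I n ω|) ^ ℓ ∂P < ∞)
    {F : Ω → ℝ} (hF : ∀ᵐ ω ∂P, HasSum (fun n => I n ω) (F ω)) :
    AEMeasurable F P ∧ ∀ k : ℕ, Integrable (fun ω => F ω ^ k) P ∧
      Tendsto (fun N : ℕ => ∫ ω, (∑ i : Fin N, I i ω) ^ k ∂P) atTop (𝓝 (∫ ω, F ω ^ k ∂P)) := by
  set G : Ω → ℝ≥0∞ := fun ω => ∑' n, ENNReal.ofReal |I n ω| with hG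
  have hlim : ∀ᵐ ω ∂P, Tendsto (fun N : ℕ => ∑ i : Fin N, I i ω) atTop (𝓝 (F ω)) := by
    filter_upwards [hF] with ω h
    simpa only [Finset.sum_range] using h.tendsto_sum_nat
  have hmeas : ∀ N : ℕ, AEMeasurable (fun ω => ∑ i : Fin N, I i ω) P := fun N =>
    Finset.aemeasurable_fun_sum _ fun i _ => hI i
  have hFm : AEMeasurable F P := aemeasurable_of_tendsto_metrizable_ae atTop hmeas hlim
  have hGm : AEMeasurable G P := AEMeasurable.tsum fun n => (hI n).norm.ennreal_ofReal
  have hGtop : ∀ᵐ ω ∂P, G ω < ∞ := ae_lt_top' hGm (by simpa using (hmom 1 le_rfl).ne)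
  have hGint : ∀ k : ℕ, Integrable (fun ω => (G ω).toReal ^ k) P := by
    intro k
    rcases Nat.eq_zero_or_pos k with rfl | hk
    · simp
    · simp_rw [← ENNReal.toReal_pow]
      exact integrable_toReal_of_lintegral_ne_top (hGm.pow_const k) (hmom k hk).ne
  have hbound : ∀ᵐ ω ∂P, ∀ N : ℕ, |∑ i : Fin N, I i ω| ≤ (G ω).toReal := by
    filter_upwards [hGtop] with ω hω N
    refine (Finset.abs_sum_le_sum_abs _ _).trans ?_
    rw [← ENNReal.ofReal_le_iff_le_toReal hω.ne,
      ENNReal.ofReal_sum_of_nonneg fun _ _ => abs_nonneg _,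
      ← Finset.sum_range fun i => ENNReal.ofReal |I i ω|]
    exact ENNReal.sum_le_tsum _
  refine ⟨hFm, fun k => ⟨?_, ?_⟩⟩
  · refine (hGint k).mono' (hFm.pow_const k).aestronglyMeasurable ?_
    filter_upwards [hbound, hlim] with ω h1 h2
    rw [norm_pow]
    exact pow_le_pow_left₀ (norm_nonneg _) (le_of_tendsto' h2.norm h1) k
  · refine tendsto_integral_of_dominated_convergence (fun ω => (G ω).toReal ^ k)
      (fun N => ((hmeas N).pow_const k).aestronglyMeasurable) (hGint k) (fun N => ?_) ?_
    · filter_upwards [hbound] with ω h1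
      rw [norm_pow]
      exact pow_le_pow_left₀ (norm_nonneg _) (h1 N) k
    · filter_upwards [hlim] with ω h2
      exact h2.pow k

/-- The cumulants are polynomials in the moments, and therefore depend continuously on them. -/
lemma tendsto_cumulantSeq {m : ℕ → ℕ → ℝ} {m' : ℕ → ℝ}
    (h : ∀ k, Tendsto (fun N => m N k) atTop (𝓝 (m' k))) (s : ℕ) :
    Tendsto (fun N => cumulantSeq (m N) s) atTop (𝓝 (cumulantSeq m' s)) := by
  induction s using Nat.strong_induction_on with
  | _ s ih =>
    rw [cumulantSeq]
    simp_rw [fun N => cumulantSeq.eq_1 (m N) s]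
    exact (h _).sub <| tendsto_finsetSum _ fun j _ =>
      (tendsto_const_nhds.mul (ih j j.2)).mul (h _)

/-- The derivatives at `0` of the logarithm of the characteristic function satisfy the recursion
between cumulants and moments, by the Leibniz rule for `φ' = (log φ)' φ`. -/
lemma cumulant_eq_cumulantSeq {Ω : Type*} [MeasurableSpace Ω] {P : Measure Ω}
    [IsProbabilityMeasure P] {Y : Ω → ℝ} (hY : AEMeasurable Y P)
    (hint : ∀ k : ℕ, Integrable (fun ω => Y ω ^ k) P) (s : ℕ) :
    cumulant P (s + 1) Y = (cumulantSeq (fun k => ∫ ω, Y ω ^ k ∂P) s : ℝ) := by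
  set μ := P.map Y with hμ
  have : IsProbabilityMeasure μ := Measure.isProbabilityMeasure_map hY
  have hLp : ∀ k : ℕ, MemLp id k μ := by
    intro k
    rcases Nat.eq_zero_or_pos k with rfl | hk
    · simpa using aestronglyMeasurable_id
    · rw [← integrable_norm_rpow_iff aestronglyMeasurable_id (by exact_mod_cast hk.ne') (by simp)]
      have h1 : Integrable (fun x : ℝ => x ^ k) μ := by
        rw [hμ, integrable_map_measure (by fun_prop) hY]
        exact hint k
      simpa using h1.norm
  have hmom : ∀ k : ℕ, iteratedDeriv k (charFun μ) 0
      = Complex.I ^ k * ((∫ ω, Y ω ^ k ∂P : ℝ) : ℂ) := by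
    intro k
    rw [iteratedDeriv_charFun_zero (hLp k), hμ, integral_map hY (by fun_prop)]
  set L : ℝ → ℂ := fun z => Complex.log (charFun μ z) with hL
  have hcum : ∀ k, cumulant P k Y = (-Complex.I) ^ k * iteratedDeriv k L 0 := by
    intro k
    rw [cumulant, hL]
    congr 2
    funext z
    rw [charFun_apply_real, hμ, integral_map hY (by fun_prop)]
    congr 2
    funext ω
    congr 1
    ring
  have hsm : ContDiff ℝ (⊤ : ℕ∞) (charFun μ) := contDiff_charFun' hLp
  have h0 : charFun μ 0 = 1 := by simp [charFun_zero]
  have hslit : ∀ᶠ z in 𝓝 (0 : ℝ), charFun μ z ∈ Complex.slitPlane :=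
    hsm.continuous.continuousAt.eventually_mem
      (Complex.isOpen_slitPlane.mem_nhds (by simp [h0]))
  have hLs : ContDiffAt ℝ (⊤ : ℕ∞) L 0 :=
    ((Complex.contDiffAt_log (x := charFun μ 0) (by simp [h0])).restrict_scalars ℝ).comp 0
      hsm.contDiffAt
  have hder : deriv (charFun μ) =ᶠ[𝓝 0] deriv L * charFun μ := by
    filter_upwards [hslit] with z hz
    have h1 : HasDerivAt (charFun μ) (deriv (charFun μ) z) z :=
      (hsm.differentiable (by simp) z).hasDerivAt
    have h2 := (h1.clog_real hz).deriv
    rw [Pi.mul_apply, hL, h2, div_mul_cancel₀ _ (Complex.slitPlane_ne_zero hz)]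
  have hLd : ∀ n : ℕ, ContDiffAt ℝ n (deriv L) 0 := fun n =>
    hLs.derivWithin (by exact_mod_cast le_top)
  induction s using Nat.strong_induction_on with
  | _ s ih =>
    have hrec := hmom (s + 1)
    rw [iteratedDeriv_succ', hder.iteratedDeriv_eq s, iteratedDeriv_mul (hLd s)
      (hsm.contDiffAt.of_le (by exact_mod_cast le_top))] at hrec
    rw [Finset.sum_range_succ, Finset.sum_range] at hrec
    simp only [Nat.choose_self, Nat.cast_one, one_mul, Nat.sub_self,
      ← iteratedDeriv_succ', hmom] at hrec
    simp only [pow_zero, integral_const, probReal_univ, one_smul, Complex.ofReal_one,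
      mul_one] at hrec
    have hI : ∀ k : ℕ, Complex.I ^ k * (-Complex.I) ^ k = 1 := fun k => by
      rw [← mul_pow]; simp
    have h3 : ∀ j : Fin s, iteratedDeriv (j + 1) L 0
        = Complex.I ^ ((j : ℕ) + 1) * (cumulantSeq (fun k => ∫ ω, Y ω ^ k ∂P) j : ℝ) := by
      intro j
      rw [← ih j j.2, hcum, ← mul_assoc, hI, one_mul]
    rw [hcum, eq_sub_of_add_eq' hrec, cumulantSeq, mul_sub, ← mul_assoc, mul_comm (_ ^ _), hI]
    push_cast
    rw [one_mul, Finset.mul_sum]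
    congr 1
    refine Finset.sum_congr rfl fun j _ => ?_
    rw [h3]
    have h4 : Complex.I ^ (s + 1) = Complex.I ^ ((j : ℕ) + 1) * Complex.I ^ (s - j) := by
      rw [← pow_add]; congr 1; omega
    have h5 := hI (s + 1)
    rw [h4] at h5
    linear_combination ((s.choose j : ℂ) * (cumulantSeq (fun k => ∫ ω, Y ω ^ k ∂P) j : ℝ)
      * ((∫ ω, Y ω ^ (s - j) ∂P : ℝ) : ℂ)) * h5

/-! ### Counting edges in random bipartite graphs -/

section Bipartite

/-- Jensen's inequality. -/
lemma lintegral_pow_le {Ω : Type*} [MeasurableSpace Ω] {P : Measure Ω} [IsProbabilityMeasure P]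
    {Z : Ω → ℝ≥0∞} (hZ : AEMeasurable Z P) (r : ℕ) : (∫⁻ ω, Z ω ∂P) ^ r ≤ ∫⁻ ω, Z ω ^ r ∂P := by
  rcases Nat.eq_zero_or_pos r with rfl | hr
  · simp
  have h := eLpNorm_le_eLpNorm_of_exponent_le (p := 1) (q := r) (μ := P)
    (by exact_mod_cast hr) hZ.aestronglyMeasurable
  rw [eLpNorm_one_eq_lintegral_enorm, eLpNorm_eq_lintegral_rpow_enorm_toReal
    (by exact_mod_cast hr.ne') (by simp)] at h
  simp only [enorm_eq_self, ENNReal.toReal_natCast, ENNReal.rpow_natCast] at h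
  have h' := pow_le_pow_left' h r
  rwa [← ENNReal.rpow_natCast (_ ^ _) r, ← ENNReal.rpow_mul, one_div,
    inv_mul_cancel₀ (by exact_mod_cast hr.ne'), ENNReal.rpow_one] at h'

lemma pi_eq_smul {α ι : Type*} [MeasurableSpace α] [Fintype ι] {μ ρ : Measure α} [SigmaFinite μ]
    [SigmaFinite ρ] {c : ℝ≥0∞} (h : ρ = c • μ) :
    Measure.pi (fun _ : ι => ρ) = c ^ Fintype.card ι • Measure.pi fun _ : ι => μ := by
  refine Measure.pi_eq fun s _ => ?_
  rw [Measure.smul_apply, Measure.pi_pi, h]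
  simp [Finset.prod_mul_distrib, Finset.card_univ]

lemma prod_indicator_one {α ι : Type*} [Fintype ι] (A : Set α) (x : ι → α) :
    ∏ a, A.indicator (1 : α → ℝ≥0∞) (x a) = (Set.univ.pi fun _ => A).indicator 1 x := by
  by_cases h : x ∈ Set.univ.pi fun _ => A
  · rw [Set.indicator_of_mem h]
    exact Finset.prod_eq_one fun a _ => Set.indicator_of_mem (h a trivial) _
  · rw [Set.indicator_of_notMem h]
    simp only [Set.mem_pi, Set.mem_univ, true_imp_iff, not_forall] at h
    obtain ⟨a, ha⟩ := h
    exact Finset.prod_eq_zero (Finset.mem_univ a) (Set.indicator_of_notMem ha _)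

variable {α β : Type*} [MeasurableSpace α] [MeasurableSpace β] {μ : Measure α} {ν : Measure β}
  [IsProbabilityMeasure μ] [IsProbabilityMeasure ν]

/-- The indicator function of the edges of the bipartite graph with edge set `S`. -/
noncomputable def edge (S : Set (α × β)) (x : α) (z : β) : ℝ≥0∞ := S.indicator 1 (x, z)

lemma measurable_edge {S : Set (α × β)} (hS : MeasurableSet S) :
    Measurable fun p : α × β => edge S p.1 p.2 := measurable_one.indicator hS

/-- The number of edges between given families of `q` vertices on each side. -/
noncomputable def edgeCount (S : Set (α × β)) {q : ℕ} (x : Fin q → α) (z : Fin q → β) : ℝ≥0∞ :=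
  ∑ a, ∑ b, edge S (x a) (z b)

lemma measurable_edgeCount {S : Set (α × β)} (hS : MeasurableSet S) (q : ℕ) :
    Measurable fun p : (Fin q → α) × (Fin q → β) => edgeCount S p.1 p.2 :=
  Finset.measurable_fun_sum _ fun a _ => Finset.measurable_fun_sum _ fun b _ =>
    (measurable_edge hS).comp
      (f := fun p : (Fin q → α) × (Fin q → β) => (p.1 a, p.2 b))
      (by fun_prop)

/-- Jensen's inequality for the number of edges between `q` independent random vertices on each
side. -/
lemma le_lintegral_edgeCount_pow {S : Set (α × β)} (hS : MeasurableSet S) (q r : ℕ) :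
    ((q : ℝ≥0∞) ^ 2 * ∫⁻ p, edge S p.1 p.2 ∂(μ.prod ν)) ^ r
      ≤ ∫⁻ p, edgeCount S p.1 p.2 ^ r
          ∂((Measure.pi fun _ : Fin q => μ).prod (Measure.pi fun _ : Fin q => ν)) := by
  refine le_trans (le_of_eq ?_) (lintegral_pow_le (measurable_edgeCount hS q).aemeasurable r)
  congr 1
  simp only [edgeCount]
  have hm : ∀ a b : Fin q, Measurable fun p : (Fin q → α) × (Fin q → β) =>
      edge S (p.1 a) (p.2 b) := fun a b =>
    (measurable_edge hS).comp
      (f := fun p : (Fin q → α) × (Fin q → β) => (p.1 a, p.2 b)) (by fun_prop)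
  rw [lintegral_finsetSum _ fun a _ => Finset.measurable_fun_sum _ fun b _ => hm a b]
  simp_rw [fun a : Fin q => lintegral_finsetSum (μ := (Measure.pi fun _ : Fin q => μ).prod
    (Measure.pi fun _ : Fin q => ν)) Finset.univ fun b _ => hm a b]
  have h : ∀ a b : Fin q, ∫⁻ p : (Fin q → α) × (Fin q → β), edge S (p.1 a) (p.2 b)
      ∂((Measure.pi fun _ : Fin q => μ).prod (Measure.pi fun _ : Fin q => ν))
      = ∫⁻ p, edge S p.1 p.2 ∂(μ.prod ν) := fun a b =>
    ((measurePreserving_eval (fun _ : Fin q => μ) a).prod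
      (measurePreserving_eval (fun _ : Fin q => ν) b)).lintegral_comp (measurable_edge hS)
  simp [h, sq, mul_assoc]

/-- For vertices restricted to `A` and `B`, the `r`-th moment of the number of edges is bounded
below through the measure `t` of the set of edges between `A` and `B`. -/
lemma le_lintegral_restrict_edgeCount_pow {S : Set (α × β)} (hS : MeasurableSet S)
    {A : Set α} {B : Set β} {q : ℕ} (hq : q ≠ 0)
    (r : ℕ) :
    (q : ℝ≥0∞) ^ (2 * r) * (∫⁻ p in A ×ˢ B, edge S p.1 p.2 ∂(μ.prod ν)) ^ (q + r)
      ≤ ∫⁻ p in (Set.univ.pi fun _ => A) ×ˢ (Set.univ.pi fun _ => B), edgeCount S p.1 p.2 ^ r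
          ∂((Measure.pi fun _ : Fin q => μ).prod (Measure.pi fun _ : Fin q => ν)) := by
  set t := ∫⁻ p in A ×ˢ B, edge S p.1 p.2 ∂(μ.prod ν) with ht
  have hle : t ≤ μ A * ν B := by
    rw [← Measure.prod_prod, ← setLIntegral_one]
    refine lintegral_mono fun p => ?_
    exact Set.indicator_le_self' (fun _ _ => zero_le) _
  rcases eq_or_ne (μ A * ν B) 0 with h0 | h0
  · rw [h0] at hle
    rw [nonpos_iff_eq_zero.1 hle, zero_pow (by omega), mul_zero]
    exact zero_le
  have hA0 : μ A ≠ 0 := left_ne_zero_of_mul h0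
  have hB0 : ν B ≠ 0 := right_ne_zero_of_mul h0
  have := cond_isProbabilityMeasure (μ := μ) hA0
  have := cond_isProbabilityMeasure (μ := ν) hB0
  have hμ : μ.restrict A = μ A • μ[|A] := by
    rw [ProbabilityTheory.cond, smul_smul, ENNReal.mul_inv_cancel hA0 (measure_ne_top _ _),
      one_smul]
  have hν : ν.restrict B = ν B • ν[|B] := by
    rw [ProbabilityTheory.cond, smul_smul, ENNReal.mul_inv_cancel hB0 (measure_ne_top _ _),
      one_smul]
  have h1 : t = μ A * ν B * ∫⁻ p, edge S p.1 p.2 ∂((μ[|A]).prod ν[|B]) := by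
    rw [ht, ← Measure.prod_restrict, hμ, hν, Measure.prod_smul_left, Measure.prod_smul_right,
      smul_smul, lintegral_smul_measure, smul_eq_mul]
  set t' := ∫⁻ p, edge S p.1 p.2 ∂((μ[|A]).prod ν[|B]) with ht'
  have hM : μ A * ν B ≤ 1 := mul_le_one' prob_le_one prob_le_one
  rw [← Measure.prod_restrict, Measure.restrict_pi_pi, Measure.restrict_pi_pi, pi_eq_smul hμ,
    pi_eq_smul hν, Measure.prod_smul_left, Measure.prod_smul_right, smul_smul,
    lintegral_smul_measure, smul_eq_mul, Fintype.card_fin, ← mul_pow]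
  calc (q : ℝ≥0∞) ^ (2 * r) * t ^ (q + r) = t ^ q * ((q : ℝ≥0∞) ^ 2 * t) ^ r := by
        rw [mul_pow, ← pow_mul, pow_add]; ring
    _ ≤ (μ A * ν B) ^ q * ((q : ℝ≥0∞) ^ 2 * t') ^ r := by
        gcongr
        rw [h1]
        exact mul_le_of_le_one_left' hM
    _ ≤ _ := by
        gcongr
        exact le_lintegral_edgeCount_pow hS q r

/-- The measure of the paths of length three in the graph. -/
noncomputable def pathWeight (S : Set (α × β)) (μ : Measure α) (ν : Measure β) : ℝ≥0∞ :=
  ∫⁻ p₀, ∫⁻ p, edge S p.1 p₀.2 * edge S p₀.1 p.2 * edge S p.1 p.2 ∂(μ.prod ν) ∂(μ.prod ν)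

/-- Almost every edge has a left end and a right end of positive degree, and therefore is the middle
edge of a set of paths of positive measure. -/
lemma pathWeight_ne_zero {S : Set (α × β)} (hS : MeasurableSet S) (h : (μ.prod ν) S ≠ 0) :
    pathWeight S μ ν ≠ 0 := by
  have hm := measurable_edge hS
  have hm1 : Measurable fun x => ∫⁻ z, edge S x z ∂ν := hm.lintegral_prod_right'
  have hm2 : Measurable fun z => ∫⁻ x, edge S x z ∂μ := hm.lintegral_prod_left'
  intro h0
  rw [pathWeight, lintegral_lintegral_swap] at h0
  · have h1 : ∀ p : α × β,
        ∫⁻ p₀, edge S p.1 p₀.2 * edge S p₀.1 p.2 * edge S p.1 p.2 ∂(μ.prod ν)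
        = (∫⁻ x, edge S x p.2 ∂μ) * (∫⁻ z, edge S p.1 z ∂ν) * edge S p.1 p.2 := by
      intro p
      have e1 : Measurable fun x => edge S x p.2 := hm.comp (measurable_id.prodMk measurable_const)
      have e2 : Measurable fun z => edge S p.1 z := hm.comp (measurable_const.prodMk measurable_id)
      rw [lintegral_mul_const _ (by fun_prop), ← lintegral_prod_mul e1.aemeasurable e2.aemeasurable]
      simp_rw [mul_comm]
    simp_rw [h1] at h0
    rw [lintegral_eq_zero_iff (by fun_prop)] at h0
    apply h
    have n1 : (μ.prod ν) (S ∩ {p | ∫⁻ z, edge S p.1 z ∂ν = 0}) = 0 := by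
      have hn : MeasurableSet (S ∩ {p | ∫⁻ z, edge S p.1 z ∂ν = 0}) :=
        hS.inter ((hm1.comp measurable_fst) (measurableSet_singleton 0))
      rw [Measure.measure_prod_null hn]
      refine Filter.Eventually.of_forall fun x => ?_
      have e : ∫⁻ z, edge S x z ∂ν = ν (Prod.mk x ⁻¹' S) :=
        lintegral_indicator_one (measurable_prodMk_left hS)
      by_cases hx : ∫⁻ z, edge S x z ∂ν = 0
      · exact measure_mono_null (fun z hz => hz.1) (e.symm.trans hx)
      · exact measure_mono_null (fun z hz => (hx hz.2).elim) measure_empty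
    have n2 : (μ.prod ν) (S ∩ {p | ∫⁻ x, edge S x p.2 ∂μ = 0}) = 0 := by
      have hn : MeasurableSet (S ∩ {p | ∫⁻ x, edge S x p.2 ∂μ = 0}) :=
        hS.inter ((hm2.comp measurable_snd) (measurableSet_singleton 0))
      rw [Measure.prod_apply_symm hn]
      refine (lintegral_congr fun z => ?_).trans lintegral_zero
      have e : ∫⁻ x, edge S x z ∂μ = μ ((fun x => (x, z)) ⁻¹' S) :=
        lintegral_indicator_one (measurable_prodMk_right hS)
      by_cases hx : ∫⁻ x, edge S x z ∂μ = 0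
      · exact measure_mono_null (fun z hz => hz.1) (e.symm.trans hx)
      · exact measure_mono_null (fun z hz => (hx hz.2).elim) measure_empty
    have n3 := measure_union_null n1 n2
    rw [measure_eq_zero_iff_ae_notMem] at n3 ⊢
    filter_upwards [n3, h0] with p h3 h2 hp
    simp [edge, hp] at h2 h3
    tauto
  · exact (((hm.comp (f := fun p : (α × β) × (α × β) => (p.2.1, p.1.2)) (by fun_prop)).mul
      (hm.comp (f := fun p : (α × β) × (α × β) => (p.1.1, p.2.2)) (by fun_prop))).mul
      (hm.comp (f := fun p : (α × β) × (α × β) => p.2) (by fun_prop))).aemeasurable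

/-- The hub `p₀` contributes edges to all other vertices; averaging over it leaves the measure of
the paths of length three. -/
lemma le_lintegral_hub {S : Set (α × β)} (hS : MeasurableSet S) {q : ℕ} (hq : q ≠ 0) (r : ℕ) :
    (q : ℝ≥0∞) ^ (2 * r) * pathWeight S μ ν ^ (q + r)
      ≤ ∫⁻ p₀, ∫⁻ p, (∏ a, edge S (p.1 a) p₀.2) * (∏ b, edge S p₀.1 (p.2 b))
          * edgeCount S p.1 p.2 ^ r
          ∂((Measure.pi fun _ : Fin q => μ).prod (Measure.pi fun _ : Fin q => ν)) ∂(μ.prod ν) := by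
  have hm := measurable_edge hS
  have h1 : pathWeight S μ ν ^ (q + r) ≤ ∫⁻ p₀ : α × β,
      (∫⁻ p, edge S p.1 p₀.2 * edge S p₀.1 p.2 * edge S p.1 p.2 ∂(μ.prod ν)) ^ (q + r)
        ∂(μ.prod ν) := by
    refine lintegral_pow_le (Measurable.aemeasurable ?_) _
    exact (((hm.comp (f := fun p : (α × β) × (α × β) => (p.2.1, p.1.2)) (by fun_prop)).mul
      (hm.comp (f := fun p : (α × β) × (α × β) => (p.1.1, p.2.2)) (by fun_prop))).mul
      (hm.comp (f := fun p : (α × β) × (α × β) => p.2) (by fun_prop))).lintegral_prod_right'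
  refine (mul_le_mul_right h1 _).trans ?_
  rw [← lintegral_const_mul' _ _ (by finiteness)]
  refine lintegral_mono fun p₀ => ?_
  set A : Set α := {x | (x, p₀.2) ∈ S} with hA
  set B : Set β := {z | (p₀.1, z) ∈ S} with hB
  have hAm : MeasurableSet A := measurable_prodMk_right hS
  have hBm : MeasurableSet B := measurable_prodMk_left hS
  have h2 := le_lintegral_restrict_edgeCount_pow (μ := μ) (ν := ν) (A := A) (B := B) hS hq r
  rw [← lintegral_indicator (hAm.prod hBm), ← lintegral_indicator
    ((MeasurableSet.univ_pi fun _ => hAm).prod (MeasurableSet.univ_pi fun _ => hBm))] at h2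
  refine le_trans (le_of_eq ?_) (h2.trans (le_of_eq ?_))
  · congr 3
    funext p
    by_cases h1 : p.1 ∈ A <;> by_cases h2 : p.2 ∈ B <;>
      simp_all [Set.indicator, edge]
  · refine lintegral_congr fun p => ?_
    have e1 : ∏ a, edge S (p.1 a) p₀.2 = (Set.univ.pi fun _ => A).indicator 1 p.1 :=
      prod_indicator_one A p.1
    have e2 : ∏ b, edge S p₀.1 (p.2 b) = (Set.univ.pi fun _ => B).indicator 1 p.2 :=
      prod_indicator_one B p.2
    rw [e1, e2]
    by_cases h1 : p.1 ∈ Set.univ.pi fun _ => A <;> by_cases h2 : p.2 ∈ Set.univ.pi fun _ => B <;>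
      simp [Set.indicator, h1, h2, -Set.mem_pi]

end Bipartite

/-! ### Many connected partitions -/

section Hub

/-- Indices for `4q + r` rows: each of the `2q` rows that join a hub to one of the `q` vertices
on the other side is taken twice, and there are `r` rows that join two arbitrary non-hub
vertices. -/
abbrev HubRow (q r : ℕ) : Type := (Bool × Bool × Fin q) ⊕ Fin r

variable {m q r : ℕ}

/-- The left vertex of a row, with `none` for the hub. -/
def leftVertex (c : Fin r → Fin q × Fin q) : HubRow q r → Option (Fin q)
  | Sum.inl (true, _, a) => some a
  | Sum.inl (false, _, _) => none
  | Sum.inr i => some (c i).1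

/-- The right vertex of a row, with `none` for the hub. -/
def rightVertex (c : Fin r → Fin q × Fin q) : HubRow q r → Option (Fin q)
  | Sum.inl (true, _, _) => none
  | Sum.inl (false, _, b) => some b
  | Sum.inr i => some (c i).2

/-- The variables attached to the vertices: one for each left vertex, `m` for each right vertex. -/
abbrev HubVar (q m : ℕ) : Type := Option (Fin q) ⊕ (Σ _ : Option (Fin q), Fin m)

/-- The labelling in which a row carries the variable of its left vertex followed by those of its
right vertex. -/
def hubLabel (m : ℕ) (c : Fin r → Fin q × Fin q) (p : Σ _ : HubRow q r, Fin (m + 1)) :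
    HubVar q m :=
  Fin.cases (Sum.inl (leftVertex c p.1)) (fun j => Sum.inr ⟨rightVertex c p.1, j⟩) p.2

@[simp] lemma hubLabel_zero (c : Fin r → Fin q × Fin q) (ρ : HubRow q r) :
    hubLabel m c ⟨ρ, 0⟩ = Sum.inl (leftVertex c ρ) := rfl

@[simp] lemma hubLabel_succ (c : Fin r → Fin q × Fin q) (ρ : HubRow q r) (j : Fin m) :
    hubLabel m c ⟨ρ, j.succ⟩ = Sum.inr ⟨rightVertex c ρ, j⟩ := rfl

lemma hubLabel_surjective (hq : q ≠ 0) (c : Fin r → Fin q × Fin q) :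
    Function.Surjective (hubLabel m c) := by
  have a₀ : Fin q := ⟨0, Nat.pos_of_ne_zero hq⟩
  rintro ((_ | a) | ⟨_ | b, j⟩)
  · exact ⟨⟨Sum.inl (false, false, a₀), 0⟩, rfl⟩
  · exact ⟨⟨Sum.inl (true, false, a), 0⟩, rfl⟩
  · exact ⟨⟨Sum.inl (true, false, a₀), j.succ⟩, rfl⟩
  · exact ⟨⟨Sum.inl (false, false, b), j.succ⟩, rfl⟩

lemma good_ker_hubLabel (c : Fin r → Fin q × Fin q) :
    Good (R := HubRow q r) (n := fun _ => m + 1) (Setoid.ker (hubLabel m c)) := by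
  constructor
  · intro ρ j j' h
    have h' : hubLabel m c ⟨ρ, j⟩ = hubLabel m c ⟨ρ, j'⟩ := h
    cases j using Fin.cases <;> cases j' using Fin.cases <;> simp_all
  · -- Every hub row occurs twice, and the vertices of the other rows occur in hub rows.
    rintro ⟨ρ, j⟩
    rcases ρ with ⟨b, e, a⟩ | i
    · refine ⟨⟨Sum.inl (b, !e, a), j⟩, fun h => ?_, ?_⟩
      · simp at h
      · change hubLabel m c _ = hubLabel m c _
        cases j using Fin.cases <;> cases b <;> rfl
    · cases j using Fin.cases with
      | zero => exact ⟨⟨Sum.inl (true, true, (c i).1), 0⟩, by simp, rfl⟩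
      | succ j => exact ⟨⟨Sum.inl (false, true, (c i).2), j.succ⟩, by simp, rfl⟩

lemma connected_ker_hubLabel (hm : m ≠ 0) (hr : r ≠ 0) (c : Fin r → Fin q × Fin q) :
    Connected (R := HubRow q r) (n := fun _ => m + 1) (Setoid.ker (hubLabel m c)) := by
  intro p hp
  have j₀ : Fin m := ⟨0, Nat.pos_of_ne_zero hm⟩
  have i₀ : Fin r := ⟨0, Nat.pos_of_ne_zero hr⟩
  have hl : ∀ ρ ρ', leftVertex c ρ = leftVertex c ρ' → (p ρ ↔ p ρ') := fun ρ ρ' h =>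
    hp ⟨ρ, 0⟩ ⟨ρ', 0⟩ (congrArg Sum.inl h)
  have hr : ∀ ρ ρ', rightVertex c ρ = rightVertex c ρ' → (p ρ ↔ p ρ') := fun ρ ρ' h =>
    hp ⟨ρ, j₀.succ⟩ ⟨ρ', j₀.succ⟩ (show Sum.inr _ = Sum.inr _ by rw [h])
  -- All rows are linked to the row `inr i₀`, via the hub rows at its two vertices.
  have h1 : ∀ e a, p (Sum.inl (true, e, a)) ↔ p (Sum.inr i₀) := fun e a =>
    
    (hr (Sum.inl (true, e, a)) (Sum.inl (true, true, (c i₀).1)) rfl).trans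
      (hl _ (Sum.inr i₀) rfl)
  have h2 : ∀ e a, p (Sum.inl (false, e, a)) ↔ p (Sum.inr i₀) := fun e a =>
    
    (hl (Sum.inl (false, e, a)) (Sum.inl (false, true, (c i₀).2)) rfl).trans
      (hr _ (Sum.inr i₀) rfl)
  have h3 : ∀ ρ, p ρ ↔ p (Sum.inr i₀) := by
    rintro (⟨_ | _, e, a⟩ | i)
    · exact h2 e a
    · exact h1 e a
    · exact (hl (Sum.inr i) (Sum.inl (true, true, (c i).1)) rfl).trans (h1 _ _)
  by_cases h : p (Sum.inr i₀)
  · exact Or.inl fun ρ => (h3 ρ).2 h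
  · exact Or.inr fun ρ hρ => h ((h3 ρ).1 hρ)

/-- The ends of the free rows are determined by the hub rows to which they are linked. -/
lemma ker_hubLabel_injective (hm : m ≠ 0) : Function.Injective
    fun c : Fin r → Fin q × Fin q => (Setoid.ker (hubLabel m c)) := by
  intro c c' h
  have j₀ : Fin m := ⟨0, Nat.pos_of_ne_zero hm⟩
  have h' : ∀ x y, hubLabel m c x = hubLabel m c y ↔ hubLabel m c' x = hubLabel m c' y :=
    fun x y => Setoid.ext_iff.1 h x y
  funext i
  refine Prod.ext ?_ ?_
  · have := (h' ⟨Sum.inr i, 0⟩ ⟨Sum.inl (true, true, (c i).1), 0⟩).1 rfl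
    simpa [leftVertex, eq_comm] using this
  · have := (h' ⟨Sum.inr i, j₀.succ⟩ ⟨Sum.inl (false, true, (c i).2), j₀.succ⟩).1 rfl
    simpa [rightVertex, eq_comm] using this

/-- The values of the variables, assembled from those at the hubs and those at the other
vertices. -/
def hubValue (t : (X × (Fin m → X)) × ((Fin q → X) × (Fin q → Fin m → X))) : HubVar q m → X :=
  Sum.elim (fun o => o.elim t.1.1 t.2.1) fun s => s.1.elim t.1.2 t.2.2 s.2

lemma measurePreserving_hubValue (μ : Measure X) [SigmaFinite μ] :
    MeasurePreserving (hubValue (X := X) (m := m) (q := q))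
      ((μ.prod (Measure.pi fun _ => μ)).prod
        ((Measure.pi fun _ => μ).prod (Measure.pi fun _ => Measure.pi fun _ => μ)))
      (Measure.pi fun _ => μ) := by
  have hmeas : Measurable (hubValue (X := X) (m := m) (q := q)) := by
    refine measurable_pi_lambda _ ?_
    rintro ((_ | a) | ⟨_ | b, j⟩) <;> simp only [hubValue, Sum.elim_inl, Sum.elim_inr,
      Option.elim_none, Option.elim_some] <;> fun_prop
  refine ⟨hmeas, (Measure.pi_eq fun s hs => ?_).symm⟩
  rw [Measure.map_apply hmeas (MeasurableSet.univ_pi hs)]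
  have : hubValue (X := X) (m := m) (q := q) ⁻¹' Set.univ.pi s
      = (s (Sum.inl none) ×ˢ Set.univ.pi fun j => s (Sum.inr ⟨none, j⟩))
        ×ˢ ((Set.univ.pi fun a => s (Sum.inl (some a)))
          ×ˢ (Set.univ.pi fun b => Set.univ.pi fun j => s (Sum.inr ⟨some b, j⟩))) := by
    ext t
    simp only [Set.mem_preimage, Set.mem_univ_pi, Sum.forall, Option.forall, Sigma.forall,
      Set.mem_prod, hubValue, Sum.elim_inl, Sum.elim_inr, Option.elim_none, Option.elim_some]
    tauto
  rw [this]
  simp only [Measure.prod_prod, Measure.pi_pi, Fintype.prod_sum_type, Fintype.prod_option,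
    Fintype.prod_sigma]
  ring

lemma measurable_edge_elim {S : Set (X × (Fin m → X))} (hS : MeasurableSet S)
    (o o' : Option (Fin q)) :
    Measurable fun t : (X × (Fin m → X)) × ((Fin q → X) × (Fin q → Fin m → X)) =>
      edge S (o.elim t.1.1 t.2.1) (o'.elim t.1.2 t.2.2) := by
  refine (measurable_edge hS).comp (f := fun t : (X × (Fin m → X)) ×
    ((Fin q → X) × (Fin q → Fin m → X)) => (o.elim t.1.1 t.2.1, o'.elim t.1.2 t.2.2))
    (Measurable.prodMk ?_ ?_)
  · cases o <;> simp only [Option.elim_none, Option.elim_some] <;> fun_prop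
  · cases o' <;> simp only [Option.elim_none, Option.elim_some] <;> fun_prop

omit [MeasurableSpace X] in
/-- The rows contribute the edges between their vertices; summing over the free rows gives a
power of the number of edges. -/
lemma sum_prod_edge {S : Set (X × (Fin m → X))}
    (t : (X × (Fin m → X)) × ((Fin q → X) × (Fin q → Fin m → X))) :
    ∑ c : Fin r → Fin q × Fin q, ∏ ρ : HubRow q r,
        edge S ((leftVertex c ρ).elim t.1.1 t.2.1) ((rightVertex c ρ).elim t.1.2 t.2.2)
      = (∏ a, edge S (t.2.1 a) t.1.2) * (∏ b, edge S t.1.1 (t.2.2 b))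
          * edgeCount S t.2.1 t.2.2 ^ r := by
  have hsq : ∀ x z, edge S x z * edge S x z = edge S x z := by
    intro x z
    by_cases h : (x, z) ∈ S <;> simp [edge, h]
  simp only [Fintype.prod_sum_type, Fintype.prod_prod_type, Fintype.prod_bool, leftVertex,
    rightVertex, Option.elim_none, Option.elim_some, ← Finset.prod_mul_distrib, hsq]
  rw [← Finset.mul_sum]
  congr 1
  rw [edgeCount, ← Fintype.sum_prod_type' fun a b => edge S (t.2.1 a) (t.2.2 b)]
  rw [← Fintype.card_fin r, ← Finset.card_univ, ← Finset.prod_const, Finset.prod_univ_sum,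
    Fintype.piFinset_univ, Finset.card_univ, Fintype.card_fin]

/-- The partitions given by the choices of the free rows are good, connected and distinct. -/
lemma sum_weight_le_connectedSum (hm : m ≠ 0) (hr : r ≠ 0) (lam : Measure X)
    (f : (n : ℕ) → (Fin n → X) → ℝ) :
    ∑ c : Fin r → Fin q × Fin q, weight lam (Setoid.ker (hubLabel m c))
        (rowProd f fun _ : HubRow q r => m + 1)
      ≤ connectedSum lam f fun _ : HubRow q r => m + 1 := by
  classical
  rw [connectedSum]
  refine le_trans (le_of_eq ?_) (Finset.sum_le_sum_of_subset (Finset.subset_univ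
    (Finset.univ.image fun c : Fin r → Fin q × Fin q => Setoid.ker (hubLabel m c))))
  rw [Finset.sum_image fun _ _ _ _ h => ker_hubLabel_injective hm h]
  exact Finset.sum_congr rfl fun c _ =>
    (if_pos ⟨good_ker_hubLabel c, connected_ker_hubLabel hm hr c⟩).symm

/-- A lower bound for the sum over connected partitions in terms of a set `S` on which `f` is
at least `ε`, and a set `Q` of finite measure with conditional probability measure `μ`. -/
lemma le_connectedSum (hm : m ≠ 0) (hq : q ≠ 0) (hr : r ≠ 0) {lam μ : Measure X} [SigmaFinite lam]
    [IsProbabilityMeasure μ] {C : ℝ≥0∞} {Q : Set X} (hQ : lam.restrict Q = C • μ)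
    {f : (n : ℕ) → (Fin n → X) → ℝ} (hf : Measurable (f (m + 1))) {ε : ℝ≥0∞}
    {S : Set (X × (Fin m → X))} (hS : MeasurableSet S)
    (hε : ∀ p ∈ S, ε ≤ ENNReal.ofReal (f (m + 1) (Fin.cons p.1 p.2))) :
    C ^ ((q + 1) * (m + 1)) * (ε ^ (4 * q + r) * ((q : ℝ≥0∞) ^ (2 * r)
        * pathWeight S μ (Measure.pi fun _ => μ) ^ (q + r)))
      ≤ connectedSum lam f fun _ : HubRow q r => m + 1 := by
  refine le_trans ?_ (sum_weight_le_connectedSum hm hr lam f)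
  have hcardR : Fintype.card (HubRow q r) = 4 * q + r := by
    simp; ring
  have hcardV : Fintype.card (HubVar q m) = (q + 1) * (m + 1) := by
    simp; ring
  have h1 : ∀ c : Fin r → Fin q × Fin q, C ^ ((q + 1) * (m + 1)) *
      ∫⁻ y : HubVar q m → X, rowProd f (fun _ : HubRow q r => m + 1) (fun i => y (hubLabel m c i))
        ∂(Measure.pi fun _ => μ)
      ≤ weight lam (Setoid.ker (hubLabel m c)) (rowProd f fun _ : HubRow q r => m + 1) := by
    intro c
    rw [weight_eq_of_surjective (hubLabel_surjective hq c) fun _ _ => Iff.rfl, ← hcardV,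
      ← smul_eq_mul, ← lintegral_smul_measure, ← pi_eq_smul hQ, ← Measure.restrict_pi_pi]
    exact setLIntegral_le_lintegral _ _
  refine le_trans ?_ (Finset.sum_le_sum fun c _ => h1 c)
  rw [← Finset.mul_sum]
  refine mul_le_mul_right ?_ _
  have h2 : ∀ (c : Fin r → Fin q × Fin q)
      (t : (X × (Fin m → X)) × ((Fin q → X) × (Fin q → Fin m → X))),
      ε ^ (4 * q + r) * ∏ ρ : HubRow q r,
        edge S ((leftVertex c ρ).elim t.1.1 t.2.1) ((rightVertex c ρ).elim t.1.2 t.2.2)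
      ≤ rowProd f (fun _ : HubRow q r => m + 1) (fun i => hubValue t (hubLabel m c i)) := by
    intro c t
    rw [← hcardR, ← Finset.card_univ, ← Finset.prod_const, ← Finset.prod_mul_distrib, rowProd]
    refine Finset.prod_le_prod' fun ρ _ => ?_
    have h3 : (fun j => hubValue t (hubLabel m c ⟨ρ, j⟩))
        = Fin.cons ((leftVertex c ρ).elim t.1.1 t.2.1) ((rightVertex c ρ).elim t.1.2 t.2.2) := by
      funext j
      cases j using Fin.cases <;> rfl
    rw [h3]
    by_cases h : ((leftVertex c ρ).elim t.1.1 t.2.1, (rightVertex c ρ).elim t.1.2 t.2.2) ∈ S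
    · rw [edge, Set.indicator_of_mem h, Pi.one_apply, mul_one]
      exact hε _ h
    · rw [edge, Set.indicator_of_notMem h, mul_zero]
      exact zero_le
  have h4 : ∀ c : Fin r → Fin q × Fin q,
      ∫⁻ t, ε ^ (4 * q + r) * ∏ ρ : HubRow q r,
        edge S ((leftVertex c ρ).elim t.1.1 t.2.1) ((rightVertex c ρ).elim t.1.2 t.2.2)
        ∂((μ.prod (Measure.pi fun _ => μ)).prod
        ((Measure.pi fun _ => μ).prod (Measure.pi fun _ => Measure.pi fun _ => μ)))
      ≤ ∫⁻ y : HubVar q m → X, rowProd f (fun _ : HubRow q r => m + 1)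
        (fun i => y (hubLabel m c i)) ∂(Measure.pi fun _ => μ) := by
    intro c
    have h6 : Measurable fun y : HubVar q m → X =>
        rowProd f (fun _ : HubRow q r => m + 1) (fun i => y (hubLabel m c i)) :=
      (measurable_rowProd fun _ => hf).comp (by fun_prop)
    rw [← (measurePreserving_hubValue μ).lintegral_comp h6]
    exact lintegral_mono (h2 c)
  refine le_trans ?_ (Finset.sum_le_sum fun c _ => h4 c)
  have h5 : ∀ c : Fin r → Fin q × Fin q, Measurable
      fun t : (X × (Fin m → X)) × ((Fin q → X) × (Fin q → Fin m → X)) => ∏ ρ : HubRow q r,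
        edge S ((leftVertex c ρ).elim t.1.1 t.2.1) ((rightVertex c ρ).elim t.1.2 t.2.2) :=
    fun c => Finset.measurable_fun_prod _ fun ρ _ => measurable_edge_elim hS _ _
  simp_rw [fun c => lintegral_const_mul (μ := (μ.prod (Measure.pi fun _ => μ)).prod
    ((Measure.pi fun _ => μ).prod (Measure.pi fun _ => Measure.pi fun _ => μ)))
    (ε ^ (4 * q + r)) (h5 c)]
  rw [← Finset.mul_sum, ← lintegral_finsetSum _ fun c _ => h5 c, lintegral_prod _
    (Finset.measurable_fun_sum _ fun c _ => h5 c).aemeasurable]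
  refine mul_le_mul_right ((le_lintegral_hub hS hq r).trans (le_of_eq ?_)) _
  exact lintegral_congr fun p₀ => lintegral_congr fun p => (sum_prod_edge (p₀, p)).symm

end Hub

/-! ### The lower bound -/

/-- A non-negative function that is not almost everywhere zero is bounded below on a set of
positive measure for a normalised restriction of the measure. -/
lemma exists_level {lam : Measure X} [SigmaFinite lam] {m : ℕ} {g : (Fin (m + 1) → X) → ℝ}
    (hg : Measurable g) (hpos : Measure.pi (fun _ => lam) {x | 0 < g x} ≠ 0) :
    ∃ (Q : Set X) (ε : ℝ), 0 < ε ∧ lam Q ≠ 0 ∧ lam Q ≠ ∞ ∧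
      MeasurableSet {p : X × (Fin m → X) | ε ≤ g (Fin.cons p.1 p.2)} ∧
      (lam[|Q].prod (Measure.pi fun _ => lam[|Q]))
        {p : X × (Fin m → X) | ε ≤ g (Fin.cons p.1 p.2)} ≠ 0 := by
  obtain ⟨N, hN⟩ : ∃ N : ℕ, Measure.pi (fun _ => lam) ({x | 1 / ((N : ℝ) + 1) ≤ g x} ∩
      Set.univ.pi fun _ => spanningSets lam N) ≠ 0 := by
    by_contra! h
    refine hpos (measure_mono_null ?_ (measure_iUnion_null h))
    intro x hx
    obtain ⟨N₁, h1⟩ := exists_nat_one_div_lt (show 0 < g x from hx)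
    have h2 : ∃ N₂, N₁ ≤ N₂ ∧ ∀ i, x i ∈ spanningSets lam N₂ :=
      ⟨max N₁ (Finset.univ.sup fun i => spanningSetsIndex lam (x i)), le_max_left _ _, fun i =>
        monotone_spanningSets lam (le_max_of_le_right (Finset.le_sup
          (f := fun i => spanningSetsIndex lam (x i)) (Finset.mem_univ i)))
          (mem_spanningSetsIndex lam (x i))⟩
    obtain ⟨N₂, h3, h4⟩ := h2
    refine Set.mem_iUnion.2 ⟨N₂, ?_, fun i _ => h4 i⟩
    exact (Nat.one_div_le_one_div h3).trans h1.le
  set Q := spanningSets lam N with hQ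
  have hQtop : lam Q ≠ ∞ := (measure_spanningSets_lt_top lam N).ne
  have hQ0 : lam Q ≠ 0 := by
    intro h
    refine hN (measure_mono_null Set.inter_subset_right ?_)
    rw [Measure.pi_pi]
    simp [h]
  have := cond_isProbabilityMeasure_of_finite hQ0 hQtop
  have hC : lam.restrict Q = lam Q • lam[|Q] := by
    rw [ProbabilityTheory.cond, smul_smul, ENNReal.mul_inv_cancel hQ0 hQtop, one_smul]
  have hcons : Measurable fun p : X × (Fin m → X) => (Fin.cons p.1 p.2 : Fin (m + 1) → X) := by
    refine measurable_pi_lambda _ fun j => ?_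
    cases j using Fin.cases <;> simp only [Fin.cons_zero, Fin.cons_succ] <;> fun_prop
  have hS : MeasurableSet {p : X × (Fin m → X) | 1 / ((N : ℝ) + 1) ≤ g (Fin.cons p.1 p.2)} :=
    measurableSet_le measurable_const (hg.comp hcons)
  refine ⟨Q, 1 / ((N : ℝ) + 1), by positivity, hQ0, hQtop, hS, fun h => hN ?_⟩
  have hmp := measurePreserving_piFinSuccAbove (fun _ : Fin (m + 1) => lam[|Q]) 0
  rw [← hmp.measure_preimage hS.nullMeasurableSet] at h
  rw [← Measure.restrict_apply (measurableSet_le measurable_const hg), Measure.restrict_pi_pi,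
    pi_eq_smul hC, Measure.smul_apply, smul_eq_mul]
  refine mul_eq_zero_of_right _ (Eq.trans ?_ h)
  congr 1
  ext x
  have : (Fin.cons (x 0) (fun j => x ((0 : Fin (m + 1)).succAbove j)) : Fin (m + 1) → X) = x := by
    funext j
    cases j using Fin.cases <;> simp
  change _ ↔ _ ≤ g (Fin.cons (x 0) (fun j => x ((0 : Fin (m + 1)).succAbove j)))
  rw [this]
  rfl

/-- With `q` the integer part of `(k + 1) / 2` and `r = 6 k - 4 q`, the number `q ^ (2 r)` of
choices of the free rows is at least `(6 k)! k!` up to an exponential factor. -/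
lemma factorial_mul_factorial_le {k : ℕ} (hk : 1 ≤ k) :
    (6 * k)! * k ! ≤ 720 ^ (6 * k) * ((k + 1) / 2) ^ (2 * (6 * k - 4 * ((k + 1) / 2))) := by
  rcases lt_or_ge k 4 with h | h
  · interval_cases k <;> simp [Nat.factorial]
  set q := (k + 1) / 2 with hq
  have h1 : (6 * k)! ≤ (6 * k) ^ (6 * k) := Nat.factorial_le_pow _
  have h2 : k ! ≤ k ^ k := Nat.factorial_le_pow _
  calc (6 * k)! * k ! ≤ (6 * k) ^ (6 * k) * k ^ k := Nat.mul_le_mul h1 h2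
    _ = (6 ^ 6) ^ k * k ^ (7 * k) := by
        rw [mul_pow, ← pow_mul, mul_assoc, ← pow_add]; congr 2; ring
    _ ≤ (6 ^ 6) ^ k * (2 * q) ^ (7 * k) := by gcongr; omega
    _ = (6 ^ 6 * 2 ^ 7) ^ k * q ^ (7 * k) := by
        rw [mul_pow 2, mul_pow _ _ k, ← pow_mul 2]; ring
    _ ≤ (720 ^ 6) ^ k * q ^ (2 * (6 * k - 4 * q)) := by
        refine Nat.mul_le_mul (Nat.pow_le_pow_left (by norm_num) k)
          (Nat.pow_le_pow_right (by omega) (by omega))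
    _ = _ := by rw [← pow_mul]

/-- The sum over connected partitions of `ℓ = 6 k` rows grows at least as fast as `ℓ! k!`, up to
exponential factors, because the number `q ^ (2 r)` of choices of the free rows does so for `q`
about `k / 2` and `r` about `4 k`. -/
theorem exists_le_connectedSum {lam : Measure X} [SigmaFinite lam]
    {f : (n : ℕ) → (Fin n → X) → ℝ} {n₀ : ℕ} (hn₀ : 2 ≤ n₀) (hf : Measurable (f n₀))
    (h0 : ∀ x, 0 ≤ f n₀ x) (hpos : 0 < eLpNorm (f n₀) 2 (Measure.pi fun _ : Fin n₀ => lam)) :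
    ∃ c : ℝ, 0 < c ∧ ∀ k : ℕ, 1 ≤ k → ∃ (R : Type) (_ : Fintype R) (_ : DecidableEq R),
      Fintype.card R = 6 * k ∧
      ENNReal.ofReal (((6 * k)! * k ! : ℝ) / 720 ^ (6 * k) * c ^ (6 * k))
        ≤ connectedSum lam f fun _ : R => n₀ := by
  obtain ⟨m, rfl⟩ : ∃ m, n₀ = m + 1 := ⟨n₀ - 1, by omega⟩
  have hm : m ≠ 0 := by omega
  have hsupp : Measure.pi (fun _ => lam) {x | 0 < f (m + 1) x} ≠ 0 := by
    intro h
    refine hpos.ne' ((eLpNorm_eq_zero_iff hf.aestronglyMeasurable (by simp)).2 ?_)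
    rw [measure_eq_zero_iff_ae_notMem] at h
    filter_upwards [h] with x hx
    exact le_antisymm (not_lt.1 hx) (h0 x)
  obtain ⟨Q, ε, hε, hQ0, hQtop, hS, hSpos⟩ := exists_level hf hsupp
  have := cond_isProbabilityMeasure_of_finite hQ0 hQtop
  have hC : lam.restrict Q = lam Q • lam[|Q] := by
    rw [ProbabilityTheory.cond, smul_smul, ENNReal.mul_inv_cancel hQ0 hQtop, one_smul]
  set S := {p : X × (Fin m → X) | ε ≤ f (m + 1) (Fin.cons p.1 p.2)} with hSdef
  have hw := pathWeight_ne_zero hS hSpos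
  set w := pathWeight S lam[|Q] (Measure.pi fun _ => lam[|Q]) with hwdef
  -- Here `e` is a common lower bound for all bases of the powers that occur; it is at most `1`
  -- so that exponents may be increased.
  set e : ℝ≥0∞ := min (min (lam Q) (ENNReal.ofReal ε)) (min w 1) with he
  have he0 : e ≠ 0 := by
    rw [he, ← pos_iff_ne_zero]
    simp [pos_iff_ne_zero, hQ0, hw, hε]
  have he1 : e ≤ 1 := (min_le_right _ _).trans (min_le_right _ _)
  set E : ℝ≥0∞ := e ^ (2 * (m + 1) + 12) with hE
  have hE1 : E ≤ 1 := pow_le_one' he1 _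
  have hEtop : E ≠ ∞ := (hE1.trans_lt ENNReal.one_lt_top).ne
  have hE0 : E ≠ 0 := pow_ne_zero _ he0
  refine ⟨E.toReal, ENNReal.toReal_pos hE0 hEtop, fun k hk => ?_⟩
  set q := (k + 1) / 2 with hq
  set r := 6 * k - 4 * q with hr
  have hq0 : q ≠ 0 := by omega
  refine ⟨HubRow q r, inferInstance, inferInstance, by simp; omega, ?_⟩
  have hmain := le_connectedSum hm hq0 (by omega : r ≠ 0) hC hf hS fun p hp =>
    ENNReal.ofReal_le_ofReal (show ε ≤ f (m + 1) (Fin.cons p.1 p.2) from hp)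
  refine le_trans ?_ hmain
  have h1 : ENNReal.ofReal (((6 * k)! * k ! : ℝ) / 720 ^ (6 * k) * E.toReal ^ (6 * k))
      ≤ E ^ k * (q : ℝ≥0∞) ^ (2 * r) := by
    have h2 : ((6 * k)! * k ! : ℝ) / 720 ^ (6 * k) ≤ (q : ℝ) ^ (2 * r) := by
      rw [div_le_iff₀' (by positivity)]
      exact_mod_cast factorial_mul_factorial_le hk
    have h3 : E.toReal ^ (6 * k) ≤ E.toReal ^ k :=
      pow_le_pow_of_le_one ENNReal.toReal_nonneg
        (ENNReal.toReal_le_of_le_ofReal zero_le_one (by simpa using hE1)) (by omega)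
    calc _ ≤ ENNReal.ofReal ((q : ℝ) ^ (2 * r) * E.toReal ^ k) :=
          ENNReal.ofReal_le_ofReal (by gcongr)
      _ = E ^ k * (q : ℝ≥0∞) ^ (2 * r) := by
          rw [mul_comm, ENNReal.ofReal_mul (by positivity), ENNReal.ofReal_pow (by positivity),
            ENNReal.ofReal_pow (by positivity), ENNReal.ofReal_toReal hEtop,
            ENNReal.ofReal_natCast]
  refine h1.trans ?_
  have hpow : ∀ (x : ℝ≥0∞) (a b : ℕ), e ≤ x → a ≤ b → e ^ b ≤ x ^ a := fun x a b hx hab =>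
    (pow_le_pow_right_of_le_one' he1 hab).trans (pow_le_pow_left' hx a)
  have e1 := hpow (lam Q) ((q + 1) * (m + 1)) (2 * k * (m + 1))
    ((min_le_left _ _).trans (min_le_left _ _)) (Nat.mul_le_mul_right _ (by omega))
  have e2 := hpow (ENNReal.ofReal ε) (4 * q + r) (6 * k)
    ((min_le_left _ _).trans (min_le_right _ _)) (by omega)
  have e3 := hpow w (q + r) (6 * k) ((min_le_right _ _).trans (min_le_left _ _)) (by omega)
  calc E ^ k * (q : ℝ≥0∞) ^ (2 * r)
      = e ^ (2 * k * (m + 1)) * (e ^ (6 * k) * ((q : ℝ≥0∞) ^ (2 * r) * e ^ (6 * k))) := by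
        rw [hE]; ring
    _ ≤ _ := by gcongr

/-! ### Exponential moments -/

open Filter Topology

/-- The negative part of an odd power of `x` is compared with the positive part, and this with the
exponential function. -/
lemma abs_pow_odd_le {s x : ℝ} (hs : 0 < s) {j : ℕ} (hj : Odd j) :
    |x| ^ j ≤ 2 * (j ! / s ^ j) * Real.exp (s * x) - x ^ j := by
  rcases le_total 0 x with hx | hx
  · rw [abs_of_nonneg hx]
    have h := Real.pow_div_factorial_le_exp (s * x) (by positivity) j
    have h2 : x ^ j ≤ j ! / s ^ j * Real.exp (s * x) := by
      calc x ^ j = j ! / s ^ j * ((s * x) ^ j / j !) := by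
            rw [mul_pow]; field_simp
        _ ≤ _ := by gcongr
    linarith
  · rw [abs_of_nonpos hx, hj.neg_pow]
    have : 0 ≤ 2 * (j ! / s ^ j) * Real.exp (s * x) := by positivity
    linarith

/-- If `E exp (s Y)` is finite and all moments are non-negative, then the even moments satisfy
the bound `(2k+1)! / s ^ (2k)` up to a constant: the odd moments of the negative part are
dominated by those of the positive part. -/
lemma integral_even_pow_le {Ω : Type*} [MeasurableSpace Ω] {P : Measure Ω} {Y : Ω → ℝ}
    (hint : ∀ k : ℕ, Integrable (fun ω => Y ω ^ k) P) (hnonneg : ∀ k : ℕ, 0 ≤ ∫ ω, Y ω ^ k ∂P)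
    {s : ℝ} (hs : 0 < s) (hexp : Integrable (fun ω => Real.exp (s * Y ω)) P) {k : ℕ} (hk : 1 ≤ k) :
    ∫ ω, Y ω ^ (2 * k) ∂P ≤ 2 * (s + 1 / s) * (∫ ω, Real.exp (s * Y ω) ∂P)
      * ((2 * k + 1)! / s ^ (2 * k)) := by
  obtain ⟨k, rfl⟩ : ∃ j, k = j + 1 := ⟨k - 1, by omega⟩
  have hpt : ∀ x : ℝ, x ^ (2 * (k + 1)) ≤ 2 * (s + 1 / s) * ((2 * (k + 1) + 1)! / s ^ (2 * (k + 1)))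
      * Real.exp (s * x) - x ^ (2 * k + 1) - x ^ (2 * k + 3) := by
    intro x
    have h1 := abs_pow_odd_le (x := x) hs (j := 2 * k + 1) ⟨k, rfl⟩
    have h2 := abs_pow_odd_le (x := x) hs (j := 2 * k + 3) ⟨k + 1, by ring⟩
    have h3 : x ^ (2 * (k + 1)) ≤ |x| ^ (2 * k + 1) + |x| ^ (2 * k + 3) := by
      have h4 : x ^ (2 * (k + 1)) = |x| ^ (2 * k + 2) := by
        exact ((even_two_mul (k + 1)).pow_abs x).symm
      rw [h4]
      rcases le_total |x| 1 with h | h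
      · exact (pow_le_pow_of_le_one (abs_nonneg x) h (by omega)).trans
          (le_add_of_nonneg_right (by positivity))
      · exact (pow_le_pow_right₀ h (by omega)).trans (le_add_of_nonneg_left (by positivity))
    have h5 : ((2 * k + 1)! : ℝ) / s ^ (2 * k + 1) ≤ s * ((2 * k + 3)! / s ^ (2 * k + 2)) := by
      calc ((2 * k + 1)! : ℝ) / s ^ (2 * k + 1) ≤ (2 * k + 3)! / s ^ (2 * k + 1) := by
            gcongr; omega
        _ = _ := by rw [pow_succ s (2 * k + 1)]; field_simp
    have h6 : ((2 * k + 3)! : ℝ) / s ^ (2 * k + 3) = 1 / s * ((2 * k + 3)! / s ^ (2 * k + 2)) := by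
      rw [pow_succ s (2 * k + 2)]; field_simp
    have h7 := mul_le_mul_of_nonneg_right h5 (Real.exp_nonneg (s * x))
    rw [h6] at h2
    have e1 : 2 * (k + 1) + 1 = 2 * k + 3 := by ring
    have e2 : 2 * (k + 1) = 2 * k + 2 := by ring
    rw [e2] at h3
    rw [e1, e2]
    linarith
  have h := integral_mono (hint _) (((hexp.const_mul _).sub (hint _)).sub (hint _)) fun ω =>
    hpt (Y ω)
  rw [integral_sub' ((hexp.const_mul _).sub (hint _)) (hint _), integral_sub' (hexp.const_mul _)
    (hint _), integral_const_mul] at h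
  have h1 := hnonneg (2 * k + 1)
  have h2 := hnonneg (2 * k + 3)
  linarith

/-- Non-negative moments that grow like `ℓ! (ℓ / 6)!` are incompatible with finite exponential
moments. -/
lemma lintegral_exp_eq_top {Ω : Type*} [MeasurableSpace Ω] {P : Measure Ω} {Y : Ω → ℝ}
    (hY : AEMeasurable Y P) (hint : ∀ k : ℕ, Integrable (fun ω => Y ω ^ k) P)
    (hnonneg : ∀ k : ℕ, 0 ≤ ∫ ω, Y ω ^ k ∂P) {c : ℝ} (hc : 0 < c)
    (hlow : ∀ k : ℕ, 1 ≤ k → ((6 * k)! * k ! : ℝ) / 720 ^ (6 * k) * c ^ (6 * k)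
      ≤ ∫ ω, Y ω ^ (6 * k) ∂P) {s : ℝ} (hs : 0 < s) :
    ∫⁻ ω, ENNReal.ofReal (Real.exp (s * Y ω)) ∂P = ∞ := by
  by_contra htop
  have hexp : Integrable (fun ω => Real.exp (s * Y ω)) P := by
    refine ⟨(Real.measurable_exp.comp_aemeasurable (hY.const_mul s)).aestronglyMeasurable, ?_⟩
    rw [hasFiniteIntegral_iff_ofReal (Eventually.of_forall fun _ => Real.exp_nonneg _)]
    exact lt_top_iff_ne_top.2 htop
  set D := 2 * (s + 1 / s) * (∫ ω, Real.exp (s * Y ω) ∂P) with hD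
  have hD0 : 0 ≤ D := mul_nonneg (by positivity) (integral_nonneg fun _ => Real.exp_nonneg _)
  set a := (c * s / 720) ^ 6 with ha
  have ha0 : 0 < a := by positivity
  have hbound : ∀ k : ℕ, 1 ≤ k → (k ! : ℝ) ≤ D * (7 / a) ^ k := by
    intro k hk
    have h1 := (hlow k hk).trans
      (by simpa only [← mul_assoc, Nat.reduceMul] using
        integral_even_pow_le hint hnonneg hs hexp (k := 3 * k) (by omega))
    rw [← hD, Nat.factorial_succ] at h1
    have h2 : ((6 * k + 1 : ℕ) : ℝ) ≤ 7 ^ k := by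
      have := one_add_mul_le_pow (a := (6 : ℝ)) (by norm_num) k
      norm_num at this
      push_cast
      linarith
    have h3 : ((6 * k)! : ℝ) * (k ! * a ^ k) ≤ (6 * k)! * (D * 7 ^ k) := by
      calc ((6 * k)! : ℝ) * (k ! * a ^ k)
          = ((6 * k)! * k ! : ℝ) / 720 ^ (6 * k) * c ^ (6 * k) * s ^ (6 * k) := by
            rw [ha, ← pow_mul, div_pow, mul_pow]; ring
        _ ≤ D * (((6 * k + 1) * (6 * k)! : ℕ) / s ^ (6 * k)) * s ^ (6 * k) := by gcongr
        _ = (6 * k)! * (D * ((6 * k + 1 : ℕ) : ℝ)) := by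
            push_cast; field_simp
        _ ≤ _ := by gcongr
    have h4 := le_of_mul_le_mul_left h3 (by positivity)
    rw [div_pow, mul_div_assoc', le_div_iff₀ (by positivity)]
    exact h4
  have hlim := (FloorSemiring.tendsto_pow_div_factorial_atTop (7 / a)).const_mul D
  rw [mul_zero] at hlim
  obtain ⟨k, hk, h1⟩ := ((hlim.eventually_lt_const one_pos).and (eventually_ge_atTop 1)).exists
  rw [mul_div_assoc', div_lt_one (by positivity)] at hk
  exact absurd (hbound k h1) (not_le.2 hk)

/-! ### The chaos series -/

section Chaos

variable {Ω : Type*} [MeasurableSpace Ω] {P : Measure Ω} {lam : Measure X} {η : Ω → Measure X}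

lemma connectedSum_le_cumulantSum (lam : Measure X) (f : (n : ℕ) → (Fin n → X) → ℝ) {n₀ N : ℕ}
    (hn₀ : 1 ≤ n₀) (hN : n₀ ≤ N) (R : Type) [Fintype R] [DecidableEq R] :
    connectedSum lam f (fun _ : R => n₀) ≤ cumulantSum lam f N R := by
  obtain ⟨j, rfl⟩ : ∃ j, n₀ = j + 1 := ⟨n₀ - 1, by omega⟩
  exact Finset.single_le_sum
    (f := fun n : R → Fin N => connectedSum lam f fun r => (n r : ℕ) + 1)
    (fun _ _ => zero_le) (Finset.mem_univ fun _ : R => (⟨j, by omega⟩ : Fin N))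

variable [IsProbabilityMeasure P] [SigmaFinite lam] (hη : IsPoissonProcess P lam η)
  {f : (n : ℕ) → (Fin n → X) → ℝ}
  (hf : ∀ n, 1 ≤ n → Measurable (f n)) (h0 : ∀ n : ℕ, 1 ≤ n → ∀ x : Fin n → X, 0 ≤ f n x)
  (hint : ∀ (ℓ : ℕ), 1 ≤ ℓ → ∀ n : Fin ℓ → ℕ, (∀ i, 1 ≤ n i) →
      ∀ σ : Setoid ((i : Fin ℓ) × Fin (n i)), NonFlat σ →
        blockIntegral lam σ (identify σ (tensor fun i x => |f (n i) x|)) < ∞)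
  (hmom : ∀ ℓ : ℕ, 1 ≤ ℓ → ∫⁻ ω, (∑' n : ℕ,
      ENNReal.ofReal |wienerIto lam (n + 1) (f (n + 1)) (η ω)|) ^ ℓ ∂P < ∞)
  {F : Ω → ℝ}
  (hF : ∀ᵐ ω ∂P, HasSum (fun n : ℕ => wienerIto lam (n + 1) (f (n + 1)) (η ω)) (F ω))

include hη hf h0 hint hmom hF

lemma tendsto_moments : AEMeasurable F P ∧ ∀ k : ℕ, Integrable (fun ω => F ω ^ k) P ∧
    Tendsto (fun N : ℕ => ∫ ω, partialChaos lam f N (η ω) ^ k ∂P) atTop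
      (𝓝 (∫ ω, F ω ^ k ∂P)) :=
  tendsto_integral_sum_pow
    (fun _ => aemeasurable_wienerIto hη hf h0 hint (Nat.le_add_left 1 _)) hmom hF

lemma integral_pow_nonneg (k : ℕ) : 0 ≤ ∫ ω, F ω ^ k ∂P := by
  refine ge_of_tendsto' ((tendsto_moments hη hf h0 hint hmom hF).2 k).2 fun N => ?_
  have h := (partialChaos_pow hη hf h0 hint N (Fin k)).2.2
  rw [Fintype.card_fin] at h
  rw [← h]
  exact ENNReal.toReal_nonneg

/-- Both the moments and the cumulants dominate each single sum over connected partitions. -/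
lemma le_moment_and_le_cumulant {n₀ : ℕ} (hn₀ : 1 ≤ n₀) {R : Type} [Fintype R] [DecidableEq R]
    {s : ℕ} (hR : Fintype.card R = s + 1) {L : ℝ}
    (hL : ENNReal.ofReal L ≤ connectedSum lam f fun _ : R => n₀) :
    L ≤ ∫ ω, F ω ^ (s + 1) ∂P ∧ (cumulant P (s + 1) F).im = 0 ∧
      L ≤ (cumulant P (s + 1) F).re := by
  obtain ⟨hFm, hFk⟩ := tendsto_moments hη hf h0 hint hmom hF
  have hN : ∀ N, n₀ ≤ N → L ≤ ∫ ω, partialChaos lam f N (η ω) ^ (s + 1) ∂P ∧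
      L ≤ cumulantSeq (fun k => ∫ ω, partialChaos lam f N (η ω) ^ k ∂P) s := by
    intro N hN
    obtain ⟨-, hfin, hM⟩ := partialChaos_pow hη hf h0 hint N R
    obtain ⟨hle, hK⟩ := cumulantSum_eq_cumulantSeq hη hf h0 hint N R hR
    have h1 := hL.trans (connectedSum_le_cumulantSum lam f hn₀ hN R)
    rw [← hR, ← hM, ← hK, ← ENNReal.ofReal_le_iff_le_toReal hfin,
      ← ENNReal.ofReal_le_iff_le_toReal (ne_top_of_le_ne_top hfin hle)]
    exact ⟨h1.trans hle, h1⟩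
  rw [cumulant_eq_cumulantSeq hFm (fun k => (hFk k).1) s, Complex.ofReal_re, Complex.ofReal_im]
  refine ⟨ge_of_tendsto (hFk (s + 1)).2 ?_, rfl,
    ge_of_tendsto (tendsto_cumulantSeq (fun k => (hFk k).2) s) ?_⟩
  · filter_upwards [eventually_ge_atTop n₀] with N h using (hN N h).1
  · filter_upwards [eventually_ge_atTop n₀] with N h using (hN N h).2

end Chaos

end PoissonChaos

theorem mainTheorem7 {Ω X : Type*} [MeasurableSpace Ω] [MeasurableSpace X]
    (P : Measure Ω) [IsProbabilityMeasure P] (lam : Measure X) [SigmaFinite lam]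
    (η : Ω → Measure X) (hη : PoissonChaos.IsPoissonProcess P lam η)
    (f : (n : ℕ) → (Fin n → X) → ℝ)
    (hf : ∀ n : ℕ, 1 ≤ n → PoissonChaos.IsSymmL1 lam n (f n))
    (hint : ∀ (ℓ : ℕ), 1 ≤ ℓ → ∀ n : Fin ℓ → ℕ, (∀ i, 1 ≤ n i) →
      ∀ σ : Setoid ((i : Fin ℓ) × Fin (n i)), PoissonChaos.NonFlat σ →
        PoissonChaos.blockIntegral lam σ
          (PoissonChaos.identify σ (PoissonChaos.tensor fun i x => |f (n i) x|)) < ∞)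
    (hmom : ∀ ℓ : ℕ, 1 ≤ ℓ →
      ∫⁻ ω, (∑' n : ℕ,
        ENNReal.ofReal |PoissonChaos.wienerIto lam (n + 1) (f (n + 1)) (η ω)|) ^ ℓ ∂P < ∞)
    (F : Ω → ℝ)
    (hF : ∀ᵐ ω ∂P,
      HasSum (fun n : ℕ => PoissonChaos.wienerIto lam (n + 1) (f (n + 1)) (η ω)) (F ω))
    (hnonneg : ∀ n : ℕ, 1 ≤ n → ∀ x : Fin n → X, 0 ≤ f n x)
    (n₀ : ℕ) (hn₀ : 2 ≤ n₀)
    (hpos : 0 < eLpNorm (f n₀) 2 (Measure.pi fun _ : Fin n₀ => lam)) :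
    (∀ s : ℝ, 0 < s → ∫⁻ ω, ENNReal.ofReal (Real.exp (s * F ω)) ∂P = ∞) ∧
    ∃ c : ℝ, 0 < c ∧ ∀ ℓ : ℕ, 1 ≤ ℓ → 6 ∣ ℓ →
      ((ℓ ! : ℝ) * ((ℓ / 6) ! : ℝ) / (6 ! : ℝ) ^ ℓ) * c ^ ℓ ≤ ∫ ω, F ω ^ ℓ ∂P ∧
      (PoissonChaos.cumulant P ℓ F).im = 0 ∧
      ((ℓ ! : ℝ) * ((ℓ / 6) ! : ℝ) / (6 ! : ℝ) ^ ℓ) * c ^ ℓ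
        ≤ (PoissonChaos.cumulant P ℓ F).re := by
  have hfm : ∀ n, 1 ≤ n → Measurable (f n) := fun n hn => (hf n hn).measurable
  obtain ⟨c, hc, hlow⟩ := PoissonChaos.exists_le_connectedSum hn₀ (hfm n₀ (by omega))
    (hnonneg n₀ (by omega)) hpos
  have hbound : ∀ k : ℕ, 1 ≤ k →
      ((6 * k)! * k ! : ℝ) / 720 ^ (6 * k) * c ^ (6 * k) ≤ ∫ ω, F ω ^ (6 * k) ∂P ∧
      (PoissonChaos.cumulant P (6 * k) F).im = 0 ∧
      ((6 * k)! * k ! : ℝ) / 720 ^ (6 * k) * c ^ (6 * k)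
        ≤ (PoissonChaos.cumulant P (6 * k) F).re := by
    intro k hk
    obtain ⟨R, _, _, hR, hL⟩ := hlow k hk
    have hs : 6 * k = (6 * k - 1) + 1 := by omega
    have h := PoissonChaos.le_moment_and_le_cumulant hη hfm hnonneg hint hmom hF
      (by omega : 1 ≤ n₀) (hR.trans hs) hL
    rwa [← hs] at h
  obtain ⟨hFm, hFk⟩ := PoissonChaos.tendsto_moments hη hfm hnonneg hint hmom hF
  refine ⟨fun s hs => PoissonChaos.lintegral_exp_eq_top hFm (fun k => (hFk k).1)
    (PoissonChaos.integral_pow_nonneg hη hfm hnonneg hint hmom hF) hc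
    (fun k hk => (hbound k hk).1) hs, c, hc, ?_⟩
  rintro ℓ hℓ ⟨k, rfl⟩
  have h6 : ((6 ! : ℕ) : ℝ) = 720 := by norm_num [Nat.factorial]
  rw [h6, Nat.mul_div_cancel_left k (by norm_num)]
  exact hbound k (by omega)
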